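/- Let $\varepsilon>0$, $p=\tfrac12e^{\sqrt\varepsilon}$, $q=\tfrac12e^{-\sqrt\varepsilon}$, let $\mu_A,\mu_B\in[\sqrt{q/p},\sqrt{p/q}]$, and set $$\alpha=\frac{p^{3/2}(\sqrt p-\mu_A\sqrt q)}{p-q},\quad \gamma=\frac{q^{3/2}(\sqrt q-\mu_A\sqrt p)}{q-p},\quad \beta=\frac{p^{3/2}(\sqrt p-\mu_B\sqrt q)}{p-q},\quad \delta=\frac{q^{3/2}(\sqrt q-\mu_B\sqrt p)}{q-p}.$$ ASEP-H (on the sites $\{1,2,\dots\}$) and ASEP-B (on $\{1,\dots,N\}$, $N\ge1$) are the exclusion processes $\eta_t(x)\in\{\pm1\}$ ($+1$: occupied, $-1$: empty) in which particles jump from $x$ to $x+1$ at rate $c^R(\eta_t,x)=\frac p4(1+\eta_t(x))(1-\eta_t(x+1))$ and from $x+1$ to $x$ at rate $c^L(\eta_t,x)=\frac q4(1-\eta_t(x))(1+\eta_t(x+1))$, are created and annihilated at the site $1$ at rates $r_A^+=\frac\alpha2(1-\eta_t(1))$ and $r_A^-=\frac\gamma2(1+\eta_t(1))$, and, for ASEP-B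 only, are created and annihilated at the site $N$ at rates $r_B^+=\frac\delta2(1-\eta_t(N))$ and $r_B^-=\frac\beta2(1+\eta_t(N))$, all events being independent. The processes are realized by the graphical construction: each move is attempted at the ring times of its own Poisson clock (of rate $p$, $q$, $\alpha$, $\gamma$, $\delta$, $\beta$ respectively) and is carried out if it is possible; the clocks are independent Poisson processes relative to a filtration $\mathcal F$ to which $\eta$ is adapted, and the initial configuration is arbitrary. Let $h_t(0)$ be twice the number of particles annihilated minus the number of particles created through the left reservoir (at the site $1$) during $[0,t]$, let $h_t(x)=h_t(0)+\sum_{y=1}^x\eta_t(y)$, and let $$Z_t(x)=e^{-\lambda h_t(x)+\nu t},\qquad \lambda=\tfrac12\log\tfrac qp,\qquad \nu=p+q-2\sqrt{pq}.$$ Write $\Delta f(x)=f(x-1)-2f(x)+f(x+1)$. (H) For ASEP-H, extend $Z_t$ to $x=-1$ by the Robin boundary condition $Z_t(-1)=\mu_AZ_t(0)$. Then there are $\mathcal F$-martingales $M(x)$, $x\ge0$, with $M_0(x)=0$, that are square integrable and satisfy $$dZ_t(x)=\tfrac12\Delta Z_t(x)\,dt+dM_t(x)\qquad(x\ge0),$$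 and their predictable brackets are given by $$\tfrac{d}{dt}\langle M(x),M(y)\rangle_t=0\quad(x\ne y),$$ $$\tfrac{d}{dt}\langle M(x),M(x)\rangle_t=\Big(\big(\tfrac qp-1\big)^2c^R(\eta_t,x)+\big(\tfrac pq-1\big)^2c^L(\eta_t,x)\Big)Z_t(x)^2\quad(x>0),$$ $$\tfrac{d}{dt}\langle M(0),M(0)\rangle_t=\Big(\big(\tfrac qp-1\big)^2r_A^+(\eta_t(1))+\big(\tfrac pq-1\big)^2r_A^-(\eta_t(1))\Big)Z_t(0)^2 .$$ (B) For ASEP-B, extend $Z_t$ to $x=-1$ and $x=N+1$ by the Robin boundary conditions $Z_t(-1)=\mu_AZ_t(0)$ and $Z_t(N+1)=\mu_BZ_t(N)$. Then the same holds for $x,y\in\{0,\dots,N\}$: there are square integrable $\mathcal F$-martingales $M(x)$ with $M_0(x)=0$ and $dZ_t(x)=\tfrac12\Delta Z_t(x)\,dt+dM_t(x)$ for $0\le x\le N$, the brackets are as in (H) for $x\ne y$, for $0<x<N$ and for $x=0$, and $$\tfrac{d}{dt}\langle M(N),M(N)\rangle_t=\Big(\big(\tfrac qp-1\big)^2r_B^-(\eta_t(N))+\big(\tfrac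 pq-1\big)^2r_B^+(\eta_t(N))\Big)Z_t(N)^2 .$$ Here $dZ_t(x)=\tfrac12\Delta Z_t(x)\,dt+dM_t(x)$ is meant in integrated form, and $\frac{d}{dt}\langle M,M'\rangle_t=g_t$ means that $\langle M,M'\rangle_t=\int_0^tg_s\,ds$ and that $g_t$ is the right derivative of the bracket at every $t\ge0$. -/

import Mathlib

open MeasureTheory ProbabilityTheory Set Filter Topology
open scoped NNReal ENNReal

noncomputable section

namespace OpenASEP

/-! ### The open exclusion process

`N : ℕ∞` is the number of sites. The sites are the integers `x ≥ 1` with `x ≤ N`: `N = ⊤` is the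
half line and a finite `N` is the bounded interval. The bond `x` (`0 ≤ x ≤ N`) lies
between the positions `x` and `x + 1`. A move across the bond `0` is an exchange with the left
reservoir and a move across the bond `N` (for finite `N`) an exchange with the right reservoir.
A configuration is a function `σ : ℕ → ℤ`, of which only the values at the sites matter:
`σ x = 1` if `x` is occupied and `σ x = -1` if `x` is empty. -/

/-- The direction in which a particle moves. -/
inductive Dir
  | right
  | left

/-- The bonds `0 ≤ x ≤ N`. -/
abbrev Bond (N : ℕ∞) : Type := {x : ℕ // (x : ℕ∞) ≤ N}

/-- Whether a particle can cross the bond `x` in a given direction. A move needs a particle at its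
origin and a hole at its destination, when these are sites; a reservoir imposes no condition.
So a right move across the bond `0` is a creation at the site `1`, a left one an annihilation at the
site `1`; a right move across the bond `N` is an annihilation at the site `N`, a left one a creation
at the site `N`. -/
def CanMove (N : ℕ∞) (x : ℕ) (σ : ℕ → ℤ) : Dir → Prop
  | .right => (0 < x → σ x = 1) ∧ ((x : ℕ∞) < N → σ (x + 1) = -1)
  | .left => (0 < x → σ x = -1) ∧ ((x : ℕ∞) < N → σ (x + 1) = 1)

/-- The rate at which a move is attempted: `p` and `q` for the right and left jumps between two
sites, `α` and `γ` for creation and annihilation at the site `1`, `δ` and `β` for creation and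
annihilation at the site `N`. -/
def attemptRate (N : ℕ∞) (p q α β γ δ : ℝ) (x : ℕ) : Dir → ℝ
  | .right => if x = 0 then α else if (x : ℕ∞) = N then β else p
  | .left => if x = 0 then γ else if (x : ℕ∞) = N then δ else q

variable {Ω : Type*} {mΩ : MeasurableSpace Ω}

/-- `C` is a family of mutually independent Poisson processes of rates `r i`, relative to the
filtration `F`. -/
structure IsPoissonClocks {ι : Type*} (P : Measure Ω) (F : Filtration ℝ≥0 mΩ) (r : ι → ℝ≥0)
    (C : ι → ℝ≥0 → Ω → ℕ) : Prop where
  zero : ∀ i ω, C i 0 ω = 0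
  mono : ∀ i ω, Monotone fun t => C i t ω
  rightCts : ∀ i ω t, ContinuousWithinAt (fun s => C i s ω) (Ici t) t
  adapted : ∀ i, Adapted F (C i)
  law : ∀ i s t, s ≤ t →
    P.map (fun ω => C i t ω - C i s ω) = poissonMeasure (r i * (t - s))
  indep : ∀ s t, s ≤ t → iIndepFun (fun i ω => C i t ω - C i s ω) P
  indepPast : ∀ s t, s ≤ t →
    Indep (MeasurableSpace.comap (fun ω i => C i t ω - C i s ω) MeasurableSpace.pi) (F s) P

/-- The clock with counting path `c` rings at time `t`. -/
def Rings (c : ℝ≥0 → ℕ) (t : ℝ≥0) : Prop := 0 < t ∧ ∀ s < t, c s < c t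

/-- A particle crosses the bond `x` in the direction `d` at time `t`: the clock rings and the
move is possible in the configuration just before `t`. -/
def Crosses (N : ℕ∞) (C : ℕ → Dir → ℝ≥0 → Ω → ℕ) (η : ℝ≥0 → Ω → ℕ → ℤ) (x : ℕ) (d : Dir)
    (ω : Ω) (t : ℝ≥0) : Prop :=
  Rings (fun s => C x d s ω) t ∧ ∀ᶠ s in 𝓝[<] t, CanMove N x (η s ω) d

/-- The number of particles that cross the bond `x` in the direction `d` during `[0,t]`. -/
def crossings (N : ℕ∞) (C : ℕ → Dir → ℝ≥0 → Ω → ℕ) (η : ℝ≥0 → Ω → ℕ → ℤ) (x : ℕ) (d : Dir)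
    (t : ℝ≥0) (ω : Ω) : ℕ :=
  {s | s ≤ t ∧ Crosses N C η x d ω s}.ncard

/-- The net number of particles that cross the bond `x` from left to right during `[0,t]`. -/
def current (N : ℕ∞) (C : ℕ → Dir → ℝ≥0 → Ω → ℕ) (η : ℝ≥0 → Ω → ℕ → ℤ) (x : ℕ)
    (t : ℝ≥0) (ω : Ω) : ℤ :=
  (crossings N C η x .right t ω : ℤ) - crossings N C η x .left t ω

/-- The exclusion process with open boundaries, in its graphical construction: each
move is attempted at the ring times of its own independent Poisson clock, and is carried out
exactly when it is possible. -/
structure IsOpenASEP (N : ℕ∞) (P : Measure Ω) (F : Filtration ℝ≥0 mΩ) (p q α β γ δ : ℝ)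
    (C : ℕ → Dir → ℝ≥0 → Ω → ℕ) (η : ℝ≥0 → Ω → ℕ → ℤ) : Prop where
  clocks : IsPoissonClocks P F
    (fun i : Bond N × Dir => (attemptRate N p q α β γ δ i.1 i.2).toNNReal) (fun i => C i.1 i.2)
  spin : ∀ t ω (x : ℕ), 1 ≤ x → (x : ℕ∞) ≤ N → η t ω x = 1 ∨ η t ω x = -1
  adapted : ∀ x : ℕ, 1 ≤ x → (x : ℕ∞) ≤ N → Adapted F fun t ω => η t ω x
  evolution : ∀ t ω (x : ℕ), ((x + 1 : ℕ) : ℕ∞) ≤ N →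
    η t ω (x + 1) = η 0 ω (x + 1) + 2 * (current N C η x t ω - current N C η (x + 1) t ω)

/-- ASEP on the half line `{1, 2, …}`; there is no right reservoir. -/
def IsASEPH (P : Measure Ω) (F : Filtration ℝ≥0 mΩ) (p q α γ : ℝ)
    (C : ℕ → Dir → ℝ≥0 → Ω → ℕ) (η : ℝ≥0 → Ω → ℕ → ℤ) : Prop :=
  IsOpenASEP ⊤ P F p q α 0 γ 0 C η

/-- ASEP on the bounded interval `{1, …, N}`. -/
def IsASEPB (N : ℕ) (P : Measure Ω) (F : Filtration ℝ≥0 mΩ) (p q α β γ δ : ℝ)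
    (C : ℕ → Dir → ℝ≥0 → Ω → ℕ) (η : ℝ≥0 → Ω → ℕ → ℤ) : Prop :=
  IsOpenASEP N P F p q α β γ δ C η

/-- The height function: `h_t(0)` is twice the number of annihilations minus the number of creations
through the left reservoir during `[0,t]`, and `h_t(x) = h_t(0) + ∑_{y=1}^x η_t(y)`. -/
def height (N : ℕ∞) (C : ℕ → Dir → ℝ≥0 → Ω → ℕ) (η : ℝ≥0 → Ω → ℕ → ℤ)
    (t : ℝ≥0) (ω : Ω) (x : ℕ) : ℤ :=
  2 * ((crossings N C η 0 .left t ω : ℤ) - crossings N C η 0 .right t ω)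
    + ∑ y ∈ Finset.Icc 1 x, η t ω y

/-! ### Rates and parameters -/

/-- Rate of the jump from `x` to `x + 1`. -/
def cR (p : ℝ) (σ : ℕ → ℤ) (x : ℕ) : ℝ := p / 4 * (1 + σ x) * (1 - σ (x + 1))

/-- Rate of the jump from `x + 1` to `x`. -/
def cL (q : ℝ) (σ : ℕ → ℤ) (x : ℕ) : ℝ := q / 4 * (1 - σ x) * (1 + σ (x + 1))

/-- Creation rate at a boundary site with occupation variable `s`. -/
def rPlus (a : ℝ) (s : ℤ) : ℝ := a / 2 * (1 - s)

/-- Annihilation rate at a boundary site with occupation variable `s`. -/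
def rMinus (a : ℝ) (s : ℤ) : ℝ := a / 2 * (1 + s)

/-- The weakly asymmetric jump rate to the right. -/
def pW (ε : ℝ) : ℝ := 1 / 2 * Real.exp (√ε)

/-- The weakly asymmetric jump rate to the left. -/
def qW (ε : ℝ) : ℝ := 1 / 2 * Real.exp (-√ε)

/-- The rate `p^{3/2} (√p - μ √q) / (p - q)`: `α` for `μ = μ_A` and `β` for `μ = μ_B`. -/
def rateP (p q μ : ℝ) : ℝ := p ^ (3 / 2 : ℝ) * (√p - μ * √q) / (p - q)

/-- The rate `q^{3/2} (√q - μ √p) / (q - p)`: `γ` for `μ = μ_A` and `δ` for `μ = μ_B`. -/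
def rateQ (p q μ : ℝ) : ℝ := q ^ (3 / 2 : ℝ) * (√q - μ * √p) / (q - p)

/-- The Gärtner transform `e^{-λ h + ν t}` with `λ = ½ log (q/p)` and `ν = p + q - 2 √(pq)`. -/
def gartner (p q : ℝ) (h : ℝ≥0 → Ω → ℕ → ℤ) (t : ℝ≥0) (ω : Ω) (x : ℕ) : ℝ :=
  Real.exp (-(1 / 2 * Real.log (q / p)) * h t ω x + (p + q - 2 * √(p * q)) * t)

/-! ### The discrete stochastic heat equation -/

/-- The discrete Laplacian on `ℤ`. -/
def lap (f : ℤ → ℝ) (x : ℤ) : ℝ := f (x - 1) - 2 * f x + f (x + 1)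

/-- `∫₀ᵗ g_s ds`, path by path. -/
def timeIntegral (g : ℝ≥0 → Ω → ℝ) (t : ℝ≥0) (ω : Ω) : ℝ :=
  ∫ s in (0 : ℝ)..t, g s.toNNReal ω

/-- `dZ_t(x) = ½ ΔZ_t(x) dt + dM_t(x)` at the point `x`, in integrated form, with `M` a martingale
started from `0`. -/
structure SolvesDSHE (P : Measure Ω) (F : Filtration ℝ≥0 mΩ) (Z : ℝ≥0 → Ω → ℤ → ℝ) (x : ℤ)
    (M : ℝ≥0 → Ω → ℝ) : Prop where
  martingale : Martingale M F P
  zero : ∀ ω, M 0 ω = 0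
  integrable : ∀ ω (t : ℝ≥0),
    IntervalIntegrable (fun s : ℝ => 1 / 2 * lap (Z s.toNNReal ω) x) volume 0 t
  equation : ∀ t ω,
    Z t ω x = Z 0 ω x + timeIntegral (fun s ω => 1 / 2 * lap (Z s ω) x) t ω + M t ω

/-- `A` is the predictable bracket `⟨M, M'⟩` of the square integrable martingales `M`, `M'`:
the predictable right-continuous process of locally finite variation with `A_0 = 0` for which
`M M' - A` is a martingale. -/
structure IsBracket (P : Measure Ω) (F : Filtration ℝ≥0 mΩ) (M M' A : ℝ≥0 → Ω → ℝ) : Prop where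
  memLp : ∀ t, MemLp (M t) 2 P
  memLp' : ∀ t, MemLp (M' t) 2 P
  predictable : IsStronglyPredictable F A
  zero : ∀ ω, A 0 ω = 0
  rightCts : ∀ ω t, ContinuousWithinAt (fun s => A s ω) (Ici t) t
  finVar : ∀ ω, LocallyBoundedVariationOn (fun t => A t ω) univ
  martingale : Martingale (fun t ω => M t ω * M' t ω - A t ω) F P

/-- `d/dt ⟨M, M'⟩_t = g_t`: the bracket is `∫₀ᵗ g_s ds`, and `g` is its right derivative at
every time. -/
structure HasBracketRate (P : Measure Ω) (F : Filtration ℝ≥0 mΩ) (M M' g : ℝ≥0 → Ω → ℝ) :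
    Prop where
  integrable : ∀ ω (t : ℝ≥0),
    IntervalIntegrable (fun s : ℝ => g s.toNNReal ω) volume 0 t
  bracket : IsBracket P F M M' (timeIntegral g)
  rightDeriv : ∀ ω (t : ℝ≥0),
    HasDerivWithinAt (fun s : ℝ => timeIntegral g s.toNNReal ω) (g t ω) (Ici (t : ℝ)) t

end OpenASEP

end

/-!
A particle that crosses the bond `x` from left to right lowers the height at `x` by two, and no
other move changes it. So the Gärtner transform `Z_t(x)` grows at the rate `ν` between the
crossings of the bond `x` and is multiplied by `q / p` at a crossing to the right and by `p / q`
at one to the left (`IsOpenASEP.gartner_eq`). A crossing happens at a ring of the corresponding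
clock, if the move is possible. Hence the relative drift of `Z(x)` is `ν` plus the sum over both
clocks of rate times relative jump times the indicator that the move is possible; in the bulk
this is half the discrete Laplacian of `Z` divided by `Z`, and at the ends it is so by the choice
of the boundary rates (`IsOpenASEP.half_lap_eq`). The martingale `M(x)` is `Z(x)` minus its initial
value and its integrated drift. Martingales at two positions jump at the rings of different clocks and
are orthogonal, and the bracket of `M(x)` with itself collects rate times squared jump.

Stochastic integration is avoided by an elementary calculus of jump expansions. For finitely many
clocks, `HasJumpExpansion` says that the increments of a process over `[s, s']` are
`∑ i, H i * (increment of the clock i) + G * (s' - s)` up to an error of second order in the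
length `h` of the interval and the number `n` of rings, namely `h ^ 2 + h * n + n * (n - 1)` times
a constant that is exponential in the number of rings up to the time `s'`. These expansions hold
for every `ω`. They are stable under products, with the additional jump term `H i * H' i`
(`HasJumpExpansion.mul`), and under time integration
(`IsRingLipschitz.hasJumpExpansion_timeIntegral`). The crossings have one
(`IsOpenASEP.hasJumpExpansion_crossings`): if there is at most one ring in the interval, then
whether the move is possible at the ring time is decided by the configuration at time `s`.

The increments of the clocks are independent of the past, and the second order error has a mean of
order `h ^ 2` by the explicit generating function of the Poisson law. So an adapted process with
`G + ∑ i, r i * H i = 0` has mean increments of order `h ^ 2` on every event of the past, and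
summing over fine partitions shows that it is a martingale (`HasJumpExpansion.martingale`). This
is applied to `M(x)` and to the products `M(x) M(y)` minus their compensators
(`HasJumpExpansion.hasBracketRate`). Adaptedness, which is required without a completion of the
filtration, is obtained from limits over partitions that hold for every `ω`.
-/

namespace OpenASEP

/-! ### Ring times of a counting path -/

lemma Rings.lt {c : ℝ≥0 → ℕ} {s t : ℝ≥0} (h : Rings c t) (hst : s < t) : c s < c t := h.2 s hst

/-- The ring times of a monotone path in `(s, t]` are at most as many as the increments: the path
itself maps them injectively into `(c s, c t]`. -/
lemma finite_rings {c : ℝ≥0 → ℕ} (hm : Monotone c) (s t : ℝ≥0) :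
    {τ | τ ∈ Ioc s t ∧ Rings c τ}.Finite ∧
      {τ | τ ∈ Ioc s t ∧ Rings c τ}.ncard ≤ c t - c s := by
  have hmaps : MapsTo c {τ | τ ∈ Ioc s t ∧ Rings c τ} (Finset.Ioc (c s) (c t) : Set ℕ) := by
    rintro τ ⟨⟨h1, h2⟩, h3⟩
    simpa using ⟨h3.lt h1, hm h2⟩
  have hinj : InjOn c {τ | τ ∈ Ioc s t ∧ Rings c τ} := by
    rintro τ ⟨_, h⟩ τ' ⟨_, h'⟩ he
    rcases lt_trichotomy τ τ' with hl | hl | hl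
    · exact absurd he (h'.lt hl).ne
    · exact hl
    · exact absurd he (h.lt hl).ne'
  refine ⟨Set.Finite.of_injOn hmaps hinj (Finset.finite_toSet _), ?_⟩
  have := Set.ncard_le_ncard_of_injOn c hmaps hinj (Finset.finite_toSet _)
  simpa [Set.ncard_coe_finset] using this

/-- A right-continuous path that increases over `(s, t]` rings at the first time at which it exceeds
its value at `s`. -/
lemma exists_rings {c : ℝ≥0 → ℕ} (hm : Monotone c)
    (hr : ∀ t, ContinuousWithinAt c (Ici t) t) {s t : ℝ≥0} (h : c s < c t) :
    ∃ τ ∈ Ioc s t, Rings c τ := by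
  set S : Set ℝ≥0 := {r | c s < c r}
  have htS : t ∈ S := h
  set τ := sInf S
  have hτt : τ ≤ t := csInf_le (OrderBot.bddBelow _) htS
  have hτS : c s < c τ := by
    have h1 : ∀ᶠ r in 𝓝[≥] τ, c r = c τ := by
      simpa using (hr τ).eventually (show ∀ᶠ y in 𝓝 (c τ), y = c τ by simp)
    obtain ⟨u, hu, hsub⟩ := (mem_nhdsGE_iff_exists_Ico_subset' (lt_add_one τ)).1 h1
    obtain ⟨r, hrS, hru⟩ := exists_lt_of_csInf_lt ⟨t, htS⟩ (show sInf S < u from hu)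
    have h2 : c r = c τ := hsub ⟨csInf_le (OrderBot.bddBelow _) hrS, hru⟩
    exact h2 ▸ hrS
  have hsτ : s < τ := by
    by_contra! hc
    exact absurd (hm hc) (not_le.2 hτS)
  refine ⟨τ, ⟨hsτ, hτt⟩, (bot_le : (0 : ℝ≥0) ≤ s).trans_lt hsτ, fun r hrτ => lt_of_le_of_lt ?_ hτS⟩
  by_contra! hc
  exact absurd (csInf_le (OrderBot.bddBelow S) hc) (not_le.2 hrτ)

/-! ### Crossings -/

variable {Ω : Type*} {mΩ : MeasurableSpace Ω} {N : ℕ∞} {P : Measure Ω} {F : Filtration ℝ≥0 mΩ}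
  {p q α β γ δ : ℝ} {C : ℕ → Dir → ℝ≥0 → Ω → ℕ} {η : ℝ≥0 → Ω → ℕ → ℤ}

/-- The crossings during `(s, t]` add to those during `[0, s]`. -/
lemma crossings_eq_add {x : ℕ} {d : Dir} {ω : Ω} (hm : Monotone fun t => C x d t ω)
    {s t : ℝ≥0} (hst : s ≤ t) :
    crossings N C η x d t ω =
      crossings N C η x d s ω + {τ | τ ∈ Ioc s t ∧ Crosses N C η x d ω τ}.ncard := by
  have hfin : ∀ u v : ℝ≥0, {τ | τ ∈ Ioc u v ∧ Crosses N C η x d ω τ}.Finite := fun u v =>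
    (finite_rings hm u v).1.subset fun τ hτ => ⟨hτ.1, hτ.2.1⟩
  have h0 : ∀ v : ℝ≥0, {τ | τ ≤ v ∧ Crosses N C η x d ω τ}
      = {τ | τ ∈ Ioc 0 v ∧ Crosses N C η x d ω τ} := fun v => by
    ext τ
    exact ⟨fun h => ⟨⟨h.2.1.1, h.1⟩, h.2⟩, fun h => ⟨h.1.2, h.2⟩⟩
  unfold crossings
  rw [← Set.ncard_union_eq _ (h0 s ▸ hfin 0 s) (hfin s t)]
  · congr 1
    ext τ
    constructor
    · rintro ⟨h1, h2⟩
      rcases le_or_gt τ s with h | h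
      · exact Or.inl ⟨h, h2⟩
      · exact Or.inr ⟨⟨h, h1⟩, h2⟩
    · rintro (⟨h1, h2⟩ | ⟨h1, h2⟩)
      · exact ⟨h1.trans hst, h2⟩
      · exact ⟨h1.2, h2⟩
  · exact Set.disjoint_left.2 fun τ h h' => absurd h.1 (not_le.2 h'.1.1)

lemma crossings_mono {x : ℕ} {d : Dir} {ω : Ω} (hm : Monotone fun t => C x d t ω) :
    Monotone fun t => crossings N C η x d t ω := fun s t hst => by
  simp only [crossings_eq_add (N := N) (η := η) hm hst]
  exact Nat.le_add_right _ _

lemma crossings_sub_le {x : ℕ} {d : Dir} {ω : Ω} (hm : Monotone fun t => C x d t ω)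
    {s t : ℝ≥0} (hst : s ≤ t) :
    crossings N C η x d t ω ≤ crossings N C η x d s ω + (C x d t ω - C x d s ω) := by
  rw [crossings_eq_add hm hst]
  have h := finite_rings hm s t
  gcongr
  refine (Set.ncard_le_ncard (?_ : _ ⊆ {τ | τ ∈ Ioc s t ∧ Rings (fun r => C x d r ω) τ})
    h.1).trans h.2
  exact fun τ hτ => ⟨hτ.1, hτ.2.1⟩

lemma crossings_zero (x : ℕ) (d : Dir) (ω : Ω) : crossings N C η x d 0 ω = 0 := by
  unfold crossings
  rw [Set.ncard_eq_zero (Set.Finite.subset (finite_singleton 0) fun τ hτ => by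
    simpa using hτ.1)]
  ext τ
  simp only [mem_ofPred_eq, mem_empty_iff_false, iff_false, not_and]
  exact fun h h' => absurd h (not_le.2 h'.1.1)

namespace IsOpenASEP

lemma clock_mono (h : IsOpenASEP N P F p q α β γ δ C η) {x : ℕ} (hx : (x : ℕ∞) ≤ N) (d : Dir)
    (ω : Ω) : Monotone fun t => C x d t ω := h.clocks.mono (⟨x, hx⟩, d) ω

lemma clock_rightCts (h : IsOpenASEP N P F p q α β γ δ C η) {x : ℕ} (hx : (x : ℕ∞) ≤ N)
    (d : Dir) (ω : Ω) (t : ℝ≥0) : ContinuousWithinAt (fun s => C x d s ω) (Ici t) t :=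
  h.clocks.rightCts (⟨x, hx⟩, d) ω t

lemma crossings_eq_of_clock_eq (h : IsOpenASEP N P F p q α β γ δ C η) {x : ℕ}
    (hx : (x : ℕ∞) ≤ N) {d : Dir} {ω : Ω} {s t : ℝ≥0} (hst : s ≤ t)
    (he : C x d t ω = C x d s ω) :
    crossings N C η x d t ω = crossings N C η x d s ω := by
  refine le_antisymm ?_ (crossings_mono (h.clock_mono hx d ω) hst)
  simpa [he] using crossings_sub_le (N := N) (η := η) (h.clock_mono hx d ω) hst

/-- The possibility of a move across the bond `x` can change only when one of the clocks of the
bonds up to `x + 1` rings. -/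
lemma canMove_iff (h : IsOpenASEP N P F p q α β γ δ C η) {x : ℕ} (hx : (x : ℕ∞) ≤ N)
    {ω : Ω} {s t : ℝ≥0} (hst : s ≤ t)
    (he : ∀ i : Bond N × Dir, i.1.1 ≤ x + 1 → C i.1 i.2 t ω = C i.1 i.2 s ω) (d : Dir) :
    CanMove N x (η t ω) d ↔ CanMove N x (η s ω) d := by
  have key : ∀ y : ℕ, y ≤ x → ((y + 1 : ℕ) : ℕ∞) ≤ N → η t ω (y + 1) = η s ω (y + 1) := by
    intro y hy hyN
    have hyN' : (y : ℕ∞) ≤ N := le_trans (by exact_mod_cast Nat.le_succ y) hyN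
    rw [h.evolution t ω y hyN, h.evolution s ω y hyN]
    unfold current
    rw [h.crossings_eq_of_clock_eq hyN' hst (he (⟨y, hyN'⟩, .right) (by simp; omega)),
      h.crossings_eq_of_clock_eq hyN' hst (he (⟨y, hyN'⟩, .left) (by simp; omega)),
      h.crossings_eq_of_clock_eq hyN hst (he (⟨y + 1, hyN⟩, .right) (by simp; omega)),
      h.crossings_eq_of_clock_eq hyN hst (he (⟨y + 1, hyN⟩, .left) (by simp; omega))]
  have h1 : 0 < x → η t ω x = η s ω x := fun h0 => by
    obtain ⟨y, rfl⟩ : ∃ y, x = y + 1 := ⟨x - 1, by omega⟩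
    exact key y (by omega) hx
  have h2 : (x : ℕ∞) < N → η t ω (x + 1) = η s ω (x + 1) := fun hlt =>
    key x le_rfl (by push_cast; exact Order.add_one_le_of_lt hlt)
  cases d <;> simp only [CanMove] <;>
    exact and_congr (forall_congr' fun h0 => by rw [h1 h0])
      (forall_congr' fun h0 => by rw [h2 h0])

open Classical in
/-- If the clocks of the bonds up to `x + 1` ring at one common time at most during `(s, t]`, then a
particle crosses the bond `x` exactly when the clock rings and the move is possible at time `s`. -/
lemma crossings_eq_ite (h : IsOpenASEP N P F p q α β γ δ C η) {x : ℕ} (hx : (x : ℕ∞) ≤ N)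
    {d : Dir} {ω : Ω} {s t : ℝ≥0} (hst : s ≤ t)
    (hone : ∀ i j : Bond N × Dir, i.1.1 ≤ x + 1 → j.1.1 ≤ x + 1 → ∀ τ ∈ Ioc s t, ∀ τ' ∈ Ioc s t,
      Rings (fun r => C i.1 i.2 r ω) τ → Rings (fun r => C j.1 j.2 r ω) τ' → τ = τ') :
    crossings N C η x d t ω = crossings N C η x d s ω +
      if C x d s ω < C x d t ω ∧ CanMove N x (η s ω) d then 1 else 0 := by
  by_cases hlt : C x d s ω < C x d t ω
  swap
  · rw [if_neg (fun hc => hlt hc.1), add_zero]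
    exact h.crossings_eq_of_clock_eq hx hst
      (le_antisymm (not_lt.1 hlt) (h.clock_mono hx d ω hst))
  obtain ⟨τ, hτ, hring⟩ := exists_rings (h.clock_mono hx d ω) (h.clock_rightCts hx d ω) hlt
  have hcan : ∀ r, s ≤ r → r < τ → (CanMove N x (η r ω) d ↔ CanMove N x (η s ω) d) := by
    intro r hsr hrτ
    refine h.canMove_iff hx hsr (fun i hi => ?_) d
    by_contra hne
    have hlt' : C i.1 i.2 s ω < C i.1 i.2 r ω :=
      lt_of_le_of_ne (h.clocks.mono i ω hsr) (Ne.symm hne)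
    obtain ⟨τ', hτ', hring'⟩ := exists_rings (h.clocks.mono i ω) (h.clocks.rightCts i ω) hlt'
    have := hone i (⟨x, hx⟩, d) hi (by simp) τ' ⟨hτ'.1, hτ'.2.trans (hrτ.le.trans hτ.2)⟩ τ hτ
      hring' hring
    exact absurd (this ▸ hτ'.2) (not_le.2 hrτ)
  have hev : (∀ᶠ r in 𝓝[<] τ, CanMove N x (η r ω) d) ↔ CanMove N x (η s ω) d := by
    have hne : (𝓝[<] τ).NeBot := nhdsLT_neBot_of_exists_lt ⟨s, hτ.1⟩
    have hmem : ∀ᶠ r in 𝓝[<] τ, (CanMove N x (η r ω) d ↔ CanMove N x (η s ω) d) := by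
      filter_upwards [Ioo_mem_nhdsLT hτ.1] with r hr using hcan r hr.1.le hr.2
    rw [eventually_congr hmem, eventually_const]
  rw [crossings_eq_add (h.clock_mono hx d ω) hst]
  congr 1
  have hset : {τ' | τ' ∈ Ioc s t ∧ Crosses N C η x d ω τ'}
      = if CanMove N x (η s ω) d then {τ} else ∅ := by
    ext τ'
    constructor
    · rintro ⟨h1, h2, h3⟩
      have he : τ' = τ := hone (⟨x, hx⟩, d) (⟨x, hx⟩, d) (by simp) (by simp) τ' h1 τ hτ h2 hring
      subst he
      rw [if_pos (hev.1 h3)]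
      rfl
    · split_ifs with hc
      · rintro rfl
        exact ⟨hτ, hring, hev.2 hc⟩
      · exact fun hf => hf.elim
  rw [hset]
  by_cases hc : CanMove N x (η s ω) d
  · simp [hc, hlt]
  · simp [hc]

end IsOpenASEP

end OpenASEP

namespace OpenASEP
variable {Ω : Type*} {mΩ : MeasurableSpace Ω} {N : ℕ∞} {P : Measure Ω} {F : Filtration ℝ≥0 mΩ}
  {p q α β γ δ : ℝ} {C : ℕ → Dir → ℝ≥0 → Ω → ℕ} {η : ℝ≥0 → Ω → ℕ → ℤ}

/-! ### Uniform partitions and adaptedness of the crossings -/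

/-- The `k`-th point of the partition of `[0, t]` into `m + 1` intervals of equal length. -/
noncomputable def gridPt (t : ℝ≥0) (m k : ℕ) : ℝ≥0 := t * k / (m + 1)

lemma gridPt_zero (t : ℝ≥0) (m : ℕ) : gridPt t m 0 = 0 := by simp [gridPt]

lemma gridPt_last (t : ℝ≥0) (m : ℕ) : gridPt t m (m + 1) = t := by
  simp only [gridPt]
  push_cast
  field_simp

lemma gridPt_mono (t : ℝ≥0) (m : ℕ) : Monotone (gridPt t m) := fun k l h => by
  unfold gridPt
  gcongr

lemma gridPt_le {t : ℝ≥0} {m k : ℕ} (hk : k ≤ m + 1) : gridPt t m k ≤ t :=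
  (gridPt_mono t m hk).trans (gridPt_last t m).le

lemma gridPt_succ (t : ℝ≥0) (m k : ℕ) : gridPt t m (k + 1) = gridPt t m k + t / (m + 1) := by
  simp only [gridPt]
  push_cast
  field_simp

lemma gridPt_succ_sub (t : ℝ≥0) (m k : ℕ) :
    (gridPt t m (k + 1) : ℝ) - gridPt t m k = t / (m + 1) := by
  rw [gridPt_succ]
  push_cast
  ring

lemma finite_clocks_le (N : ℕ∞) (m : ℕ) : {i : Bond N × Dir | i.1.1 ≤ m}.Finite := by
  have : Finite Dir := Finite.of_injective (fun d : Dir => match d with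
    | .right => true
    | .left => false) (by rintro (_ | _) (_ | _) <;> simp)
  refine Set.Finite.of_injOn (f := fun i : Bond N × Dir => (i.1.1, i.2))
    (t := Iic m ×ˢ univ) (fun i hi => ⟨hi, mem_univ _⟩) ?_ ((finite_Iic _).prod finite_univ)
  rintro ⟨⟨a, ha⟩, d⟩ _ ⟨⟨b, hb⟩, e⟩ _ he
  simpa using he

namespace IsOpenASEP

/-- On a fine partition, no two ring times of the clocks of the bonds up to `x + 1` lie in one
interval. -/
lemma eventually_ring_separated (h : IsOpenASEP N P F p q α β γ δ C η) (x : ℕ) (t : ℝ≥0) (ω : Ω) :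
    ∀ᶠ m : ℕ in atTop, ∀ k ≤ m, ∀ i j : Bond N × Dir, i.1.1 ≤ x + 1 → j.1.1 ≤ x + 1 →
      ∀ τ ∈ Ioc (gridPt t m k) (gridPt t m (k + 1)),
      ∀ τ' ∈ Ioc (gridPt t m k) (gridPt t m (k + 1)),
      Rings (fun r => C i.1 i.2 r ω) τ → Rings (fun r => C j.1 j.2 r ω) τ' → τ = τ' := by
  set T : Set ℝ≥0 := ⋃ i ∈ {i : Bond N × Dir | i.1.1 ≤ x + 1},
    {τ | τ ∈ Ioc 0 t ∧ Rings (fun r => C i.1 i.2 r ω) τ} with hT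
  have hI : {i : Bond N × Dir | i.1.1 ≤ x + 1}.Finite := finite_clocks_le N (x + 1)
  have hTf : T.Finite := hI.biUnion fun i _ => (finite_rings (h.clocks.mono i ω) 0 t).1
  have hlim : Tendsto (fun m : ℕ => (t : ℝ) / (m + 1)) atTop (𝓝 0) :=
    tendsto_const_div_atTop_nhds_zero_nat (t : ℝ) |>.comp (tendsto_add_atTop_nat 1)
      |>.congr fun m => by simp
  have hsep : ∀ᶠ m : ℕ in atTop, ∀ u ∈ T ×ˢ T, u.1 ≠ u.2 → (t : ℝ) / (m + 1) < dist u.1 u.2 := by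
    rw [(hTf.prod hTf).eventually_all]
    rintro ⟨u, v⟩ -
    by_cases huv : u = v
    · simp [huv]
    · filter_upwards [hlim.eventually (gt_mem_nhds (dist_pos.2 huv))] with m hm using fun _ => hm
  filter_upwards [hsep] with m hm k hk i j hi hj τ hτ τ' hτ' hr hr'
  by_contra hne
  have hle : gridPt t m (k + 1) ≤ t := gridPt_le (by omega)
  have h1 := hm (τ, τ') ⟨mem_biUnion hi ⟨⟨hr.1, hτ.2.trans hle⟩, hr⟩,
    mem_biUnion hj ⟨⟨hr'.1, hτ'.2.trans hle⟩, hr'⟩⟩ hne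
  have h2 := gridPt_succ_sub t m k
  rw [NNReal.dist_eq] at h1
  have a1 : (gridPt t m k : ℝ) < τ := hτ.1
  have a2 : (τ : ℝ) ≤ gridPt t m (k + 1) := hτ.2
  have a3 : (gridPt t m k : ℝ) < τ' := hτ'.1
  have a4 : (τ' : ℝ) ≤ gridPt t m (k + 1) := hτ'.2
  have := abs_le.2 (⟨by linarith, by linarith⟩ :
    -((t : ℝ) / (m + 1)) ≤ (τ : ℝ) - τ' ∧ (τ : ℝ) - τ' ≤ (t : ℝ) / (m + 1))
  simp only at h1
  linarith

lemma measurableSet_canMove (h : IsOpenASEP N P F p q α β γ δ C η) {x : ℕ} (hx : (x : ℕ∞) ≤ N)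
    (t : ℝ≥0) (d : Dir) : MeasurableSet[F t] {ω | CanMove N x (η t ω) d} := by
  have h1 : ∀ a : ℤ, MeasurableSet[F t] {ω | 0 < x → η t ω x = a} := fun a => by
    by_cases h0 : 0 < x
    · simp only [h0, true_imp_iff]
      exact h.adapted x h0 hx t (measurableSet_singleton a)
    · simp [h0]
  have h2 : ∀ a : ℤ, MeasurableSet[F t] {ω | (x : ℕ∞) < N → η t ω (x + 1) = a} := fun a => by
    by_cases h0 : (x : ℕ∞) < N
    · simp only [h0, true_imp_iff]
      exact h.adapted (x + 1) (by omega)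
        (by push_cast; exact Order.add_one_le_of_lt h0) t (measurableSet_singleton a)
    · simp [h0]
  cases d
  · exact (h1 1).inter (h2 (-1))
  · exact (h1 (-1)).inter (h2 1)

open Classical in
/-- The number of crossings is adapted: along fine partitions it is the number of the intervals in
which the clock rings and at whose left end the move is possible. -/
lemma measurable_crossings (h : IsOpenASEP N P F p q α β γ δ C η) {x : ℕ} (hx : (x : ℕ∞) ≤ N)
    (d : Dir) : Adapted F (crossings N C η x d) := by
  intro t
  have hlim : Tendsto (fun (m : ℕ) (ω : Ω) => ∑ k ∈ Finset.range (m + 1),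
      if C x d (gridPt t m k) ω < C x d (gridPt t m (k + 1)) ω
        ∧ CanMove N x (η (gridPt t m k) ω) d then 1 else 0) atTop
      (𝓝 (crossings N C η x d t)) := by
    rw [tendsto_pi_nhds]
    intro ω
    refine tendsto_const_nhds.congr' ?_
    filter_upwards [h.eventually_ring_separated x t ω] with m hm
    have key : ∀ k ≤ m + 1, crossings N C η x d (gridPt t m k) ω = ∑ k ∈ Finset.range k,
        if C x d (gridPt t m k) ω < C x d (gridPt t m (k + 1)) ω
          ∧ CanMove N x (η (gridPt t m k) ω) d then 1 else 0 := by
      intro k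
      induction k with
      | zero => simp [gridPt_zero, crossings_zero]
      | succ k ih =>
        intro hk
        rw [Finset.sum_range_succ, ← ih (by omega)]
        exact h.crossings_eq_ite hx (gridPt_mono t m k.le_succ) (hm k (by omega))
    rw [← key (m + 1) le_rfl, gridPt_last]
  refine @measurable_of_tendsto_metrizable _ _ (F t) _ _ _ _ _ _ (fun m => ?_) hlim
  refine Finset.measurable_sum _ fun k hk => ?_
  have hk' : k + 1 ≤ m + 1 := by simpa using hk
  refine Measurable.ite ?_ measurable_const measurable_const
  have hC : ∀ l ≤ m + 1, Measurable[F t] (C x d (gridPt t m l)) := fun l hl =>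
    (h.clocks.adapted (⟨x, hx⟩, d) (gridPt t m l)).mono (F.mono (gridPt_le hl)) le_rfl
  exact (@measurableSet_lt _ _ _ _ _ (F t) _ _ _ _ _ (hC k (by omega)) (hC (k + 1) hk')).inter
    (F.mono (gridPt_le (by omega)) _ (h.measurableSet_canMove hx _ d))

end IsOpenASEP
end OpenASEP

namespace OpenASEP

/-! ### Jump expansions driven by counting paths -/

/-- The second order error over a time `h` during which the clocks ring `n` times. -/
def secondOrder (h n : ℝ) : ℝ := h ^ 2 + h * n + n * (n - 1)

lemma secondOrder_nonneg {h : ℝ} (hh : 0 ≤ h) {n : ℕ} : 0 ≤ secondOrder h n := by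
  unfold secondOrder
  rcases Nat.eq_zero_or_pos n with rfl | hn
  · simp [sq_nonneg]
  · have : (1 : ℝ) ≤ n := by exact_mod_cast hn
    have : 0 ≤ (n : ℝ) * (n - 1) := mul_nonneg (by linarith) (by linarith)
    positivity

/-- A factor that is affine in the exponent is absorbed by a larger base. -/
lemma affine_mul_pow_le {K L : ℝ} (hK : 1 ≤ K) (hL : 0 ≤ L) {n : ℝ} {k : ℕ} (hn : n ≤ k) :
    (K + n) * L ^ (k + 1) ≤ (2 * K * L) ^ (k + 1) := by
  rw [mul_pow]
  gcongr
  have h1 : (1 + k : ℝ) ≤ 2 ^ (k + 1) := by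
    have : 1 + k ≤ 2 ^ (k + 1) := by
      have := Nat.lt_two_pow_self (n := k + 1)
      omega
    exact_mod_cast this
  have h2 : K ≤ K ^ (k + 1) := le_self_pow₀ hK (by omega)
  have hk : (0 : ℝ) ≤ k := k.cast_nonneg
  calc K + n ≤ (1 + k) * K := by nlinarith
    _ ≤ 2 ^ (k + 1) * K ^ (k + 1) := by gcongr
    _ = _ := (mul_pow _ _ _).symm

lemma const_mul_pow_le {K L : ℝ} (hK : 1 ≤ K) (hL : 0 ≤ L) (k : ℕ) :
    K * L ^ (k + 1) ≤ (2 * K * L) ^ (k + 1) := by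
  simpa using affine_mul_pow_le hK hL (n := 0) (k := k) k.cast_nonneg

/-- Products of jump parts: the diagonal terms give the bracket, the remaining ones are of second
order. -/
lemma abs_sum_mul_sum_sub_le {ι : Type*} (J : Finset ι) {D H H' : ι → ℝ} {A : ℝ}
    (hD0 : ∀ i ∈ J, 0 ≤ D i) (hD : ∀ i ∈ J, D i ≤ D i * D i) (hA : 0 ≤ A)
    (hH : ∀ i ∈ J, |H i| ≤ A) (hH' : ∀ i ∈ J, |H' i| ≤ A) :
    |(∑ i ∈ J, H i * D i) * (∑ i ∈ J, H' i * D i) - ∑ i ∈ J, H i * H' i * D i|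
      ≤ A ^ 2 * ((∑ i ∈ J, D i) * (∑ i ∈ J, D i - 1)) := by
  classical
  have e1 : (∑ i ∈ J, H i * D i) * (∑ i ∈ J, H' i * D i) - ∑ i ∈ J, H i * H' i * D i
      = ∑ i ∈ J, ∑ j ∈ J, H i * H' j * (D i * D j - if i = j then D i else 0) := by
    rw [Finset.sum_mul_sum, ← Finset.sum_sub_distrib]
    refine Finset.sum_congr rfl fun i hi => ?_
    simp only [mul_sub, Finset.sum_sub_distrib]
    congr 1
    · exact Finset.sum_congr rfl fun j _ => by ring
    · simp [hi]
  have e2 : (∑ i ∈ J, D i) * (∑ i ∈ J, D i - 1)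
      = ∑ i ∈ J, ∑ j ∈ J, (D i * D j - if i = j then D i else 0) := by
    rw [mul_sub, Finset.sum_mul_sum, mul_one, ← Finset.sum_sub_distrib]
    refine Finset.sum_congr rfl fun i hi => ?_
    simp [Finset.sum_sub_distrib, hi]
  rw [e1, e2, Finset.mul_sum]
  refine (Finset.abs_sum_le_sum_abs _ _).trans (Finset.sum_le_sum fun i hi => ?_)
  rw [Finset.mul_sum]
  refine (Finset.abs_sum_le_sum_abs _ _).trans (Finset.sum_le_sum fun j hj => ?_)
  have hnn : 0 ≤ D i * D j - if i = j then D i else 0 := by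
    split_ifs with hij
    · subst hij
      linarith [hD i hi]
    · simpa using mul_nonneg (hD0 i hi) (hD0 j hj)
  rw [abs_mul, abs_mul, abs_of_nonneg hnn, sq]
  gcongr
  exacts [hH i hi, hH' j hj]

/-- The product rule for jump expansions, for a single pair of times. -/
lemma abs_mul_expansion_le {ι : Type*} (J : Finset ι) {D H H' : ι → ℝ}
    {A B h T x x₁ y y₁ g g' : ℝ} {n : ℕ} (hn : ∑ i ∈ J, D i = n)
    (hD0 : ∀ i ∈ J, 0 ≤ D i) (hD : ∀ i ∈ J, D i ≤ D i * D i) (hA : 0 ≤ A) (hAB : A ≤ B)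
    (hh : 0 ≤ h) (hT : h ≤ T)
    (hx : |x| ≤ A) (hy : |y| ≤ A) (hy₁ : |y₁| ≤ B)
    (hH : ∀ i ∈ J, |H i| ≤ A) (hH' : ∀ i ∈ J, |H' i| ≤ A) (hg : |g| ≤ A) (hg' : |g'| ≤ A)
    (hE : |x₁ - x - ∑ i ∈ J, H i * D i - g * h| ≤ B * secondOrder h n)
    (hE' : |y₁ - y - ∑ i ∈ J, H' i * D i - g' * h| ≤ B * secondOrder h n) :
    |x₁ * y₁ - x * y - ∑ i ∈ J, (x * H' i + y * H i + H i * H' i) * D i - (x * g' + y * g) * h|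
      ≤ (6 + T + n) * (B * B * secondOrder h n) := by
  set E := x₁ - x - ∑ i ∈ J, H i * D i - g * h with hEd
  set E' := y₁ - y - ∑ i ∈ J, H' i * D i - g' * h with hEd'
  set S := ∑ i ∈ J, H i * D i
  set S' := ∑ i ∈ J, H' i * D i
  set w := secondOrder h n
  have hw0 : 0 ≤ w := secondOrder_nonneg hh
  have hw : h ^ 2 + h * n + n * (n - 1) = w := rfl
  have hB : 0 ≤ B := hA.trans hAB
  have hT0 : 0 ≤ T := hh.trans hT
  have hSbd : ∀ {H : ι → ℝ}, (∀ i ∈ J, |H i| ≤ A) → |∑ i ∈ J, H i * D i| ≤ A * n := by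
    intro H hH
    rw [← hn, Finset.mul_sum]
    refine (Finset.abs_sum_le_sum_abs _ _).trans (Finset.sum_le_sum fun i hi => ?_)
    rw [abs_mul, abs_of_nonneg (hD0 i hi)]
    exact mul_le_mul_of_nonneg_right (hH i hi) (hD0 i hi)
  have hS : |S| ≤ A * n := hSbd hH
  have hS' : |S'| ≤ A * n := hSbd hH'
  have hbr := abs_sum_mul_sum_sub_le J hD0 hD hA hH hH'
  rw [hn] at hbr
  have hsum : ∑ i ∈ J, (x * H' i + y * H i + H i * H' i) * D i
      = x * S' + y * S + ∑ i ∈ J, H i * H' i * D i := by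
    simp only [S, S', Finset.mul_sum, ← Finset.sum_add_distrib]
    exact Finset.sum_congr rfl fun i _ => by ring
  have hid : x₁ * y₁ - x * y - ∑ i ∈ J, (x * H' i + y * H i + H i * H' i) * D i
        - (x * g' + y * g) * h
      = x * E' + y * E + (S * S' - ∑ i ∈ J, H i * H' i * D i) + S * (g' * h) + S' * (g * h)
        + g * g' * h ^ 2 + E * (y₁ - y) + (S + g * h) * E' := by
    rw [hsum, hEd, hEd']
    ring
  have hn0 : (0 : ℝ) ≤ n := n.cast_nonneg
  have hnn : 0 ≤ (n : ℝ) * (n - 1) := by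
    have := secondOrder_nonneg le_rfl (n := n)
    simpa [secondOrder] using this
  have t1 : |x * E'| ≤ A * (B * w) := by rw [abs_mul]; gcongr
  have t2 : |y * E| ≤ A * (B * w) := by rw [abs_mul]; gcongr
  have t4 : |S * (g' * h)| ≤ A * n * (A * h) := by
    rw [abs_mul, abs_mul, abs_of_nonneg hh]; gcongr
  have t5 : |S' * (g * h)| ≤ A * n * (A * h) := by
    rw [abs_mul, abs_mul, abs_of_nonneg hh]; gcongr
  have t6 : |g * g' * h ^ 2| ≤ A * A * h ^ 2 := by
    rw [abs_mul, abs_mul, abs_of_nonneg (sq_nonneg h)]; gcongr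
  have t7 : |E * (y₁ - y)| ≤ B * w * (B + A) := by
    rw [abs_mul]
    gcongr
    exact (abs_sub _ _).trans (add_le_add hy₁ hy)
  have t8 : |(S + g * h) * E'| ≤ (A * n + A * h) * (B * w) := by
    rw [abs_mul]
    gcongr
    refine (abs_add_le _ _).trans (add_le_add hS ?_)
    rw [abs_mul, abs_of_nonneg hh]
    gcongr
  rw [hid]
  have hAA : A * A ≤ B * B := by gcongr
  have hABB : A * B ≤ B * B := by gcongr
  have u1 : A * (B * w) ≤ B * B * w := by
    rw [← mul_assoc]; gcongr
  have u2 : A ^ 2 * (n * (n - 1)) + 2 * (A * n * (A * h)) + A * A * h ^ 2 ≤ 2 * (B * B * w) := by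
    have e : A ^ 2 * (n * (n - 1)) + 2 * (A * n * (A * h)) + A * A * h ^ 2
        = A * A * (w + h * n) := by rw [← hw]; ring
    have hwn : h * n ≤ w := by rw [← hw]; linarith only [sq_nonneg h, hnn]
    rw [e]
    calc A * A * (w + h * n) ≤ B * B * (w + w) := by gcongr
      _ = _ := by ring
  have u3 : B * w * (B + A) ≤ 2 * (B * B * w) := by
    calc B * w * (B + A) ≤ B * w * (B + B) := by gcongr
      _ = _ := by ring
  have u4 : (A * n + A * h) * (B * w) ≤ (T + n) * (B * B * w) := by
    calc (A * n + A * h) * (B * w) = (n + h) * (A * B * w) := by ring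
      _ ≤ (n + T) * (B * B * w) := by gcongr
      _ = _ := by ring
  calc _ ≤ |x * E'| + |y * E| + |S * S' - ∑ i ∈ J, H i * H' i * D i| + |S * (g' * h)|
        + |S' * (g * h)| + |g * g' * h ^ 2| + |E * (y₁ - y)| + |(S + g * h) * E'| := by
        refine (abs_add_le _ _).trans ?_
        gcongr
        refine (abs_add_le _ _).trans ?_
        gcongr
        refine (abs_add_le _ _).trans ?_
        gcongr
        refine (abs_add_le _ _).trans ?_
        gcongr
        refine (abs_add_le _ _).trans ?_
        gcongr
        refine (abs_add_le _ _).trans ?_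
        gcongr
        exact abs_add_le _ _
    _ ≤ _ := by linarith only [t1, t2, hbr, t4, t5, t6, t7, t8, u1, u2, u3, u4]

end OpenASEP

namespace OpenASEP

variable {Ω ι : Type*} {J : Finset ι} {c : ι → ℝ≥0 → Ω → ℕ}

/-- The total number of rings of the clocks in `J` during `[0, t]`. -/
def totalRings (J : Finset ι) (c : ι → ℝ≥0 → Ω → ℕ) (t : ℝ≥0) (ω : Ω) : ℕ := ∑ i ∈ J, c i t ω

lemma totalRings_mono (hc : ∀ i ω, Monotone fun t => c i t ω) (ω : Ω) :
    Monotone fun t => totalRings J c t ω := fun _ _ h => Finset.sum_le_sum fun i _ => hc i ω h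

/-- The process `X` is, locally uniformly in time and uniformly on the probability space, bounded
and Lipschitz with respect to time plus the number of rings, with constants that are exponential in
the number of rings. A single base `L` serves as the constant and as the exponential rate. -/
def IsRingLipschitz (J : Finset ι) (c : ι → ℝ≥0 → Ω → ℕ) (X : ℝ≥0 → Ω → ℝ) : Prop :=
  ∀ T : ℝ≥0, ∃ L : ℝ, 1 ≤ L ∧ ∀ ω (s s' : ℝ≥0), s ≤ s' → s' ≤ T →
    |X s ω| ≤ L ^ (totalRings J c s ω + 1) ∧
    |X s' ω - X s ω| ≤ L ^ (totalRings J c s' ω + 1) *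
      ((s' - s : ℝ) + (totalRings J c s' ω - totalRings J c s ω : ℝ))

/-- The process `X` moves by `H i` at a ring of the clock `i ∈ J` and with speed `G` in between:
its increments are `∑ i, H i dc_i + G dt` up to an error of second order in the length of the time
interval and the number of rings. -/
def HasJumpExpansion (J : Finset ι) (c : ι → ℝ≥0 → Ω → ℕ) (X : ℝ≥0 → Ω → ℝ)
    (H : ι → ℝ≥0 → Ω → ℝ) (G : ℝ≥0 → Ω → ℝ) : Prop :=
  ∀ T : ℝ≥0, ∃ L : ℝ, 1 ≤ L ∧ ∀ ω (s s' : ℝ≥0), s ≤ s' → s' ≤ T →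
    |X s ω| ≤ L ^ (totalRings J c s ω + 1) ∧
    (∀ i ∈ J, |H i s ω| ≤ L ^ (totalRings J c s ω + 1)) ∧
    |G s ω| ≤ L ^ (totalRings J c s ω + 1) ∧
    |X s' ω - X s ω - ∑ i ∈ J, H i s ω * (c i s' ω - c i s ω : ℝ) - G s ω * (s' - s)| ≤
      L ^ (totalRings J c s' ω + 1) *
        secondOrder (s' - s) (totalRings J c s' ω - totalRings J c s ω)

/-- The increments of the clocks over `[s, s']` are natural numbers, so that each is at most its
square, and they add up to the number of rings. -/
lemma increments_facts (hc : ∀ i ω, Monotone fun t => c i t ω) {s s' : ℝ≥0} (h : s ≤ s') (ω : Ω) :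
    ∃ n : ℕ, (totalRings J c s' ω - totalRings J c s ω : ℝ) = n ∧
      n ≤ totalRings J c s' ω ∧
      ∑ i ∈ J, (c i s' ω - c i s ω : ℝ) = n ∧
      (∀ i ∈ J, (0 : ℝ) ≤ c i s' ω - c i s ω) ∧
      ∀ i ∈ J, (c i s' ω - c i s ω : ℝ) ≤ (c i s' ω - c i s ω : ℝ) * (c i s' ω - c i s ω) := by
  have hle := totalRings_mono (J := J) hc ω h
  have hnat : ∀ i, ∃ m : ℕ, (c i s' ω - c i s ω : ℝ) = m := fun i =>
    ⟨c i s' ω - c i s ω, by rw [Nat.cast_sub (hc i ω h)]⟩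
  refine ⟨totalRings J c s' ω - totalRings J c s ω, by rw [Nat.cast_sub hle], by omega, ?_, ?_, ?_⟩
  · rw [Nat.cast_sub hle, Finset.sum_sub_distrib]
    simp [totalRings]
  · intro i _
    obtain ⟨m, hm⟩ := hnat i
    rw [hm]
    exact m.cast_nonneg
  · intro i _
    obtain ⟨m, hm⟩ := hnat i
    rw [hm]
    exact_mod_cast Nat.le_mul_self m

lemma secondOrder_rings_nonneg (hc : ∀ i ω, Monotone fun t => c i t ω) {s s' : ℝ≥0} (h : s ≤ s')
    (ω : Ω) : 0 ≤ secondOrder ((s' : ℝ) - s) (totalRings J c s' ω - totalRings J c s ω) := by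
  obtain ⟨n, hn, -⟩ := increments_facts (J := J) hc h ω
  rw [hn]
  exact secondOrder_nonneg (sub_nonneg.2 (by exact_mod_cast h))

lemma pow_rings_mono (hc : ∀ i ω, Monotone fun t => c i t ω) {L : ℝ} (hL : 1 ≤ L) {s s' : ℝ≥0}
    (h : s ≤ s') (ω : Ω) : L ^ (totalRings J c s ω + 1) ≤ L ^ (totalRings J c s' ω + 1) :=
  pow_le_pow_right₀ hL (Nat.add_le_add_right (totalRings_mono hc ω h) 1)

lemma rings_length_nonneg (hc : ∀ i ω, Monotone fun t => c i t ω) {s s' : ℝ≥0} (h : s ≤ s')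
    (ω : Ω) : (0 : ℝ) ≤ (s' - s : ℝ) + (totalRings J c s' ω - totalRings J c s ω : ℝ) := by
  have h1 : (s : ℝ) ≤ s' := by exact_mod_cast h
  have h2 : (totalRings J c s ω : ℝ) ≤ totalRings J c s' ω := by
    exact_mod_cast totalRings_mono hc ω h
  linarith

namespace IsRingLipschitz

lemma const {X : Ω → ℝ} {K : ℝ} (hc : ∀ i ω, Monotone fun t => c i t ω)
    (hX : ∀ ω, |X ω| ≤ K) : IsRingLipschitz J c fun _ => X := by
  refine fun T => ⟨max 1 K, le_max_left _ _, fun ω s s' h _ => ⟨?_, ?_⟩⟩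
  · exact ((hX ω).trans (le_max_right _ _)).trans (le_self_pow₀ (le_max_left _ _) (by omega))
  · rw [sub_self, abs_zero]
    have := rings_length_nonneg (J := J) hc h ω
    positivity

lemma add {X Y : ℝ≥0 → Ω → ℝ} (hc : ∀ i ω, Monotone fun t => c i t ω)
    (hX : IsRingLipschitz J c X) (hY : IsRingLipschitz J c Y) :
    IsRingLipschitz J c fun t ω => X t ω + Y t ω := by
  intro T
  obtain ⟨L, hL, hX⟩ := hX T
  obtain ⟨L', hL', hY⟩ := hY T
  refine ⟨L + L', by linarith, fun ω s s' h hT => ?_⟩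
  obtain ⟨x1, x2⟩ := hX ω s s' h hT
  obtain ⟨y1, y2⟩ := hY ω s s' h hT
  have hr := rings_length_nonneg (J := J) hc h ω
  have key : ∀ k : ℕ, L ^ (k + 1) + L' ^ (k + 1) ≤ (L + L') ^ (k + 1) := fun k =>
    pow_add_pow_le (by linarith) (by linarith) (by omega)
  refine ⟨(abs_add_le _ _).trans ((add_le_add x1 y1).trans (key _)), ?_⟩
  rw [add_sub_add_comm]
  refine (abs_add_le _ _).trans ((add_le_add x2 y2).trans ?_)
  rw [← add_mul]
  exact mul_le_mul_of_nonneg_right (key _) hr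

lemma mul {X Y : ℝ≥0 → Ω → ℝ} (hc : ∀ i ω, Monotone fun t => c i t ω)
    (hX : IsRingLipschitz J c X) (hY : IsRingLipschitz J c Y) :
    IsRingLipschitz J c fun t ω => X t ω * Y t ω := by
  intro T
  obtain ⟨L, hL, hX⟩ := hX T
  obtain ⟨L', hL', hY⟩ := hY T
  refine ⟨4 * (L * L'), by nlinarith, fun ω s s' h hT => ?_⟩
  obtain ⟨x1, x2⟩ := hX ω s s' h hT
  obtain ⟨y1, y2⟩ := hY ω s s' h hT
  have x3 := (hX ω s' s' le_rfl hT).1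
  have hr := rings_length_nonneg (J := J) hc h ω
  set r := (s' - s : ℝ) + (totalRings J c s' ω - totalRings J c s ω : ℝ)
  have y3 := y1.trans (pow_rings_mono hc hL' h ω)
  have key : ∀ k : ℕ, 2 * (L * L') ^ (k + 1) ≤ (4 * (L * L')) ^ (k + 1) := fun k => by
    refine (const_mul_pow_le (by norm_num) (by positivity) k).trans (le_of_eq ?_)
    congr 1
    ring
  constructor
  · rw [abs_mul]
    calc |X s ω| * |Y s ω| ≤ L ^ (totalRings J c s ω + 1) * L' ^ (totalRings J c s ω + 1) := by
          gcongr
      _ = (L * L') ^ (totalRings J c s ω + 1) := (mul_pow _ _ _).symm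
      _ ≤ 2 * (L * L') ^ (totalRings J c s ω + 1) := by
          have : 0 ≤ (L * L') ^ (totalRings J c s ω + 1) := by positivity
          linarith
      _ ≤ _ := key _
  · have e : X s' ω * Y s' ω - X s ω * Y s ω
        = X s' ω * (Y s' ω - Y s ω) + (X s' ω - X s ω) * Y s ω := by ring
    rw [e]
    refine (abs_add_le _ _).trans ?_
    rw [abs_mul, abs_mul]
    set k := totalRings J c s' ω
    calc |X s' ω| * |Y s' ω - Y s ω| + |X s' ω - X s ω| * |Y s ω|
        ≤ L ^ (k + 1) * (L' ^ (k + 1) * r) + L ^ (k + 1) * r * L' ^ (k + 1) := by gcongr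
      _ = 2 * (L * L') ^ (k + 1) * r := by rw [mul_pow]; ring
      _ ≤ _ := mul_le_mul_of_nonneg_right (key _) hr

end IsRingLipschitz

namespace HasJumpExpansion

lemma isRingLipschitz {X G : ℝ≥0 → Ω → ℝ} {H : ι → ℝ≥0 → Ω → ℝ}
    (hc : ∀ i ω, Monotone fun t => c i t ω) (hX : HasJumpExpansion J c X H G) :
    IsRingLipschitz J c X := by
  intro T
  obtain ⟨L, hL, hX⟩ := hX T
  have hK : (1 : ℝ) ≤ 2 + T := by linarith [T.coe_nonneg]
  have hK' : (1 : ℝ) ≤ 2 * (2 + T) := by linarith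
  refine ⟨2 * (2 + T) * L, by nlinarith, fun ω s s' h hT => ?_⟩
  obtain ⟨x1, x2, x3, x4⟩ := hX ω s s' h hT
  obtain ⟨n, hn, hnk, hsum, hD0, -⟩ := increments_facts (J := J) hc h ω
  refine ⟨x1.trans (pow_le_pow_left₀ (by linarith) (by nlinarith) _), ?_⟩
  have hr := rings_length_nonneg (J := J) hc h ω
  have hA := pow_rings_mono (J := J) hc hL h ω
  rw [hn] at hr x4 ⊢
  set k := totalRings J c s' ω
  have hh : (0 : ℝ) ≤ (s' : ℝ) - s := sub_nonneg.2 (by exact_mod_cast h)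
  have hhT : (s' : ℝ) - s ≤ T := by
    have : (s' : ℝ) ≤ T := by exact_mod_cast hT
    linarith [s.coe_nonneg]
  have hn0 : (0 : ℝ) ≤ n := n.cast_nonneg
  have hB : 0 ≤ L ^ (k + 1) := by positivity
  have hS : |∑ i ∈ J, H i s ω * (c i s' ω - c i s ω : ℝ)| ≤ L ^ (k + 1) * n := by
    rw [← hsum, Finset.mul_sum]
    refine (Finset.abs_sum_le_sum_abs _ _).trans (Finset.sum_le_sum fun i hi => ?_)
    rw [abs_mul, abs_of_nonneg (hD0 i hi)]
    exact mul_le_mul_of_nonneg_right ((x2 i hi).trans hA) (hD0 i hi)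
  have hG : |G s ω * ((s' : ℝ) - s)| ≤ L ^ (k + 1) * ((s' : ℝ) - s) := by
    rw [abs_mul, abs_of_nonneg hh]
    exact mul_le_mul_of_nonneg_right (x3.trans hA) hh
  have hw : secondOrder ((s' : ℝ) - s) n ≤ (T + n) * ((s' : ℝ) - s + n) := by
    unfold secondOrder
    nlinarith
  have e : X s' ω - X s ω = (X s' ω - X s ω - ∑ i ∈ J, H i s ω * (c i s' ω - c i s ω : ℝ)
      - G s ω * (s' - s)) + ∑ i ∈ J, H i s ω * (c i s' ω - c i s ω : ℝ) + G s ω * (s' - s) := by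
    ring
  rw [e]
  calc _ ≤ L ^ (k + 1) * ((T + n) * ((s' : ℝ) - s + n)) + L ^ (k + 1) * n
        + L ^ (k + 1) * ((s' : ℝ) - s) := by
        refine (abs_add_le _ _).trans (add_le_add ((abs_add_le _ _).trans (add_le_add ?_ hS)) hG)
        exact x4.trans (mul_le_mul_of_nonneg_left hw hB)
    _ = (1 + T + n) * L ^ (k + 1) * ((s' : ℝ) - s + n) := by ring
    _ ≤ (2 + T + n) * L ^ (k + 1) * ((s' : ℝ) - s + n) := by gcongr; norm_num
    _ ≤ _ := by
        refine mul_le_mul_of_nonneg_right ?_ hr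
        exact affine_mul_pow_le hK (by linarith) (by exact_mod_cast hnk)

lemma const {X : Ω → ℝ} {K : ℝ} (hc : ∀ i ω, Monotone fun t => c i t ω)
    (hX : ∀ ω, |X ω| ≤ K) :
    HasJumpExpansion J c (fun _ => X) (fun _ _ _ => 0) (fun _ _ => 0) := by
  refine fun T => ⟨max 1 K, le_max_left _ _, fun ω s s' h _ => ⟨?_, ?_, ?_, ?_⟩⟩
  · exact ((hX ω).trans (le_max_right _ _)).trans (le_self_pow₀ (le_max_left _ _) (by omega))
  · intro i _
    simp only [abs_zero]
    positivity
  · simp only [abs_zero]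
    positivity
  · simp only [sub_self, zero_mul, Finset.sum_const_zero, abs_zero]
    exact mul_nonneg (by positivity) (secondOrder_rings_nonneg hc h ω)

lemma sub {X Y G G' : ℝ≥0 → Ω → ℝ} {H H' : ι → ℝ≥0 → Ω → ℝ}
    (hc : ∀ i ω, Monotone fun t => c i t ω)
    (hX : HasJumpExpansion J c X H G) (hY : HasJumpExpansion J c Y H' G') :
    HasJumpExpansion J c (fun t ω => X t ω - Y t ω) (fun i t ω => H i t ω - H' i t ω)
      (fun t ω => G t ω - G' t ω) := by
  intro T
  obtain ⟨L, hL, hX⟩ := hX T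
  obtain ⟨L', hL', hY⟩ := hY T
  refine ⟨L + L', by linarith, fun ω s s' h hT => ?_⟩
  obtain ⟨x1, x2, x3, x4⟩ := hX ω s s' h hT
  obtain ⟨y1, y2, y3, y4⟩ := hY ω s s' h hT
  have key : ∀ k : ℕ, L ^ (k + 1) + L' ^ (k + 1) ≤ (L + L') ^ (k + 1) := fun k =>
    pow_add_pow_le (by linarith) (by linarith) (by omega)
  refine ⟨(abs_sub _ _).trans ((add_le_add x1 y1).trans (key _)),
    fun i hi => (abs_sub _ _).trans ((add_le_add (x2 i hi) (y2 i hi)).trans (key _)),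
    (abs_sub _ _).trans ((add_le_add x3 y3).trans (key _)), ?_⟩
  simp only [sub_mul, Finset.sum_sub_distrib]
  refine le_trans (le_of_eq ?_) ((abs_sub _ _).trans ((add_le_add x4 y4).trans ?_))
  · congr 1
    ring
  · rw [← add_mul]
    exact mul_le_mul_of_nonneg_right (key _) (secondOrder_rings_nonneg hc h ω)

/-- The product rule: besides the two terms of Leibniz, a ring of the clock `i` contributes the
product of the two jumps. -/
lemma mul {X Y G G' : ℝ≥0 → Ω → ℝ} {H H' : ι → ℝ≥0 → Ω → ℝ}
    (hc : ∀ i ω, Monotone fun t => c i t ω)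
    (hX : HasJumpExpansion J c X H G) (hY : HasJumpExpansion J c Y H' G') :
    HasJumpExpansion J c (fun t ω => X t ω * Y t ω)
      (fun i t ω => X t ω * H' i t ω + Y t ω * H i t ω + H i t ω * H' i t ω)
      (fun t ω => X t ω * G' t ω + Y t ω * G t ω) := by
  intro T
  obtain ⟨L₁, hL₁, hX⟩ := hX T
  obtain ⟨L₂, hL₂, hY⟩ := hY T
  set L := max L₁ L₂
  have hL : 1 ≤ L := hL₁.trans (le_max_left _ _)
  have p1 : ∀ k : ℕ, L₁ ^ (k + 1) ≤ L ^ (k + 1) := fun k =>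
    pow_le_pow_left₀ (by linarith) (le_max_left _ _) _
  have p2 : ∀ k : ℕ, L₂ ^ (k + 1) ≤ L ^ (k + 1) := fun k =>
    pow_le_pow_left₀ (by linarith) (le_max_right _ _) _
  have hT0 : (0 : ℝ) ≤ T := T.coe_nonneg
  have hK : (1 : ℝ) ≤ 6 + T := by linarith
  refine ⟨2 * (6 + T) * (L * L), by nlinarith [mul_le_mul hL hL zero_le_one (by linarith)],
    fun ω s s' h hT => ?_⟩
  obtain ⟨x1, x2, x3, x4⟩ := hX ω s s' h hT
  obtain ⟨y1, y2, y3, y4⟩ := hY ω s s' h hT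
  have y5 := (hY ω s' s' le_rfl hT).1.trans (p2 _)
  have hw0 := secondOrder_rings_nonneg (J := J) hc h ω
  replace x4 := x4.trans (mul_le_mul_of_nonneg_right (p1 _) hw0)
  replace y4 := y4.trans (mul_le_mul_of_nonneg_right (p2 _) hw0)
  replace x1 := x1.trans (p1 _)
  replace y1 := y1.trans (p2 _)
  replace x3 := x3.trans (p1 _)
  replace y3 := y3.trans (p2 _)
  replace x2 := fun i hi => (x2 i hi).trans (p1 _)
  replace y2 := fun i hi => (y2 i hi).trans (p2 _)
  obtain ⟨n, hn, hnk, hsum, hD0, hD⟩ := increments_facts (J := J) hc h ω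
  have hA := pow_rings_mono (J := J) hc hL h ω
  rw [hn] at hw0 x4 y4 ⊢
  set k := totalRings J c s' ω
  set l := totalRings J c s ω
  have hh : (0 : ℝ) ≤ (s' : ℝ) - s := sub_nonneg.2 (by exact_mod_cast h)
  have hhT : (s' : ℝ) - s ≤ T := by
    have : (s' : ℝ) ≤ T := by exact_mod_cast hT
    linarith [s.coe_nonneg]
  have hA0 : 0 ≤ L ^ (l + 1) := by positivity
  have q1 : ∀ a b : ℝ, |a| ≤ L ^ (l + 1) → |b| ≤ L ^ (l + 1) → |a * b| ≤ (L * L) ^ (l + 1) :=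
    fun a b ha hb => by
      rw [abs_mul, mul_pow]
      gcongr
  have q2 : (6 : ℝ) * (L * L) ^ (l + 1) ≤ (2 * (6 + T) * (L * L)) ^ (l + 1) := by
    refine le_trans ?_ (const_mul_pow_le hK (by positivity) l)
    gcongr
    linarith
  have q0 : 0 ≤ (L * L) ^ (l + 1) := by positivity
  refine ⟨?_, fun i hi => ?_, ?_, ?_⟩
  · linarith [q1 _ _ x1 y1]
  · have := q1 _ _ x1 (y2 i hi)
    have := q1 _ _ y1 (x2 i hi)
    have := q1 _ _ (x2 i hi) (y2 i hi)
    refine (abs_add_le _ _).trans ?_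
    linarith [abs_add_le (X s ω * H' i s ω) (Y s ω * H i s ω)]
  · have := q1 _ _ x1 y3
    have := q1 _ _ y1 x3
    refine (abs_add_le _ _).trans ?_
    linarith
  · refine (abs_mul_expansion_le J hsum hD0 hD hA0 hA hh hhT x1 y1 y5 x2 y2 x3 y3 x4 y4).trans ?_
    rw [← mul_assoc, ← mul_pow]
    exact mul_le_mul_of_nonneg_right
      (affine_mul_pow_le hK (by positivity) (by exact_mod_cast hnk)) hw0

end HasJumpExpansion

end OpenASEP

namespace OpenASEP

variable {Ω ι : Type*} {J : Finset ι} {c : ι → ℝ≥0 → Ω → ℕ}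

/-! ### Time integrals -/

/-- A continuous adapted process is predictable: it is the limit of the processes that are frozen at
the left end of each interval `(k / (m + 1), (k + 1) / (m + 1)]`. -/
lemma isStronglyPredictable_of_continuous {mΩ : MeasurableSpace Ω} {F : Filtration ℝ≥0 mΩ}
    {A : ℝ≥0 → Ω → ℝ} (hA : Adapted F A) (hcont : ∀ ω, Continuous fun t => A t ω) :
    IsStronglyPredictable F A := by
  let _ : MeasurableSpace (ℝ≥0 × Ω) := F.predictable
  set φ : ℕ → ℝ≥0 → ℕ := fun m t => ⌈t * (m + 1)⌉₊ - 1
  have hφ : ∀ (m k : ℕ) (t : ℝ≥0), φ m t = k ↔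
      (k = 0 ∧ t = 0) ∨ t ∈ Ioc ((k : ℝ≥0) / (m + 1)) ((k + 1) / (m + 1)) := by
    intro m k t
    have hm : (0 : ℝ≥0) < m + 1 := by positivity
    simp only [φ, mem_Ioc, div_lt_iff₀ hm, le_div_iff₀ hm]
    rcases eq_or_ne t 0 with rfl | ht
    · simp [eq_comm]
    · have hpos : 0 < ⌈t * (m + 1)⌉₊ := Nat.ceil_pos.2 (mul_pos (pos_iff_ne_zero.2 ht) hm)
      have e1 : ⌈t * (m + 1)⌉₊ - 1 = k ↔ ⌈t * (m + 1)⌉₊ = k + 1 := by omega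
      rw [e1, Nat.ceil_eq_iff (by omega)]
      simp [ht]
  have hlim : Tendsto (fun (m : ℕ) (z : ℝ≥0 × Ω) => A (φ m z.1 / (m + 1)) z.2) atTop
      (𝓝 (Function.uncurry A)) := by
    rw [tendsto_pi_nhds]
    rintro ⟨t, ω⟩
    refine ((hcont ω).tendsto t).comp ?_
    have h0 : Tendsto (fun m : ℕ => (t : ℝ) - 1 / ((m : ℝ) + 1)) atTop (𝓝 (t - 0)) :=
      tendsto_const_nhds.sub tendsto_one_div_add_atTop_nhds_zero_nat
    rw [sub_zero] at h0
    rw [← NNReal.tendsto_coe]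
    refine tendsto_of_tendsto_of_tendsto_of_le_of_le h0 tendsto_const_nhds (fun m => ?_) fun m => ?_
    · have hm : (0 : ℝ) < (m : ℝ) + 1 := by positivity
      rcases (hφ m _ t).1 rfl with ⟨h1, rfl⟩ | h1
      · simp only [NNReal.coe_zero, zero_sub]
        exact (neg_nonpos.2 (by positivity)).trans (NNReal.coe_nonneg _)
      · have : (t : ℝ) ≤ (φ m t + 1) / (m + 1) := by exact_mod_cast h1.2
        rw [add_div] at this
        push_cast
        linarith
    · rcases (hφ m _ t).1 rfl with ⟨h1, rfl⟩ | h1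
      · simp [φ]
      · exact_mod_cast h1.1.le
  refine (measurable_of_tendsto_metrizable (fun m => ?_) hlim).stronglyMeasurable
  intro B hB
  have hset : (fun z : ℝ≥0 × Ω => A (φ m z.1 / (m + 1)) z.2) ⁻¹' B
      = ({0} ×ˢ (A 0 ⁻¹' B)) ∪ ⋃ k : ℕ, Ioc ((k : ℝ≥0) / (m + 1)) ((k + 1) / (m + 1)) ×ˢ
        (A (k / (m + 1)) ⁻¹' B) := by
    ext ⟨t, ω⟩
    simp only [mem_preimage, mem_union, mem_prod, mem_singleton_iff, mem_iUnion]
    constructor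
    · intro hB
      rcases (hφ m _ t).1 rfl with ⟨h1, h2⟩ | h1
      · refine Or.inl ⟨h2, ?_⟩
        rwa [h1, Nat.cast_zero, zero_div] at hB
      · exact Or.inr ⟨_, h1, hB⟩
    · rintro (⟨rfl, hB⟩ | ⟨k, h1, hB⟩)
      · have : φ m 0 = 0 := (hφ m 0 0).2 (Or.inl ⟨rfl, rfl⟩)
        rwa [this, Nat.cast_zero, zero_div]
      · rwa [(hφ m k t).2 (Or.inr h1)]
  rw [hset]
  exact (measurableSet_predictable_singleton_bot_prod (hA 0 hB)).union
    (MeasurableSet.iUnion fun k => measurableSet_predictable_Ioc_prod _ _ (hA _ hB))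

namespace IsRingLipschitz

lemma continuousWithinAt {X : ℝ≥0 → Ω → ℝ}
    (hr : ∀ i ω t, ContinuousWithinAt (fun s => c i s ω) (Ici t) t)
    (hX : IsRingLipschitz J c X) (ω : Ω) (t : ℝ≥0) :
    ContinuousWithinAt (fun s => X s ω) (Ici t) t := by
  obtain ⟨L, hL, hX⟩ := hX (t + 1)
  have h1 : ∀ᶠ s in 𝓝[≥] t, ∀ i ∈ J, c i s ω = c i t ω := by
    rw [Finset.eventually_all]
    intro i _
    simpa using (hr i ω t).eventually (show ∀ᶠ y in 𝓝 (c i t ω), y = c i t ω by simp)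
  have h2 : ∀ᶠ s in 𝓝[≥] t, dist (X s ω) (X t ω)
      ≤ L ^ (totalRings J c t ω + 1) * ((s : ℝ) - t) := by
    filter_upwards [h1, self_mem_nhdsWithin,
      mem_nhdsWithin_of_mem_nhds (Iic_mem_nhds (lt_add_one t))] with s hs hts hst
    have he : totalRings J c s ω = totalRings J c t ω := Finset.sum_congr rfl hs
    have := (hX ω t s hts hst).2
    rw [he, sub_self, add_zero] at this
    exact this
  have h3 : Tendsto (fun s : ℝ≥0 => L ^ (totalRings J c t ω + 1) * ((s : ℝ) - t)) (𝓝[≥] t)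
      (𝓝 0) := by
    have : Continuous fun s : ℝ≥0 => L ^ (totalRings J c t ω + 1) * ((s : ℝ) - t) := by fun_prop
    simpa using (this.tendsto t).mono_left nhdsWithin_le_nhds
  exact tendsto_iff_dist_tendsto_zero.2
    (squeeze_zero' (Eventually.of_forall fun _ => dist_nonneg) h2 h3)

/-- The paths are integrable, as differences of monotone functions. -/
lemma intervalIntegrable {X : ℝ≥0 → Ω → ℝ} (hc : ∀ i ω, Monotone fun t => c i t ω)
    (hX : IsRingLipschitz J c X) (ω : Ω) (a b : ℝ) :
    IntervalIntegrable (fun s : ℝ => X s.toNNReal ω) volume a b := by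
  set T := (max a b).toNNReal
  obtain ⟨L, hL, hX⟩ := hX T
  set K := L ^ (totalRings J c T ω + 1)
  have hK : 0 ≤ K := by positivity
  set v : ℝ → ℝ := fun s => K * ((s.toNNReal : ℝ) + totalRings J c s.toNNReal ω)
  have hv : Monotone v := fun s s' h => by
    have h1 := Real.toNNReal_mono h
    have h2 := totalRings_mono (J := J) hc ω h1
    simp only [v]
    gcongr
  have hu : MonotoneOn (fun s => X s.toNNReal ω + v s) (uIcc a b) := by
    intro s _ s' hs' h
    have h1 := Real.toNNReal_mono h
    have hT : s'.toNNReal ≤ T := Real.toNNReal_mono hs'.2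
    have h2 := (hX ω _ _ h1 hT).2
    have h3 := h2.trans (mul_le_mul_of_nonneg_right (pow_rings_mono hc hL hT ω)
      (rings_length_nonneg hc h1 ω))
    have := (abs_le.1 h3).1
    simp only [v]
    linarith
  refine (hu.intervalIntegrable.sub (hv.monotoneOn (uIcc a b)).intervalIntegrable).congr ?_
  exact fun s _ => by simp

lemma continuous_timeIntegral {X : ℝ≥0 → Ω → ℝ} (hc : ∀ i ω, Monotone fun t => c i t ω)
    (hX : IsRingLipschitz J c X) (ω : Ω) : Continuous fun t => timeIntegral X t ω :=
  (intervalIntegral.continuous_primitive (hX.intervalIntegrable hc ω) 0).comp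
    NNReal.continuous_coe

lemma timeIntegral_sub {X : ℝ≥0 → Ω → ℝ} (hc : ∀ i ω, Monotone fun t => c i t ω)
    (hX : IsRingLipschitz J c X) (ω : Ω) (s t : ℝ≥0) :
    timeIntegral X t ω - timeIntegral X s ω = ∫ r in (s : ℝ)..t, X r.toNNReal ω :=
  intervalIntegral.integral_interval_sub_left (hX.intervalIntegrable hc ω _ _)
    (hX.intervalIntegrable hc ω _ _)

lemma abs_timeIntegral_sub_le {X : ℝ≥0 → Ω → ℝ} (hc : ∀ i ω, Monotone fun t => c i t ω)
    (hX : IsRingLipschitz J c X) {ω : Ω} {s s' : ℝ≥0} (h : s ≤ s') {K : ℝ}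
    (hK : ∀ r, s ≤ r → r ≤ s' → |X r ω - X s ω| ≤ K) :
    |timeIntegral X s' ω - timeIntegral X s ω - X s ω * (s' - s)| ≤ K * (s' - s) := by
  have hss : (s : ℝ) ≤ s' := by exact_mod_cast h
  have e : timeIntegral X s' ω - timeIntegral X s ω - X s ω * (s' - s)
      = ∫ r in (s : ℝ)..s', (X r.toNNReal ω - X s ω) := by
    rw [intervalIntegral.integral_sub (hX.intervalIntegrable hc ω _ _) intervalIntegrable_const,
      hX.timeIntegral_sub hc, intervalIntegral.integral_const, smul_eq_mul, mul_comm (X s ω)]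
  rw [e, ← Real.norm_eq_abs]
  refine (intervalIntegral.norm_integral_le_of_norm_le_const fun r hr => ?_).trans
    (le_of_eq (by rw [abs_of_nonneg (sub_nonneg.2 hss)]))
  rw [uIoc_of_le hss] at hr
  exact hK _ (by simpa using Real.toNNReal_mono hr.1.le) (by simpa using Real.toNNReal_mono hr.2)

/-- A time integral moves continuously, with the integrand as its speed. -/
lemma hasJumpExpansion_timeIntegral {X : ℝ≥0 → Ω → ℝ} (hc : ∀ i ω, Monotone fun t => c i t ω)
    (hX : IsRingLipschitz J c X) :
    HasJumpExpansion J c (timeIntegral X) (fun _ _ _ => 0) X := by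
  intro T
  obtain ⟨L, hL, hb⟩ := hX T
  have hT0 : (0 : ℝ) ≤ T := T.coe_nonneg
  have hK : (1 : ℝ) ≤ 1 + 2 * T := by linarith
  refine ⟨2 * (1 + 2 * T) * L, by nlinarith, fun ω s s' h hT => ?_⟩
  have hLL : ∀ k : ℕ, L ^ (k + 1) ≤ (2 * (1 + 2 * T) * L) ^ (k + 1) := fun k =>
    pow_le_pow_left₀ (by linarith) (by nlinarith) _
  have hsT : (s : ℝ) ≤ T := by exact_mod_cast h.trans hT
  obtain ⟨x1, -⟩ := hb ω s s' h hT
  refine ⟨?_, fun i _ => ?_, x1.trans (hLL _), ?_⟩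
  · set A := L ^ (totalRings J c s ω + 1) with hA
    have hA0 : 0 ≤ A := by positivity
    have hbd : ∀ r ≤ s, |X r ω| ≤ A := fun r hr =>
      (hb ω r s hr (h.trans hT)).1.trans (pow_rings_mono hc hL hr ω)
    have h1 := hX.abs_timeIntegral_sub_le hc (ω := ω) (zero_le : 0 ≤ s) (K := 2 * A)
      fun r _ hr => (abs_sub _ _).trans (by linarith [hbd r hr, hbd 0 zero_le])
    have h2 : |X 0 ω * s| ≤ A * s := by
      rw [abs_mul, abs_of_nonneg s.coe_nonneg]
      exact mul_le_mul_of_nonneg_right (hbd 0 zero_le) s.coe_nonneg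
    have e0 : timeIntegral X 0 ω = 0 := by simp [timeIntegral]
    simp only [e0, NNReal.coe_zero, sub_zero] at h1
    have h3 : |timeIntegral X s ω| ≤ 3 * A * s := by
      have := abs_add_le (timeIntegral X s ω - X 0 ω * s) (X 0 ω * s)
      rw [sub_add_cancel] at this
      linarith
    have h4 : 3 * A * s ≤ 2 * (1 + 2 * T) * A := by nlinarith [mul_le_mul_of_nonneg_left hsT hA0]
    refine h3.trans (h4.trans ?_)
    rw [hA, mul_pow (2 * (1 + 2 * (T : ℝ)))]
    gcongr
    exact le_self_pow₀ (by linarith) (by omega)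
  · simp only [abs_zero]
    positivity
  · simp only [zero_mul, Finset.sum_const_zero, sub_zero]
    have hr := rings_length_nonneg (J := J) hc h ω
    refine (hX.abs_timeIntegral_sub_le hc h (K := L ^ (totalRings J c s' ω + 1) *
      ((s' - s : ℝ) + (totalRings J c s' ω - totalRings J c s ω : ℝ))) fun r hr hr' => ?_).trans ?_
    · refine (hb ω s r hr (hr'.trans hT)).2.trans ?_
      have h1 := totalRings_mono (J := J) hc ω hr'
      have h2 := rings_length_nonneg (J := J) hc hr ω
      have h3 : (r : ℝ) ≤ s' := by exact_mod_cast hr'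
      have h4 : (totalRings J c r ω : ℝ) ≤ totalRings J c s' ω := by exact_mod_cast h1
      exact mul_le_mul (pow_rings_mono hc hL hr' ω) (by linarith) h2 (by positivity)
    · rw [mul_assoc]
      obtain ⟨n, hn, -⟩ := increments_facts (J := J) hc h ω
      have hnn := secondOrder_nonneg le_rfl (n := n)
      simp only [secondOrder, ne_eq, OfNat.ofNat_ne_zero, not_false_eq_true, zero_pow, zero_mul,
        zero_add] at hnn
      rw [hn] at hr ⊢
      have hss : (0 : ℝ) ≤ (s' : ℝ) - s := sub_nonneg.2 (by exact_mod_cast h)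
      refine mul_le_mul (hLL _) ?_ (mul_nonneg hr hss) (by positivity)
      unfold secondOrder
      nlinarith

/-- A time integral is adapted, as a limit of Riemann sums. -/
lemma adapted_timeIntegral {mΩ : MeasurableSpace Ω} {F : Filtration ℝ≥0 mΩ} {X : ℝ≥0 → Ω → ℝ}
    (hc : ∀ i ω, Monotone fun t => c i t ω) (hX : IsRingLipschitz J c X) (hA : Adapted F X) :
    Adapted F (timeIntegral X) := by
  intro t
  have hlim : Tendsto (fun (m : ℕ) (ω : Ω) => ∑ k ∈ Finset.range (m + 1),
      X (gridPt t m k) ω * ((gridPt t m (k + 1) : ℝ) - gridPt t m k)) atTop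
      (𝓝 (timeIntegral X t)) := by
    rw [tendsto_pi_nhds]
    intro ω
    obtain ⟨L, hL, hb⟩ := hX t
    set K := L ^ (totalRings J c t ω + 1) with hK
    have hbd : ∀ m : ℕ, dist (∑ k ∈ Finset.range (m + 1),
        X (gridPt t m k) ω * ((gridPt t m (k + 1) : ℝ) - gridPt t m k)) (timeIntegral X t ω)
        ≤ K * ((t : ℝ) + totalRings J c t ω) * (t / (m + 1)) := by
      intro m
      set u := gridPt t m
      set V : ℕ → ℝ := fun k => (u k : ℝ) + totalRings J c (u k) ω
      have e1 : timeIntegral X t ω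
          = ∑ k ∈ Finset.range (m + 1),
            (timeIntegral X (u (k + 1)) ω - timeIntegral X (u k) ω) := by
        rw [Finset.sum_range_sub (fun k => timeIntegral X (u k) ω)]
        simp [u, gridPt_zero, gridPt_last, timeIntegral]
      have e2 : ∑ k ∈ Finset.range (m + 1), (V (k + 1) - V k) ≤ t + totalRings J c t ω := by
        rw [Finset.sum_range_sub V]
        simp only [V, u, gridPt_zero, gridPt_last, NNReal.coe_zero, zero_add]
        linarith [(totalRings J c 0 ω).cast_nonneg (α := ℝ)]
      rw [dist_comm, Real.dist_eq, e1, ← Finset.sum_sub_distrib]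
      refine (Finset.abs_sum_le_sum_abs _ _).trans ?_
      calc _ ≤ ∑ k ∈ Finset.range (m + 1), K * (V (k + 1) - V k) * (t / (m + 1)) := by
            refine Finset.sum_le_sum fun k hk => ?_
            have hk' : k + 1 ≤ m + 1 := by simpa using hk
            have hu : u k ≤ u (k + 1) := gridPt_mono t m k.le_succ
            rw [← gridPt_succ_sub t m k]
            refine hX.abs_timeIntegral_sub_le hc hu fun r hr hr' => ?_
            have hrt : r ≤ t := hr'.trans (gridPt_le hk')
            refine (hb ω _ r hr hrt).2.trans ?_
            have h2 := rings_length_nonneg (J := J) hc hr ω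
            have h3 : (r : ℝ) ≤ u (k + 1) := by exact_mod_cast hr'
            have h4 : (totalRings J c r ω : ℝ) ≤ totalRings J c (u (k + 1)) ω := by
              exact_mod_cast totalRings_mono (J := J) hc ω hr'
            exact mul_le_mul (pow_rings_mono hc hL hrt ω) (by simp only [V]; linarith) h2
              (by positivity)
        _ = K * (∑ k ∈ Finset.range (m + 1), (V (k + 1) - V k)) * (t / (m + 1)) := by
            rw [Finset.mul_sum, Finset.sum_mul]
        _ ≤ _ := by gcongr
    refine tendsto_iff_dist_tendsto_zero.2 (squeeze_zero (fun _ => dist_nonneg) hbd ?_)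
    have : Tendsto (fun m : ℕ => (t : ℝ) / (m + 1)) atTop (𝓝 0) :=
      tendsto_const_div_atTop_nhds_zero_nat (t : ℝ) |>.comp (tendsto_add_atTop_nat 1)
        |>.congr fun m => by simp
    simpa using this.const_mul (K * ((t : ℝ) + totalRings J c t ω))
  refine @measurable_of_tendsto_metrizable _ _ (F t) _ _ _ _ _ _ (fun m => ?_) hlim
  refine Finset.measurable_sum _ fun k hk => Measurable.mul_const ?_ _
  exact (hA (gridPt t m k)).mono (F.mono (gridPt_le (by simp at hk; omega))) le_rfl

lemma isStronglyPredictable_timeIntegral {mΩ : MeasurableSpace Ω} {F : Filtration ℝ≥0 mΩ}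
    {X : ℝ≥0 → Ω → ℝ} (hc : ∀ i ω, Monotone fun t => c i t ω) (hX : IsRingLipschitz J c X)
    (hA : Adapted F X) : IsStronglyPredictable F (timeIntegral X) :=
  isStronglyPredictable_of_continuous (hX.adapted_timeIntegral hc hA)
    (hX.continuous_timeIntegral hc)

lemma hasDerivWithinAt_timeIntegral {X : ℝ≥0 → Ω → ℝ} (hc : ∀ i ω, Monotone fun t => c i t ω)
    (hr : ∀ i ω t, ContinuousWithinAt (fun s => c i s ω) (Ici t) t)
    (hX : IsRingLipschitz J c X) (ω : Ω) (t : ℝ≥0) :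
    HasDerivWithinAt (fun s : ℝ => timeIntegral X s.toNNReal ω) (X t ω) (Ici (t : ℝ)) t := by
  have hcont : ContinuousWithinAt (fun s : ℝ => X s.toNNReal ω) (Ici (t : ℝ)) t := by
    have h1 := hX.continuousWithinAt hr ω t
    refine ContinuousWithinAt.comp (t := Ici t) (g := fun s => X s ω) (f := Real.toNNReal)
      (by simpa using h1) continuous_real_toNNReal.continuousWithinAt fun s hs => ?_
    exact (Real.toNNReal_coe (r := t)).symm.le.trans (Real.toNNReal_mono hs)
  have hmeas : StronglyMeasurableAtFilter (fun s : ℝ => X s.toNNReal ω) (𝓝[>] (t : ℝ)) :=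
    ⟨Ioc t (t + 1), Ioc_mem_nhdsGT (lt_add_one _),
      (hX.intervalIntegrable hc ω (t : ℝ) (t + 1)).1.aestronglyMeasurable⟩
  have := intervalIntegral.integral_hasDerivWithinAt_right (hX.intervalIntegrable hc ω 0 t)
    (s := Ici (t : ℝ)) (t := Ioi (t : ℝ)) hmeas (hcont.mono Ioi_subset_Ici_self)
  rw [Real.toNNReal_coe] at this
  refine this.congr (fun s hs => ?_) ?_
  · simp only [timeIntegral, Real.coe_toNNReal s (t.coe_nonneg.trans hs)]
  · simp [timeIntegral]

end IsRingLipschitz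

lemma timeIntegral_mono {X : ℝ≥0 → Ω → ℝ} (hc : ∀ i ω, Monotone fun t => c i t ω)
    (hX : IsRingLipschitz J c X) (h0 : ∀ t ω, 0 ≤ X t ω) (ω : Ω) :
    Monotone fun t => timeIntegral X t ω := fun s t h => by
  have h1 : (s : ℝ) ≤ t := by exact_mod_cast h
  have h2 := hX.timeIntegral_sub hc ω s t
  have h3 := intervalIntegral.integral_nonneg h1 (μ := volume) (f := fun r => X r.toNNReal ω)
    fun r _ => h0 _ ω
  simp only
  linarith

end OpenASEP

namespace OpenASEP

/-! ### Poisson moments -/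

lemma hasSum_poisson_pow (y : ℝ≥0) (θ : ℝ) :
    HasSum (fun n : ℕ => Real.exp (-y) * y ^ n / n.factorial * θ ^ n)
      (Real.exp (y * (θ - 1))) := by
  have h := (NormedSpace.expSeries_div_hasSum_exp ((y : ℝ) * θ)).mul_left (Real.exp (-y))
  rw [← Real.exp_eq_exp_ℝ, ← Real.exp_add] at h
  convert! h using 1
  · funext n
    rw [mul_pow]
    ring
  · congr 1
    ring

lemma integrable_poisson_pow (y : ℝ≥0) (θ : ℝ) :
    Integrable (fun n : ℕ => θ ^ n) (poissonMeasure y) := by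
  rw [integrable_poissonMeasure_iff]
  simpa using (hasSum_poisson_pow y |θ|).summable

lemma integral_poisson_pow (y : ℝ≥0) (θ : ℝ) :
    ∫ n, θ ^ n ∂(poissonMeasure y) = Real.exp (y * (θ - 1)) := by
  rw [integral_poissonMeasure]
  exact (hasSum_poisson_pow y θ).tsum_eq

lemma hasSum_poisson_id (y : ℝ≥0) :
    HasSum (fun n : ℕ => Real.exp (-y) * y ^ n / n.factorial * n) y := by
  rw [← hasSum_nat_add_iff' 1]
  have h := (hasSum_one_poissonMeasure y).mul_left (y : ℝ)
  simp only [mul_one] at h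
  convert! h using 1
  · funext n
    rw [Nat.factorial_succ]
    push_cast
    field_simp
    ring
  · simp

lemma integrable_poisson_id (y : ℝ≥0) :
    Integrable (fun n : ℕ => (n : ℝ)) (poissonMeasure y) := by
  rw [integrable_poissonMeasure_iff]
  simpa using (hasSum_poisson_id y).summable

lemma integral_poisson_id (y : ℝ≥0) : ∫ n : ℕ, (n : ℝ) ∂(poissonMeasure y) = y := by
  rw [integral_poissonMeasure]
  exact (hasSum_poisson_id y).tsum_eq

/-- Two or more rings are dominated by the second order remainder of a generating function, whose
Poisson mean is explicit. -/
lemma pow_mul_secondOrder_le {L h : ℝ} (hL : 1 ≤ L) (hh : 0 ≤ h) (n : ℕ) :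
    L ^ n * secondOrder h n ≤ h ^ 2 * (4 * L) ^ n + h * ((4 * L) ^ n - 1)
      + 2 * ((4 * L) ^ n - 1 - (4 * L - 1) * n) := by
  have hθ : L ^ n ≤ (4 * L) ^ n := pow_le_pow_left₀ (by linarith) (by linarith) n
  rcases n with _ | _ | n
  · simp [secondOrder]
  · simp only [secondOrder, zero_add, pow_one, Nat.cast_one]
    nlinarith [mul_nonneg hh (by linarith : 0 ≤ L), mul_nonneg (sq_nonneg h) (by linarith : 0 ≤ L)]
  · set m := n + 2 with hm
    have hm2 : (2 : ℝ) ≤ m := by rw [hm]; push_cast; linarith [n.cast_nonneg (α := ℝ)]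
    have h2 : (m : ℝ) + 1 ≤ 2 ^ m := by
      have : m + 1 ≤ 2 ^ m := Nat.lt_two_pow_self
      exact_mod_cast this
    have hP : 0 < L ^ m := by positivity
    have hP1 : 1 ≤ L ^ m := one_le_pow₀ hL
    have e4 : (4 * L) ^ m = 2 ^ m * 2 ^ m * L ^ m := by
      rw [mul_pow, ← mul_pow 2 2]
      norm_num
    -- the remainder of the generating function at `m ≥ 2` is at least half of its main term
    have hB : (4 * L) ^ m ≤ 2 * ((4 * L) ^ m - 1 - (4 * L - 1) * m) := by
      have key : ∀ k : ℕ, 2 * (1 + (4 * L - 1) * (k + 2 : ℕ)) ≤ (4 * L) ^ (k + 2) := by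
        intro k
        induction k with
        | zero => push_cast; nlinarith
        | succ k ih =>
          have e : (4 * L) ^ (k + 1 + 2) = 4 * L * (4 * L) ^ (k + 2) := by ring
          rw [e]
          push_cast at ih ⊢
          have hk : (0 : ℝ) ≤ k := k.cast_nonneg
          have : 0 ≤ (4 * L - 1) * (k : ℝ) := mul_nonneg (by linarith) hk
          nlinarith [mul_le_mul_of_nonneg_left ih (by linarith : (0 : ℝ) ≤ 4 * L)]
      have := key n
      linarith
    have h3 : (m : ℝ) * L ^ m ≤ (4 * L) ^ m - 1 := by
      have : ((m : ℝ) + 1) * L ^ m ≤ 2 ^ m * 2 ^ m * L ^ m := by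
        refine mul_le_mul_of_nonneg_right ?_ hP.le
        nlinarith
      rw [e4]
      linarith
    have h4 : (m : ℝ) * (m - 1) * L ^ m ≤ (4 * L) ^ m := by
      rw [e4]
      have : (m : ℝ) * (m - 1) ≤ 2 ^ m * 2 ^ m := by nlinarith
      exact mul_le_mul_of_nonneg_right this hP.le
    have h5 : h * (m * L ^ m) ≤ h * ((4 * L) ^ m - 1) := mul_le_mul_of_nonneg_left h3 hh
    have h6 : h ^ 2 * L ^ m ≤ h ^ 2 * (4 * L) ^ m :=
      mul_le_mul_of_nonneg_left hθ (sq_nonneg h)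
    unfold secondOrder
    linarith

lemma exp_sub_le {z : ℝ} (hz : 0 ≤ z) :
    Real.exp z - 1 ≤ z * Real.exp z ∧ Real.exp z - 1 - z ≤ z ^ 2 * Real.exp z := by
  have f1 : Real.exp z - 1 ≤ z * Real.exp z := by
    have h1 := Real.add_one_le_exp (-z)
    have h2 : Real.exp (-z) * Real.exp z = 1 := by rw [← Real.exp_add]; simp
    nlinarith [Real.exp_pos z]
  exact ⟨f1, by nlinarith⟩

/-- The second order error has a Poisson mean of second order in the length of the time interval. -/
lemma integral_pow_mul_secondOrder_le {L : ℝ} (hL : 1 ≤ L) (Λ T : ℝ≥0) :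
    ∃ K : ℝ, ∀ h : ℝ≥0, h ≤ T →
      Integrable (fun n : ℕ => L ^ n * secondOrder h n) (poissonMeasure (Λ * h)) ∧
      ∫ n : ℕ, L ^ n * secondOrder h n ∂(poissonMeasure (Λ * h)) ≤ K * h ^ 2 := by
  set θ := 4 * L
  set b : ℝ := Λ * (θ - 1)
  have hb : 0 ≤ b := mul_nonneg Λ.coe_nonneg (by simp only [θ]; linarith)
  refine ⟨Real.exp (b * T) * (1 + b + 2 * b ^ 2), fun h hT => ?_⟩
  set μ := poissonMeasure (Λ * h)
  have hh : (0 : ℝ) ≤ h := h.coe_nonneg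
  have i1 : Integrable (fun n : ℕ => (h : ℝ) ^ 2 * θ ^ n) μ :=
    (integrable_poisson_pow _ θ).const_mul _
  have i2 : Integrable (fun n : ℕ => (h : ℝ) * (θ ^ n - 1)) μ :=
    ((integrable_poisson_pow _ θ).sub (integrable_const 1)).const_mul _
  have i3' : Integrable (fun n : ℕ => θ ^ n - 1) μ :=
    (integrable_poisson_pow _ θ).sub (integrable_const 1)
  have i3 : Integrable (fun n : ℕ => 2 * (θ ^ n - 1 - (θ - 1) * n)) μ :=
    (i3'.sub ((integrable_poisson_id _).const_mul _)).const_mul _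
  have add3 : ∀ {f g k : ℕ → ℝ}, Integrable f μ → Integrable g μ → Integrable k μ →
      Integrable (fun n => f n + g n + k n) μ ∧
      ∫ n, (f n + g n + k n) ∂μ = ∫ n, f n ∂μ + ∫ n, g n ∂μ + ∫ n, k n ∂μ := fun hf hg hk =>
    ⟨(hf.add hg).add hk, (integral_add' (hf.add hg) hk).trans (by rw [integral_add' hf hg])⟩
  have hadd := add3 i1 i2 i3
  have hle : ∀ n : ℕ, L ^ n * secondOrder h n ≤ h ^ 2 * θ ^ n + h * (θ ^ n - 1)
      + 2 * (θ ^ n - 1 - (θ - 1) * n) := pow_mul_secondOrder_le hL hh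
  have hnn : ∀ n : ℕ, 0 ≤ L ^ n * secondOrder h n := fun n =>
    mul_nonneg (by positivity) (secondOrder_nonneg hh)
  have i4 : Integrable (fun n : ℕ => L ^ n * secondOrder h n) μ := by
    refine hadd.1.mono' Measurable.of_discrete.aestronglyMeasurable
      (Eventually.of_forall fun n => ?_)
    rw [Real.norm_of_nonneg (hnn n)]
    exact hle n
  refine ⟨i4, (integral_mono i4 hadd.1 hle).trans ?_⟩
  set z : ℝ := b * h with hz
  have hz0 : 0 ≤ z := mul_nonneg hb hh
  have hpow : ∫ n : ℕ, θ ^ n ∂μ = Real.exp z := by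
    rw [integral_poisson_pow]
    congr 1
    push_cast
    ring
  have hid : ∫ n : ℕ, (θ - 1) * (n : ℝ) ∂μ = z := by
    rw [integral_const_mul, integral_poisson_id]
    push_cast
    ring
  have e1 : ∫ n : ℕ, (h : ℝ) ^ 2 * θ ^ n ∂μ = h ^ 2 * Real.exp z := by
    rw [integral_const_mul, hpow]
  have e2 : ∫ n : ℕ, (h : ℝ) * (θ ^ n - 1) ∂μ = h * (Real.exp z - 1) := by
    rw [integral_const_mul, integral_sub (integrable_poisson_pow _ θ) (integrable_const 1), hpow]
    simp
  have e3 : ∫ n : ℕ, 2 * (θ ^ n - 1 - (θ - 1) * n) ∂μ = 2 * (Real.exp z - 1 - z) := by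
    rw [integral_const_mul, integral_sub i3' ((integrable_poisson_id _).const_mul _),
      integral_sub (integrable_poisson_pow _ θ) (integrable_const 1), hpow, hid]
    simp
  have e4 := hadd.2
  rw [e1, e2, e3] at e4
  refine (le_of_eq e4).trans ?_
  obtain ⟨f1, f2⟩ := exp_sub_le hz0
  have f3 : Real.exp z ≤ Real.exp (b * T) :=
    Real.exp_le_exp.2 (mul_le_mul_of_nonneg_left (by exact_mod_cast hT) hb)
  calc (h : ℝ) ^ 2 * Real.exp z + h * (Real.exp z - 1) + 2 * (Real.exp z - 1 - z)
      ≤ (h : ℝ) ^ 2 * Real.exp z + h * (z * Real.exp z) + 2 * (z ^ 2 * Real.exp z) := by gcongr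
    _ = Real.exp z * (1 + b + 2 * b ^ 2) * (h : ℝ) ^ 2 := by rw [hz]; ring
    _ ≤ _ := by gcongr

end OpenASEP

namespace OpenASEP

/-! ### Martingales driven by Poisson clocks -/

variable {Ω ι : Type*} {mΩ : MeasurableSpace Ω} {P : Measure Ω} {F : Filtration ℝ≥0 mΩ}
  {r : ι → ℝ≥0} {c : ι → ℝ≥0 → Ω → ℕ} {J : Finset ι}

namespace IsPoissonClocks

lemma measurable (h : IsPoissonClocks P F r c) (i : ι) (t : ℝ≥0) : Measurable (c i t) :=
  (h.adapted i t).mono (F.le t) le_rfl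

/-- The number of rings of finitely many clocks is Poisson. -/
lemma hasLaw_sum [IsProbabilityMeasure P] (h : IsPoissonClocks P F r c) (J : Finset ι)
    {s t : ℝ≥0} (hst : s ≤ t) :
    HasLaw (∑ i ∈ J, fun ω => c i t ω - c i s ω) (poissonMeasure ((∑ i ∈ J, r i) * (t - s))) P := by
  classical
  have hm : ∀ i, Measurable fun ω => c i t ω - c i s ω := fun i =>
    (h.measurable i t).sub (h.measurable i s)
  induction J using Finset.induction_on with
  | empty =>
    refine ⟨by rw [Finset.sum_empty]; exact measurable_zero.aemeasurable, ?_⟩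
    have h1 : P.map (fun _ : Ω => (0 : ℕ)) = Measure.dirac 0 := by simp
    simp only [Finset.sum_empty, zero_mul]
    refine h1.trans ?_
    have h2 : poissonMeasure 0 {0} = 1 := by simp [poissonMeasure_singleton]
    refine Measure.ext_of_singleton fun n => ?_
    rcases Nat.eq_zero_or_pos n with rfl | hn
    · simp [h2]
    · simp [poissonMeasure_singleton, hn.ne', hn.ne]
  | insert i J hi ih =>
    rw [Finset.sum_insert hi, Finset.sum_insert hi, add_mul]
    refine IndepFun.hasLaw_add_poissonMeasure ?_ ⟨(hm i).aemeasurable, h.law i s t hst⟩ ih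
    exact ((h.indep s t hst).indepFun_finsetSum_of_notMem hm hi).symm

lemma totalRings_eq (h : IsPoissonClocks P F r c) {s t : ℝ≥0} (hst : s ≤ t) (ω : Ω) :
    totalRings J c t ω = totalRings J c s ω + (∑ i ∈ J, fun ω => c i t ω - c i s ω) ω := by
  simp only [totalRings, Finset.sum_apply, ← Finset.sum_add_distrib]
  exact Finset.sum_congr rfl fun i _ => (Nat.add_sub_cancel' (h.mono i ω hst)).symm

lemma adapted_totalRings (h : IsPoissonClocks P F r c) (J : Finset ι) :
    Adapted F (totalRings J c) := fun t =>
  Finset.measurable_sum _ fun i _ => h.adapted i t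

lemma integrable_pow_totalRings [IsProbabilityMeasure P] (h : IsPoissonClocks P F r c)
    (J : Finset ι) (L : ℝ) (t : ℝ≥0) : Integrable (fun ω => L ^ totalRings J c t ω) P := by
  have hl := h.hasLaw_sum J (zero_le : 0 ≤ t)
  have := (integrable_poisson_pow ((∑ i ∈ J, r i) * (t - 0)) L)
  rw [← hl.map_eq] at this
  refine (this.comp_aemeasurable hl.aemeasurable).congr (Eventually.of_forall fun ω => ?_)
  simp only [Function.comp_apply]
  rw [h.totalRings_eq (zero_le : 0 ≤ t)]
  simp [totalRings, h.zero]

/-- The increments of the clocks after time `s` are independent of the past. -/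
lemma indepFun_of_past (h : IsPoissonClocks P F r c) {s t : ℝ≥0} (hst : s ≤ t) {U : Ω → ℝ}
    (hU : Measurable[F s] U) {f : (ι → ℕ) → ℝ} (hf : Measurable f) :
    IndepFun U (fun ω => f fun i => c i t ω - c i s ω) P := by
  refine indep_of_indep_of_le_left (indep_of_indep_of_le_right (h.indepPast s t hst).symm ?_) ?_
  · rintro _ ⟨B, hB, rfl⟩
    exact ⟨f ⁻¹' B, hf hB, rfl⟩
  · exact hU.comap_le

end IsPoissonClocks

namespace HasJumpExpansion

lemma integrable [IsProbabilityMeasure P] (h : IsPoissonClocks P F r c)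
    {Y G : ℝ≥0 → Ω → ℝ} {H : ι → ℝ≥0 → Ω → ℝ} (hY : HasJumpExpansion J c Y H G)
    (hA : Adapted F Y) (t : ℝ≥0) : Integrable (Y t) P := by
  obtain ⟨L, hL, hb⟩ := hY t
  refine ((h.integrable_pow_totalRings J L t).const_mul L).mono'
    ((hA t).mono (F.le t) le_rfl).aestronglyMeasurable (Eventually.of_forall fun ω => ?_)
  rw [← pow_succ']
  exact (hb ω t t le_rfl le_rfl).1

/-- Over a short time interval the compensated process has no mean increment up to second order,
even when restricted to an event of the past. -/
lemma abs_setIntegral_sub_le [IsProbabilityMeasure P] (h : IsPoissonClocks P F r c)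
    {Y G : ℝ≥0 → Ω → ℝ} {H : ι → ℝ≥0 → Ω → ℝ} (hY : HasJumpExpansion J c Y H G)
    (hA : Adapted F Y) (hH : ∀ i ∈ J, Adapted F (H i))
    (h0 : ∀ t ω, G t ω + ∑ i ∈ J, r i * H i t ω = 0) (T : ℝ≥0) :
    ∃ K : ℝ, ∀ s t : ℝ≥0, s ≤ t → t ≤ T → ∀ A, MeasurableSet[F s] A →
      |∫ ω in A, (Y t ω - Y s ω) ∂P| ≤ K * ((t : ℝ) - s) ^ 2 := by
  obtain ⟨L, hL, hb⟩ := hY T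
  set Λ := ∑ i ∈ J, r i
  obtain ⟨K, hK⟩ := integral_pow_mul_secondOrder_le hL Λ T
  set B := ∫ ω, L ^ (totalRings J c T ω + 1) ∂P
  have hLT : Integrable (fun ω => L ^ (totalRings J c T ω + 1)) P :=
    ((h.integrable_pow_totalRings J L T).const_mul L).congr
      (Eventually.of_forall fun ω => (pow_succ' _ _).symm)
  refine ⟨B * K, fun s t hst hT A hAm => ?_⟩
  have hAm' : MeasurableSet A := F.le s A hAm
  have hst' : (s : ℝ) ≤ t := by exact_mod_cast hst
  have hcoe : ((t - s : ℝ≥0) : ℝ) = t - s := NNReal.coe_sub hst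
  set R : Ω → ℕ := ∑ i ∈ J, fun ω => c i t ω - c i s ω with hR
  have hRlaw := h.hasLaw_sum J hst
  set W : Ω → ℝ := fun ω => L ^ R ω * secondOrder ((t : ℝ) - s) (R ω) with hW
  set U : Ω → ℝ := fun ω => L ^ (totalRings J c s ω + 1) with hU
  have hUm : Measurable[F s] U :=
    (Measurable.of_discrete (f := fun n : ℕ => L ^ (n + 1))).comp (h.adapted_totalRings J s)
  have hUi : Integrable U P :=
    ((h.integrable_pow_totalRings J L s).const_mul L).congr
      (Eventually.of_forall fun ω => (pow_succ' _ _).symm)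
  have hUle : ∫ ω, U ω ∂P ≤ B := integral_mono hUi hLT fun ω =>
    pow_rings_mono h.mono hL (hst.trans hT) ω
  -- the mean of the second order error
  obtain ⟨k1, k2⟩ := hK (t - s) (tsub_le_self.trans hT)
  rw [hcoe] at k1 k2
  have hWi : Integrable W P := by
    rw [← hRlaw.map_eq] at k1
    exact k1.comp_aemeasurable hRlaw.aemeasurable
  have hWK : ∫ ω, W ω ∂P ≤ K * ((t : ℝ) - s) ^ 2 := by
    refine le_trans (le_of_eq ?_) k2
    exact hRlaw.integral_comp (f := fun n : ℕ => L ^ n * secondOrder ((t : ℝ) - s) n)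
      Measurable.of_discrete.aestronglyMeasurable
  have hW0 : ∀ ω, 0 ≤ W ω := fun ω =>
    mul_nonneg (by positivity) (secondOrder_nonneg (sub_nonneg.2 hst'))
  have hUW : IndepFun U W P := by
    refine h.indepFun_of_past hst hUm (f := fun D => L ^ (∑ i ∈ J, D i) *
      secondOrder ((t : ℝ) - s) (∑ i ∈ J, D i : ℕ)) ?_ |>.congr (Eventually.of_forall fun _ => rfl)
        (Eventually.of_forall fun ω => ?_)
    · exact (Measurable.of_discrete (f := fun n : ℕ => L ^ n *
        secondOrder ((t : ℝ) - s) n)).comp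
          (Finset.measurable_sum _ fun i _ => measurable_pi_apply i)
    · simp [hW, hR]
  have hUWi : Integrable (fun ω => U ω * W ω) P := hUW.integrable_mul hUi hWi
  -- the first order terms are centered
  set V : Ω → ℝ := fun ω => ∑ i ∈ J, H i s ω * (((c i t ω - c i s ω : ℕ) : ℝ) - r i * (t - s))
    with hV
  have hterm : ∀ i ∈ J, Integrable
      (fun ω => A.indicator (H i s) ω * (((c i t ω - c i s ω : ℕ) : ℝ) - r i * (t - s))) P ∧
      ∫ ω, A.indicator (H i s) ω * (((c i t ω - c i s ω : ℕ) : ℝ) - r i * (t - s)) ∂P = 0 := by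
    intro i hi
    have hlaw : HasLaw (fun ω => c i t ω - c i s ω) (poissonMeasure (r i * (t - s))) P :=
      ⟨((h.measurable i t).sub (h.measurable i s)).aemeasurable, h.law i s t hst⟩
    have hHm : Measurable[F s] (A.indicator (H i s)) := (hH i hi s).indicator hAm
    have hHi : Integrable (A.indicator (H i s)) P := by
      refine Integrable.indicator ?_ hAm'
      refine hUi.mono' ((hH i hi s).mono (F.le s) le_rfl).aestronglyMeasurable
        (Eventually.of_forall fun ω => ?_)
      exact (hb ω s s le_rfl (hst.trans hT)).2.1 i hi
    have hDi : Integrable (fun ω => ((c i t ω - c i s ω : ℕ) : ℝ)) P := by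
      have := integrable_poisson_id (r i * (t - s))
      rw [← hlaw.map_eq] at this
      exact this.comp_aemeasurable hlaw.aemeasurable
    have hDE : ∫ ω, ((c i t ω - c i s ω : ℕ) : ℝ) ∂P = r i * (t - s) := by
      have h1 := hlaw.integral_comp (f := fun n : ℕ => (n : ℝ))
        Measurable.of_discrete.aestronglyMeasurable
      rw [integral_poisson_id, NNReal.coe_mul, hcoe] at h1
      exact h1
    have hind : IndepFun (A.indicator (H i s))
        (fun ω => ((c i t ω - c i s ω : ℕ) : ℝ) - r i * (t - s)) P :=
      h.indepFun_of_past hst hHm (f := fun D => (D i : ℝ) - r i * (t - s))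
        ((Measurable.of_discrete (f := fun n : ℕ => (n : ℝ) - r i * (t - s))).comp
          (measurable_pi_apply i))
    have hDi' : Integrable (fun ω => ((c i t ω - c i s ω : ℕ) : ℝ) - r i * (t - s)) P :=
      hDi.sub (integrable_const _)
    refine ⟨hind.integrable_mul hHi hDi', ?_⟩
    rw [hind.integral_fun_mul_eq_mul_integral hHi.aestronglyMeasurable hDi'.aestronglyMeasurable,
      integral_sub hDi (integrable_const _), hDE]
    simp
  have hVeq : A.indicator V = fun ω => ∑ i ∈ J,
      A.indicator (H i s) ω * (((c i t ω - c i s ω : ℕ) : ℝ) - r i * (t - s)) := by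
    funext ω
    by_cases hω : ω ∈ A <;> simp [hω, hV]
  have hVi : IntegrableOn V A P := by
    rw [← integrable_indicator_iff hAm', hVeq]
    exact integrable_finsetSum _ fun i hi => (hterm i hi).1
  have hV0 : ∫ ω in A, V ω ∂P = 0 := by
    rw [← integral_indicator hAm', hVeq, integral_finsetSum _ fun i hi => (hterm i hi).1]
    exact Finset.sum_eq_zero fun i hi => (hterm i hi).2
  have hYi : IntegrableOn (fun ω => Y t ω - Y s ω) A P :=
    ((hY.integrable h hA t).sub (hY.integrable h hA s)).integrableOn
  have hbound : ∀ ω, |Y t ω - Y s ω - V ω| ≤ U ω * W ω := by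
    intro ω
    have h1 := (hb ω s t hst hT).2.2.2
    have h2 := h.totalRings_eq (J := J) hst ω
    have h3 : (totalRings J c t ω - totalRings J c s ω : ℝ) = R ω := by rw [h2]; push_cast; ring
    have h4 : U ω * W ω = L ^ (totalRings J c t ω + 1) * secondOrder ((t : ℝ) - s) (R ω) := by
      simp only [hU, hW]
      rw [h2]
      ring
    rw [h4, ← h3]
    refine le_trans (le_of_eq ?_) h1
    congr 1
    have h5 : V ω = ∑ i ∈ J, H i s ω * (c i t ω - c i s ω : ℝ)
        - (∑ i ∈ J, r i * H i s ω) * (t - s) := by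
      simp only [hV, Finset.sum_mul, ← Finset.sum_sub_distrib]
      refine Finset.sum_congr rfl fun i _ => ?_
      rw [Nat.cast_sub (h.mono i ω hst)]
      ring
    have h6 : ∑ i ∈ J, r i * H i s ω = - G s ω := by linarith [h0 s ω]
    rw [h5, h6]
    ring
  have e : ∫ ω in A, (Y t ω - Y s ω) ∂P = ∫ ω in A, (Y t ω - Y s ω - V ω) ∂P := by
    rw [integral_sub hYi hVi, hV0, sub_zero]
  rw [e, ← Real.norm_eq_abs]
  calc ‖∫ ω in A, (Y t ω - Y s ω - V ω) ∂P‖ ≤ ∫ ω in A, U ω * W ω ∂P :=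
        norm_integral_le_of_norm_le hUWi.integrableOn (Eventually.of_forall hbound)
    _ ≤ ∫ ω, U ω * W ω ∂P := setIntegral_le_integral hUWi
        (Eventually.of_forall fun ω => mul_nonneg (by positivity) (hW0 ω))
    _ = (∫ ω, U ω ∂P) * ∫ ω, W ω ∂P :=
        hUW.integral_fun_mul_eq_mul_integral hUi.aestronglyMeasurable hWi.aestronglyMeasurable
    _ ≤ B * (K * ((t : ℝ) - s) ^ 2) :=
        mul_le_mul hUle hWK (integral_nonneg hW0) (integral_nonneg fun ω => by positivity)
    _ = _ := by ring

/-- A process with a jump expansion whose speed compensates its jumps is a martingale: over the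
intervals of a partition into `m` pieces the mean increments are of order `m⁻²`, and so their sum
vanishes in the limit. -/
theorem martingale [IsProbabilityMeasure P] (h : IsPoissonClocks P F r c)
    {Y G : ℝ≥0 → Ω → ℝ} {H : ι → ℝ≥0 → Ω → ℝ} (hY : HasJumpExpansion J c Y H G)
    (hA : Adapted F Y) (hH : ∀ i ∈ J, Adapted F (H i))
    (h0 : ∀ t ω, G t ω + ∑ i ∈ J, r i * H i t ω = 0) : Martingale Y F P := by
  have hint := hY.integrable h hA
  refine ⟨fun t => (hA t).stronglyMeasurable, fun s t hst => ?_⟩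
  refine (ae_eq_condExp_of_forall_setIntegral_eq (F.le s) (hint t)
    (fun A _ _ => (hint s).integrableOn) (fun A hAm _ => ?_)
    (hA s).stronglyMeasurable.aestronglyMeasurable).symm
  obtain ⟨K, hK⟩ := hY.abs_setIntegral_sub_le h hA hH h0 t
  have hst' : (s : ℝ) ≤ t := by exact_mod_cast hst
  have hzero : ∫ ω in A, (Y t ω - Y s ω) ∂P = 0 := by
    have hbd : ∀ m : ℕ, |∫ ω in A, (Y t ω - Y s ω) ∂P| ≤ K * ((t : ℝ) - s) ^ 2 / (m + 1) := by
      intro m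
      set u : ℕ → ℝ≥0 := fun k => s + gridPt (t - s) m k
      have hu : Monotone u := fun k l hkl => add_le_add le_rfl (gridPt_mono _ _ hkl)
      have hulast : u (m + 1) = t := by simp [u, gridPt_last, add_tsub_cancel_of_le hst]
      have hu0 : u 0 = s := by simp [u, gridPt_zero]
      have hsub : ∀ k, (u (k + 1) : ℝ) - u k = (t - s) / (m + 1) := fun k => by
        have := gridPt_succ_sub (t - s) m k
        rw [NNReal.coe_sub hst] at this
        simp only [u, NNReal.coe_add]
        linarith
      have e : ∫ ω in A, (Y t ω - Y s ω) ∂P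
          = ∑ k ∈ Finset.range (m + 1), ∫ ω in A, (Y (u (k + 1)) ω - Y (u k) ω) ∂P := by
        rw [← integral_finsetSum (f := fun k ω => Y (u (k + 1)) ω - Y (u k) ω) _
          fun k _ => ((hint _).sub (hint _)).integrableOn]
        refine integral_congr_ae (Eventually.of_forall fun ω => ?_)
        simp only [Finset.sum_range_sub (fun k => Y (u k) ω), hulast, hu0]
      rw [e]
      calc _ ≤ ∑ k ∈ Finset.range (m + 1), K * (((t : ℝ) - s) / (m + 1)) ^ 2 := by
            refine (Finset.abs_sum_le_sum_abs _ _).trans (Finset.sum_le_sum fun k hk => ?_)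
            rw [← hsub k]
            have hk' : k + 1 ≤ m + 1 := by simpa using hk
            exact hK _ _ (hu k.le_succ) ((hu hk').trans hulast.le) A
              (F.mono (by simp [u]) A hAm)
        _ = K * ((t : ℝ) - s) ^ 2 / (m + 1) := by
            rw [Finset.sum_const, Finset.card_range, nsmul_eq_mul]
            push_cast
            field_simp
    have hlim : Tendsto (fun m : ℕ => K * ((t : ℝ) - s) ^ 2 / ((m : ℝ) + 1)) atTop (𝓝 0) := by
      have := tendsto_one_div_add_atTop_nhds_zero_nat (𝕜 := ℝ) |>.const_mul (K * ((t : ℝ) - s) ^ 2)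
      simpa [div_eq_mul_inv] using this
    exact abs_nonpos_iff.1 (ge_of_tendsto' hlim hbd)
  rw [integral_sub (hint t).integrableOn (hint s).integrableOn] at hzero
  linarith

end HasJumpExpansion

end OpenASEP

namespace OpenASEP

/-! ### Predictable brackets -/

section Brackets

variable {Ω ι : Type*} {mΩ : MeasurableSpace Ω} {P : Measure Ω} {F : Filtration ℝ≥0 mΩ}
  {r : ι → ℝ≥0} {c : ι → ℝ≥0 → Ω → ℕ} {J : Finset ι}

/-- The bracket of two compensated processes accumulates at the rate `∑ i, r i * H i * H' i`: this
is what compensates the jumps `H i * H' i` of the product. -/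
lemma HasJumpExpansion.hasBracketRate [IsProbabilityMeasure P] (h : IsPoissonClocks P F r c)
    {X Y G G' g : ℝ≥0 → Ω → ℝ} {H H' : ι → ℝ≥0 → Ω → ℝ}
    (hX : HasJumpExpansion J c X H G) (hY : HasJumpExpansion J c Y H' G')
    (hXA : Adapted F X) (hYA : Adapted F Y)
    (hH : ∀ i ∈ J, Adapted F (H i)) (hH' : ∀ i ∈ J, Adapted F (H' i))
    (h0 : ∀ t ω, G t ω + ∑ i ∈ J, r i * H i t ω = 0)
    (h0' : ∀ t ω, G' t ω + ∑ i ∈ J, r i * H' i t ω = 0)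
    (hg : IsRingLipschitz J c g) (hgA : Adapted F g)
    (hgH : ∀ t ω, g t ω = ∑ i ∈ J, r i * (H i t ω * H' i t ω)) (hg0 : ∀ t ω, 0 ≤ g t ω) :
    HasBracketRate P F X Y g := by
  have hL2 : ∀ {X G : ℝ≥0 → Ω → ℝ} {H : ι → ℝ≥0 → Ω → ℝ}, HasJumpExpansion J c X H G →
      Adapted F X → ∀ t, MemLp (X t) 2 P := fun {X G H} hX hXA t => by
    rw [memLp_two_iff_integrable_sq ((hXA t).mono (F.le t) le_rfl).aestronglyMeasurable]
    refine ((hX.mul h.mono hX).integrable h (fun s => (hXA s).mul (hXA s)) t).congr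
      (Eventually.of_forall fun ω => (sq _).symm)
  have hIA := hg.adapted_timeIntegral h.mono hgA
  refine ⟨fun ω t => hg.intervalIntegrable h.mono ω _ _, ⟨hL2 hX hXA, hL2 hY hYA,
    hg.isStronglyPredictable_timeIntegral h.mono hgA, fun ω => by simp [timeIntegral],
    fun ω t => (hg.continuous_timeIntegral h.mono ω).continuousWithinAt,
    fun ω => ((timeIntegral_mono h.mono hg hg0 ω).monotoneOn univ).locallyBoundedVariationOn, ?_⟩,
    hg.hasDerivWithinAt_timeIntegral h.mono h.rightCts⟩
  refine ((hX.mul h.mono hY).sub h.mono (hg.hasJumpExpansion_timeIntegral h.mono)).martingale h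
    (fun t => ((hXA t).mul (hYA t)).sub (hIA t)) (fun i hi t => ?_) fun t ω => ?_
  · exact ((((hXA t).mul (hH' i hi t)).add ((hYA t).mul (hH i hi t))).add
      ((hH i hi t).mul (hH' i hi t))).sub measurable_const
  · have e : ∑ i ∈ J, (r i : ℝ) * (X t ω * H' i t ω + Y t ω * H i t ω + H i t ω * H' i t ω - 0)
        = X t ω * (∑ i ∈ J, r i * H' i t ω) + Y t ω * (∑ i ∈ J, r i * H i t ω)
          + ∑ i ∈ J, r i * (H i t ω * H' i t ω) := by
      simp only [Finset.mul_sum, ← Finset.sum_add_distrib]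
      exact Finset.sum_congr rfl fun i _ => by ring
    rw [e, ← hgH]
    linear_combination X t ω * h0' t ω + Y t ω * h0 t ω

/-- A deterministic exponential has no jumps; its Taylor remainder is of second order. -/
lemma hasJumpExpansion_exp (hc : ∀ i ω, Monotone fun t => c i t ω) {ν : ℝ} (hν : 0 ≤ ν) :
    HasJumpExpansion J c (fun t _ => Real.exp (ν * t)) (fun _ _ _ => 0)
      (fun t _ => ν * Real.exp (ν * t)) := by
  intro T
  set L := (1 + ν) ^ 2 * Real.exp (ν * T)
  have h1 : ∀ t ≤ T, Real.exp (ν * t) ≤ Real.exp (ν * T) := fun t ht =>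
    Real.exp_le_exp.2 (mul_le_mul_of_nonneg_left (by exact_mod_cast ht) hν)
  have hE : 0 < Real.exp (ν * T) := Real.exp_pos _
  have hE1 : 1 ≤ Real.exp (ν * T) := Real.one_le_exp (mul_nonneg hν T.coe_nonneg)
  have hL : 1 ≤ L := by
    have : (1 : ℝ) ≤ (1 + ν) ^ 2 := by nlinarith
    nlinarith
  have hle : ∀ k : ℕ, L ≤ L ^ (k + 1) := fun k => le_self_pow₀ hL (by omega)
  refine ⟨L, hL, fun ω s s' h hT => ⟨?_, fun i _ => ?_, ?_, ?_⟩⟩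
  · rw [abs_of_pos (Real.exp_pos _)]
    refine ((h1 s (h.trans hT)).trans ?_).trans (hle _)
    exact le_mul_of_one_le_left hE.le (one_le_pow₀ (by linarith))
  · simp only [abs_zero]
    positivity
  · rw [abs_of_nonneg (by positivity)]
    refine ((mul_le_mul_of_nonneg_left (h1 s (h.trans hT)) hν).trans ?_).trans (hle _)
    exact mul_le_mul_of_nonneg_right (by nlinarith) hE.le
  · have hh : (0 : ℝ) ≤ (s' : ℝ) - s := sub_nonneg.2 (by exact_mod_cast h)
    set z := ν * ((s' : ℝ) - s) with hz
    have hz0 : 0 ≤ z := mul_nonneg hν hh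
    have e : Real.exp (ν * s') = Real.exp (ν * s) * Real.exp z := by
      rw [← Real.exp_add, hz]
      ring_nf
    obtain ⟨-, h2⟩ := exp_sub_le hz0
    have h3 := Real.add_one_le_exp z
    have e2 : Real.exp (ν * s') - Real.exp (ν * s) - ∑ i ∈ J, (0 : ℝ) * (c i s' ω - c i s ω : ℝ)
        - ν * Real.exp (ν * s) * (s' - s) = Real.exp (ν * s) * (Real.exp z - 1 - z) := by
      simp only [zero_mul, Finset.sum_const_zero]
      rw [e, hz]
      ring
    rw [e2, abs_of_nonneg (mul_nonneg (Real.exp_pos _).le (by linarith))]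
    obtain ⟨n, hn, -⟩ := increments_facts (J := J) hc h ω
    rw [hn]
    have hnn : 0 ≤ secondOrder 0 n := secondOrder_nonneg le_rfl
    have hw : ((s' : ℝ) - s) ^ 2 ≤ secondOrder ((s' : ℝ) - s) n := by
      have : 0 ≤ ((s' : ℝ) - s) * n := mul_nonneg hh n.cast_nonneg
      simp only [secondOrder] at hnn ⊢
      linarith
    calc Real.exp (ν * s) * (Real.exp z - 1 - z) ≤ Real.exp (ν * s) * (z ^ 2 * Real.exp z) := by
          gcongr
      _ = Real.exp (ν * s') * ν ^ 2 * ((s' : ℝ) - s) ^ 2 := by rw [e, hz]; ring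
      _ ≤ Real.exp (ν * T) * (1 + ν) ^ 2 * secondOrder ((s' : ℝ) - s) n := by
          have := h1 s' hT
          gcongr
          linarith
      _ = L * secondOrder ((s' : ℝ) - s) n := by simp only [L]; ring
      _ ≤ _ := mul_le_mul_of_nonneg_right (hle _) (secondOrder_nonneg hh)

end Brackets

/-! ### Jumps of the exclusion process -/

variable {Ω : Type*} {mΩ : MeasurableSpace Ω} {N : ℕ∞} {P : Measure Ω} {F : Filtration ℝ≥0 mΩ}
  {p q α β γ δ : ℝ} {C : ℕ → Dir → ℝ≥0 → Ω → ℕ} {η : ℝ≥0 → Ω → ℕ → ℤ}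

open Classical in
/-- The indicator that a move across the bond `x` is possible. -/
noncomputable def canMoveInd (N : ℕ∞) (η : ℝ≥0 → Ω → ℕ → ℤ) (x : ℕ) (d : Dir) (t : ℝ≥0) (ω : Ω) :
    ℝ :=
  if CanMove N x (η t ω) d then 1 else 0

/-- The relative jump at a ring of the clock `i` of a quantity that is multiplied by `κ d` when a
particle crosses the bond `x` in the direction `d`. -/
noncomputable def relJump (η : ℝ≥0 → Ω → ℕ → ℤ) (κ : Dir → ℝ) (x : ℕ) (i : Bond N × Dir) (t : ℝ≥0)
    (ω : Ω) : ℝ :=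
  if i.1.1 = x then (κ i.2 - 1) * canMoveInd N η x i.2 t ω else 0

lemma canMoveInd_nonneg (x : ℕ) (d : Dir) (t : ℝ≥0) (ω : Ω) : 0 ≤ canMoveInd N η x d t ω := by
  unfold canMoveInd
  split_ifs <;> norm_num

lemma canMoveInd_le_one (x : ℕ) (d : Dir) (t : ℝ≥0) (ω : Ω) : canMoveInd N η x d t ω ≤ 1 := by
  unfold canMoveInd
  split_ifs <;> norm_num

lemma canMoveInd_sq (x : ℕ) (d : Dir) (t : ℝ≥0) (ω : Ω) :
    canMoveInd N η x d t ω * canMoveInd N η x d t ω = canMoveInd N η x d t ω := by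
  unfold canMoveInd
  split_ifs <;> norm_num

/-- Only the two clocks of the bond `x` contribute to a sum over clocks of terms that vanish off
this bond. -/
lemma sum_clocks_eq {J : Finset (Bond N × Dir)} {x : ℕ} (hx : (x : ℕ∞) ≤ N)
    (hJ : ∀ i : Bond N × Dir, i.1.1 ≤ x + 1 → i ∈ J) {f : Bond N × Dir → ℝ}
    (hf : ∀ i : Bond N × Dir, i.1.1 ≠ x → f i = 0) :
    ∑ i ∈ J, f i = f (⟨x, hx⟩, .right) + f (⟨x, hx⟩, .left) := by
  classical
  have hne : ((⟨x, hx⟩, .right) : Bond N × Dir) ≠ (⟨x, hx⟩, .left) := by simp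
  rw [← Finset.sum_pair hne]
  refine (Finset.sum_subset (fun i hi => ?_) fun i _ hi => hf i fun he => hi ?_).symm
  · rw [Finset.mem_insert, Finset.mem_singleton] at hi
    rcases hi with rfl | rfl <;> exact hJ _ (Nat.le_succ x)
  · obtain ⟨⟨y, hy⟩, d⟩ := i
    subst he
    cases d <;> simp

namespace IsOpenASEP

/-- If the clocks in `J` ring at most once during `(s, t]`, then the clocks of the bonds up to
`x + 1` have at most one common ring time. -/
lemma ring_unique (h : IsOpenASEP N P F p q α β γ δ C η) {J : Finset (Bond N × Dir)} {x : ℕ}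
    (hJ : ∀ i : Bond N × Dir, i.1.1 ≤ x + 1 → i ∈ J) {s t : ℝ≥0} (hst : s ≤ t) {ω : Ω}
    (hn : totalRings J (fun i => C i.1 i.2) t ω ≤ totalRings J (fun i => C i.1 i.2) s ω + 1) :
    ∀ i j : Bond N × Dir, i.1.1 ≤ x + 1 → j.1.1 ≤ x + 1 → ∀ τ ∈ Ioc s t, ∀ τ' ∈ Ioc s t,
      Rings (fun r => C i.1 i.2 r ω) τ → Rings (fun r => C j.1 j.2 r ω) τ' → τ = τ' := by
  classical
  intro i j hi hj τ hτ τ' hτ' hr hr'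
  rw [h.clocks.totalRings_eq hst, Finset.sum_apply] at hn
  have hn1 : ∑ k ∈ J, (C k.1 k.2 t ω - C k.1 k.2 s ω) ≤ 1 := by simpa using hn
  have h1 : C i.1 i.2 s ω < C i.1 i.2 τ ω := hr.lt hτ.1
  have h2 : C i.1 i.2 τ ω ≤ C i.1 i.2 t ω := h.clocks.mono i ω hτ.2
  have h1' : C j.1 j.2 s ω < C j.1 j.2 τ' ω := hr'.lt hτ'.1
  have h2' : C j.1 j.2 τ' ω ≤ C j.1 j.2 t ω := h.clocks.mono j ω hτ'.2
  by_cases hij : i = j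
  · subst hij
    have h3 := (Finset.single_le_sum (f := fun k : Bond N × Dir => C k.1 k.2 t ω - C k.1 k.2 s ω)
      (fun _ _ => Nat.zero_le _) (hJ i hi)).trans hn1
    rcases lt_trichotomy τ τ' with hl | hl | hl
    · have : C i.1 i.2 τ ω < C i.1 i.2 τ' ω := hr'.lt hl
      omega
    · exact hl
    · have : C i.1 i.2 τ' ω < C i.1 i.2 τ ω := hr.lt hl
      omega
  · have h3 := (Finset.sum_le_sum_of_subset (f := fun k : Bond N × Dir =>
      C k.1 k.2 t ω - C k.1 k.2 s ω) (Finset.insert_subset (hJ i hi)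
        (Finset.singleton_subset_iff.2 (hJ j hj)))).trans hn1
    rw [Finset.sum_pair hij] at h3
    omega

lemma adapted_canMoveInd (h : IsOpenASEP N P F p q α β γ δ C η) {x : ℕ} (hx : (x : ℕ∞) ≤ N)
    (d : Dir) : Adapted F (canMoveInd N η x d) := fun t =>
  Measurable.ite (h.measurableSet_canMove hx t d) measurable_const measurable_const

lemma isRingLipschitz_canMoveInd (h : IsOpenASEP N P F p q α β γ δ C η)
    {J : Finset (Bond N × Dir)} {x : ℕ} (hx : (x : ℕ∞) ≤ N)
    (hJ : ∀ i : Bond N × Dir, i.1.1 ≤ x + 1 → i ∈ J) (d : Dir) :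
    IsRingLipschitz J (fun i => C i.1 i.2) (canMoveInd N η x d) := by
  refine fun T => ⟨1, le_rfl, fun ω s s' hs _ => ?_⟩
  have b0 := canMoveInd_nonneg (N := N) (η := η) x d s ω
  have b1 := canMoveInd_le_one (N := N) (η := η) x d s ω
  have b0' := canMoveInd_nonneg (N := N) (η := η) x d s' ω
  have b1' := canMoveInd_le_one (N := N) (η := η) x d s' ω
  simp only [one_pow, one_mul]
  refine ⟨abs_le.2 ⟨by linarith, b1⟩, ?_⟩
  have hss : (0 : ℝ) ≤ (s' : ℝ) - s := sub_nonneg.2 (by exact_mod_cast hs)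
  have hle := totalRings_mono (J := J) h.clocks.mono ω hs
  rcases hle.eq_or_lt with he | hlt
  · have hc : ∀ i : Bond N × Dir, i.1.1 ≤ x + 1 → C i.1 i.2 s' ω = C i.1 i.2 s ω := by
      intro i hi
      have := (Finset.sum_eq_sum_iff_of_le fun k _ => h.clocks.mono k ω hs).1 he i (hJ i hi)
      exact this.symm
    have : canMoveInd N η x d s' ω = canMoveInd N η x d s ω := by
      unfold canMoveInd
      classical exact if_congr (h.canMove_iff hx hs hc d) rfl rfl
    rw [this, sub_self, abs_zero]
    exact rings_length_nonneg h.clocks.mono hs ω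
  · have : (totalRings J (fun i => C i.1 i.2) s ω : ℝ) + 1
        ≤ totalRings J (fun i => C i.1 i.2) s' ω := by exact_mod_cast hlt
    rw [abs_le]
    constructor <;> linarith

/-- A product of powers of the two crossing numbers of the bond `x` changes only at the rings of the
two clocks of this bond; at most one ring leaves no error at all. -/
lemma hasJumpExpansion_crossings (h : IsOpenASEP N P F p q α β γ δ C η)
    {J : Finset (Bond N × Dir)} {x : ℕ} (hx : (x : ℕ∞) ≤ N)
    (hJ : ∀ i : Bond N × Dir, i.1.1 ≤ x + 1 → i ∈ J) {κ : Dir → ℝ} (hκ : ∀ d, 0 ≤ κ d) :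
    HasJumpExpansion J (fun i => C i.1 i.2)
      (fun t ω => κ .right ^ crossings N C η x .right t ω * κ .left ^ crossings N C η x .left t ω)
      (fun i t ω => relJump η κ x i t ω *
        (κ .right ^ crossings N C η x .right t ω * κ .left ^ crossings N C η x .left t ω))
      (fun _ _ => 0) := by
  classical
  set U : ℝ≥0 → Ω → ℝ := fun t ω =>
    κ .right ^ crossings N C η x .right t ω * κ .left ^ crossings N C η x .left t ω with hU
  set c : Bond N × Dir → ℝ≥0 → Ω → ℕ := fun i => C i.1 i.2
  set a := max 1 (max (κ .right) (κ .left)) with ha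
  have ha1 : 1 ≤ a := le_max_left _ _
  have haκ : ∀ d, κ d ≤ a := by
    rintro (_ | _)
    · exact (le_max_left _ _).trans (le_max_right _ _)
    · exact (le_max_right _ _).trans (le_max_right _ _)
  have hU0 : ∀ t ω, 0 ≤ U t ω := fun t ω =>
    mul_nonneg (pow_nonneg (hκ _) _) (pow_nonneg (hκ _) _)
  have hUa : ∀ t ω, U t ω ≤ a ^ totalRings J c t ω := by
    intro t ω
    have h1 : ∀ d, crossings N C η x d t ω ≤ C x d t ω := fun d => by
      have h2 : C x d 0 ω = 0 := h.clocks.zero (⟨x, hx⟩, d) ω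
      have := crossings_sub_le (N := N) (η := η) (h.clock_mono hx d ω) (zero_le : 0 ≤ t)
      rwa [crossings_zero, h2, zero_add, Nat.sub_zero] at this
    have h3 : C x .right t ω + C x .left t ω ≤ totalRings J c t ω := by
      have hne : ((⟨x, hx⟩, .right) : Bond N × Dir) ≠ (⟨x, hx⟩, .left) := by simp
      have := Finset.sum_le_sum_of_subset (f := fun k : Bond N × Dir => C k.1 k.2 t ω)
        (Finset.insert_subset (hJ (⟨x, hx⟩, .right) (Nat.le_succ x))
        (Finset.singleton_subset_iff.2 (hJ (⟨x, hx⟩, .left) (Nat.le_succ x))))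
      rwa [Finset.sum_pair hne] at this
    calc U t ω ≤ a ^ crossings N C η x .right t ω * a ^ crossings N C η x .left t ω := by
          simp only [hU]
          gcongr
          exacts [pow_nonneg (hκ _) _, hκ _, haκ _, hκ _, haκ _]
      _ = a ^ (crossings N C η x .right t ω + crossings N C η x .left t ω) := (pow_add _ _ _).symm
      _ ≤ _ := pow_le_pow_right₀ ha1 (by linarith [h1 .right, h1 .left])
  have hrel : ∀ (i : Bond N × Dir) t ω, |relJump η κ x i t ω| ≤ a := by
    intro i t ω
    unfold relJump
    split_ifs
    · rw [abs_mul, abs_of_nonneg (canMoveInd_nonneg _ _ _ _)]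
      refine (mul_le_of_le_one_right (abs_nonneg _) (canMoveInd_le_one _ _ _ _)).trans ?_
      exact abs_le.2 ⟨by linarith [hκ i.2], by linarith [haκ i.2]⟩
    · simpa using zero_le_one.trans ha1
  have hH : ∀ (i : Bond N × Dir) t ω,
      |relJump η κ x i t ω * U t ω| ≤ a ^ (totalRings J c t ω + 1) := by
    intro i t ω
    rw [abs_mul, abs_of_nonneg (hU0 t ω), pow_succ']
    exact mul_le_mul (hrel i t ω) (hUa t ω) (hU0 t ω) (by linarith)
  have hUa' : ∀ t ω, U t ω ≤ a ^ (totalRings J c t ω + 1) := fun t ω =>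
    (hUa t ω).trans (pow_le_pow_right₀ ha1 (Nat.le_succ _))
  have hpow : ∀ k : ℕ, 2 * a ^ (k + 1) ≤ (4 * a) ^ (k + 1) := fun k => by
    have := const_mul_pow_le (K := 2) (L := a) (by norm_num) (by linarith) k
    norm_num at this ⊢
    exact this
  have hpow' : ∀ k : ℕ, a ^ (k + 1) ≤ (4 * a) ^ (k + 1) := fun k =>
    pow_le_pow_left₀ (by linarith) (by linarith) _
  refine fun T => ⟨4 * a, by linarith, fun ω s s' hs hT => ⟨?_, fun i _ => (hH i s ω).trans
    (hpow' _), by simp only [abs_zero]; positivity, ?_⟩⟩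
  · rw [abs_of_nonneg (hU0 s ω)]
    exact (hUa' s ω).trans (hpow' _)
  obtain ⟨n, hn, hnk, hsum, hD0, hD⟩ := increments_facts (J := J) h.clocks.mono hs ω
  have hw0 := secondOrder_rings_nonneg (J := J) h.clocks.mono hs ω
  rw [hn] at hw0 ⊢
  simp only [zero_mul, sub_zero]
  rcases le_or_gt n 1 with hn1 | hn1
  · -- at most one ring: the expansion is exact
    have htot : totalRings J c s' ω ≤ totalRings J c s ω + 1 := by
      have : (totalRings J c s' ω : ℝ) ≤ totalRings J c s ω + 1 := by
        have : (n : ℝ) ≤ 1 := by exact_mod_cast hn1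
        linarith
      exact_mod_cast this
    have huniq := h.ring_unique hJ hs htot
    have hcr := fun d => h.crossings_eq_ite hx (d := d) hs huniq
    have hsum2 := sum_clocks_eq hx hJ
      (f := fun i => relJump η κ x i s ω * U s ω * (c i s' ω - c i s ω : ℝ)) fun i hi => by
        simp [relJump, hi]
    have hle2 : (C x .right s' ω - C x .right s ω) + (C x .left s' ω - C x .left s ω) ≤ 1 := by
      have hne : ((⟨x, hx⟩, .right) : Bond N × Dir) ≠ (⟨x, hx⟩, .left) := by simp
      have h1 := Finset.sum_le_sum_of_subset
        (f := fun k : Bond N × Dir => C k.1 k.2 s' ω - C k.1 k.2 s ω)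
        (Finset.insert_subset (hJ (⟨x, hx⟩, .right) (Nat.le_succ x))
        (Finset.singleton_subset_iff.2 (hJ (⟨x, hx⟩, .left) (Nat.le_succ x))))
      rw [Finset.sum_pair hne] at h1
      refine h1.trans ?_
      rw [h.clocks.totalRings_eq hs, Finset.sum_apply] at htot
      exact Nat.le_of_add_le_add_left htot
    have hmR := h.clock_mono hx .right ω hs
    have hmL := h.clock_mono hx .left ω hs
    simp only at hmR hmL
    obtain ⟨dR, hdR⟩ := Nat.exists_eq_add_of_le hmR
    obtain ⟨dL, hdL⟩ := Nat.exists_eq_add_of_le hmL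
    have hzero : U s' ω - U s ω - ∑ i ∈ J, relJump η κ x i s ω * U s ω *
        (c i s' ω - c i s ω : ℝ) = 0 := by
      rw [hsum2]
      simp only [hU, hcr, relJump, c, canMoveInd, if_true]
      rw [hdR, hdL] at hle2 ⊢
      have hcases : (dR = 0 ∧ dL = 0) ∨ (dR = 1 ∧ dL = 0) ∨ (dR = 0 ∧ dL = 1) := by omega
      rcases hcases with ⟨rfl, rfl⟩ | ⟨rfl, rfl⟩ | ⟨rfl, rfl⟩
      · simp
      · by_cases hc : CanMove N x (η s ω) .right
        · simp [hc]
          ring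
        · simp [hc]
      · by_cases hc : CanMove N x (η s ω) .left
        · simp [hc]
          ring
        · simp [hc]
    rw [hzero, abs_zero]
    positivity
  · -- two rings or more: every term is of second order
    have hn2 : (2 : ℝ) ≤ n := by exact_mod_cast hn1
    set k := totalRings J c s' ω
    have hA := pow_rings_mono (J := J) h.clocks.mono ha1 hs ω
    have hS : |∑ i ∈ J, relJump η κ x i s ω * U s ω * (c i s' ω - c i s ω : ℝ)|
        ≤ a ^ (k + 1) * n := by
      rw [← hsum, Finset.mul_sum]
      refine (Finset.abs_sum_le_sum_abs _ _).trans (Finset.sum_le_sum fun i hi => ?_)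
      rw [abs_mul, abs_of_nonneg (hD0 i hi)]
      exact mul_le_mul_of_nonneg_right ((hH i s ω).trans hA) (hD0 i hi)
    have hUU : |U s' ω - U s ω| ≤ a ^ (k + 1) * 2 := by
      have h1 := hUa' s' ω
      have h2 := (hUa' s ω).trans hA
      exact abs_le.2 ⟨by linarith [hU0 s ω, hU0 s' ω], by linarith [hU0 s ω, hU0 s' ω]⟩
    have hw : 2 + (n : ℝ) ≤ 2 * secondOrder ((s' : ℝ) - s) n := by
      have hss : (0 : ℝ) ≤ (s' : ℝ) - s := sub_nonneg.2 (by exact_mod_cast hs)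
      have h1 : 0 ≤ ((s' : ℝ) - s) * n := mul_nonneg hss n.cast_nonneg
      unfold secondOrder
      nlinarith [sq_nonneg ((s' : ℝ) - s)]
    calc _ ≤ a ^ (k + 1) * 2 + a ^ (k + 1) * n := (abs_sub _ _).trans (add_le_add hUU hS)
      _ = a ^ (k + 1) * (2 + n) := by ring
      _ ≤ a ^ (k + 1) * (2 * secondOrder ((s' : ℝ) - s) n) := by gcongr
      _ = 2 * a ^ (k + 1) * secondOrder ((s' : ℝ) - s) n := by ring
      _ ≤ _ := mul_le_mul_of_nonneg_right (hpow k) hw0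

end IsOpenASEP

end OpenASEP

namespace OpenASEP

/-! ### The Gärtner transform and its martingale part -/

variable {Ω : Type*} {mΩ : MeasurableSpace Ω} {N : ℕ∞} {P : Measure Ω} {F : Filtration ℝ≥0 mΩ}
  {p q α β γ δ : ℝ} {C : ℕ → Dir → ℝ≥0 → Ω → ℕ} {η : ℝ≥0 → Ω → ℕ → ℤ}

/-- The factor by which the Gärtner transform at `x` is multiplied when a particle crosses the
bond `x`. -/
noncomputable def crossFactor (p q : ℝ) : Dir → ℝ
  | .right => q / p
  | .left => p / q

/-- The relative drift of the Gärtner transform at `x`: its growth rate between the rings together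
with the mean effect of the crossings. -/
noncomputable def relDrift (N : ℕ∞) (p q α β γ δ : ℝ) (η : ℝ≥0 → Ω → ℕ → ℤ) (x : ℕ) (t : ℝ≥0)
    (ω : Ω) : ℝ :=
  (p + q - 2 * √(p * q))
    + (attemptRate N p q α β γ δ x .right).toNNReal * ((q / p - 1) * canMoveInd N η x .right t ω)
    + (attemptRate N p q α β γ δ x .left).toNNReal * ((p / q - 1) * canMoveInd N η x .left t ω)

/-- The relative rate at which the bracket of the martingale part at `x` accumulates. -/
noncomputable def relBracket (N : ℕ∞) (p q α β γ δ : ℝ) (η : ℝ≥0 → Ω → ℕ → ℤ) (x : ℕ) (t : ℝ≥0)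
    (ω : Ω) : ℝ :=
  (attemptRate N p q α β γ δ x .right).toNNReal
      * ((q / p - 1) ^ 2 * canMoveInd N η x .right t ω)
    + (attemptRate N p q α β γ δ x .left).toNNReal
      * ((p / q - 1) ^ 2 * canMoveInd N η x .left t ω)

/-- The martingale part of the Gärtner transform: the transform minus its initial value and its
integrated drift. -/
noncomputable def noise (N : ℕ∞) (p q α β γ δ : ℝ) (C : ℕ → Dir → ℝ≥0 → Ω → ℕ)
    (η : ℝ≥0 → Ω → ℕ → ℤ) (x : ℕ) (t : ℝ≥0) (ω : Ω) : ℝ :=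
  gartner p q (height N C η) t ω x - gartner p q (height N C η) 0 ω x
    - timeIntegral (fun s ω =>
        relDrift N p q α β γ δ η x s ω * gartner p q (height N C η) s ω x) t ω

/-- The drift compensates the jumps. -/
lemma noise_compensation {J : Finset (Bond N × Dir)} {x : ℕ} (hx : (x : ℕ∞) ≤ N)
    (hJ : ∀ i : Bond N × Dir, i.1.1 ≤ x + 1 → i ∈ J) (t : ℝ≥0) (ω : Ω) :
    ((p + q - 2 * √(p * q)) * gartner p q (height N C η) t ω x
        - relDrift N p q α β γ δ η x t ω * gartner p q (height N C η) t ω x)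
      + ∑ i ∈ J, ((attemptRate N p q α β γ δ i.1 i.2).toNNReal : ℝ) *
        (relJump η (crossFactor p q) x i t ω * gartner p q (height N C η) t ω x) = 0 := by
  rw [sum_clocks_eq hx hJ fun i hi => by simp [relJump, hi]]
  simp only [relJump, relDrift, crossFactor, if_true]
  ring

namespace IsOpenASEP

/-- A particle that crosses the bond `x` lowers the height at `x` by two. -/
lemma height_eq (h : IsOpenASEP N P F p q α β γ δ C η) {x : ℕ} (hx : (x : ℕ∞) ≤ N) (t : ℝ≥0)
    (ω : Ω) : height N C η t ω x
      = ∑ y ∈ Finset.Icc 1 x, η 0 ω y - 2 * current N C η x t ω := by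
  induction x with
  | zero => simp [height, current]; ring
  | succ x ih =>
    have hx' : (x : ℕ∞) ≤ N := le_trans (by exact_mod_cast Nat.le_succ x) hx
    have e := ih hx'
    have h1 := h.evolution t ω x hx
    unfold height at e ⊢
    rw [Finset.sum_Icc_succ_top (by omega), Finset.sum_Icc_succ_top (by omega), h1]
    linarith

lemma gartner_eq (h : IsOpenASEP N P F p q α β γ δ C η) (hp : 0 < p) (hq : 0 < q) {x : ℕ}
    (hx : (x : ℕ∞) ≤ N) (t : ℝ≥0) (ω : Ω) : gartner p q (height N C η) t ω x
      = Real.exp (-(1 / 2 * Real.log (q / p)) * (∑ y ∈ Finset.Icc 1 x, η 0 ω y : ℤ)) *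
        (crossFactor p q .right ^ crossings N C η x .right t ω *
          crossFactor p q .left ^ crossings N C η x .left t ω) *
        Real.exp ((p + q - 2 * √(p * q)) * t) := by
  have e1 : ∀ n : ℕ, (q / p) ^ n = Real.exp (n * Real.log (q / p)) := fun n => by
    rw [Real.exp_nat_mul, Real.exp_log (by positivity)]
  have e2 : ∀ n : ℕ, (p / q) ^ n = Real.exp (-(n * Real.log (q / p))) := fun n => by
    rw [Real.exp_neg, ← e1, ← inv_pow, inv_div]
  simp only [gartner, crossFactor, h.height_eq hx, current]
  rw [e1, e2, ← Real.exp_add, ← Real.exp_add, ← Real.exp_add]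
  congr 1
  push_cast
  ring

lemma hasJumpExpansion_gartner (h : IsOpenASEP N P F p q α β γ δ C η) (hp : 0 < p) (hq : 0 < q)
    {J : Finset (Bond N × Dir)} {x : ℕ} (hx : (x : ℕ∞) ≤ N)
    (hJ : ∀ i : Bond N × Dir, i.1.1 ≤ x + 1 → i ∈ J) :
    HasJumpExpansion J (fun i => C i.1 i.2) (fun t ω => gartner p q (height N C η) t ω x)
      (fun i t ω => relJump η (crossFactor p q) x i t ω * gartner p q (height N C η) t ω x)
      (fun t ω => (p + q - 2 * √(p * q)) * gartner p q (height N C η) t ω x) := by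
  have hν : 0 ≤ p + q - 2 * √(p * q) := by
    rw [Real.sqrt_mul hp.le]
    nlinarith [sq_nonneg (√p - √q), Real.sq_sqrt hp.le, Real.sq_sqrt hq.le]
  have hκ : ∀ d, 0 ≤ crossFactor p q d := by
    rintro (_ | _) <;> simp only [crossFactor] <;> positivity
  have hconst : ∀ ω, |Real.exp (-(1 / 2 * Real.log (q / p)) *
      (∑ y ∈ Finset.Icc 1 x, η 0 ω y : ℤ))| ≤ Real.exp (|1 / 2 * Real.log (q / p)| * x) := by
    intro ω
    rw [abs_of_pos (Real.exp_pos _)]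
    refine Real.exp_le_exp.2 ((le_abs_self _).trans ?_)
    rw [abs_mul, abs_neg]
    gcongr
    push_cast
    refine (Finset.abs_sum_le_sum_abs _ _).trans ?_
    calc _ ≤ ∑ y ∈ Finset.Icc 1 x, (1 : ℝ) := by
          refine Finset.sum_le_sum fun y hy => ?_
          rw [Finset.mem_Icc] at hy
          have hyN : (y : ℕ∞) ≤ N := le_trans (by exact_mod_cast hy.2) hx
          rcases h.spin 0 ω y hy.1 hyN with e | e <;> simp [e]
      _ = x := by simp
  have := ((HasJumpExpansion.const (J := J) h.clocks.mono hconst).mul h.clocks.mono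
    (h.hasJumpExpansion_crossings hx hJ hκ)).mul h.clocks.mono
    (hasJumpExpansion_exp h.clocks.mono hν)
  simp only [← h.gartner_eq hp hq hx] at this
  convert! this using 1
  · funext i t ω
    rw [h.gartner_eq hp hq hx]
    ring
  · funext t ω
    rw [h.gartner_eq hp hq hx]
    ring

lemma adapted_gartner (h : IsOpenASEP N P F p q α β γ δ C η) {x : ℕ} (hx : (x : ℕ∞) ≤ N) :
    Adapted F fun t ω => gartner p q (height N C η) t ω x := by
  intro t
  have h1 : Measurable[F t] fun ω => height N C η t ω x := by
    have h0 : ((0 : ℕ) : ℕ∞) ≤ N := by simp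
    have hcr : ∀ d, Measurable[F t] fun ω => (crossings N C η 0 d t ω : ℤ) := fun d =>
      (Measurable.of_discrete (f := fun n : ℕ => (n : ℤ))).comp (h.measurable_crossings h0 d t)
    refine (((hcr .left).sub (hcr .right)).const_mul 2).add
      (Finset.measurable_sum _ fun y hy => ?_)
    rw [Finset.mem_Icc] at hy
    exact h.adapted y hy.1 (le_trans (by exact_mod_cast hy.2) hx) t
  exact (Measurable.of_discrete (f := fun n : ℤ =>
    Real.exp (-(1 / 2 * Real.log (q / p)) * n + (p + q - 2 * √(p * q)) * t))).comp h1

lemma isRingLipschitz_relDrift (h : IsOpenASEP N P F p q α β γ δ C η)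
    {J : Finset (Bond N × Dir)} {x : ℕ} (hx : (x : ℕ∞) ≤ N)
    (hJ : ∀ i : Bond N × Dir, i.1.1 ≤ x + 1 → i ∈ J) :
    IsRingLipschitz J (fun i => C i.1 i.2) (relDrift N p q α β γ δ η x) := by
  have hc : ∀ a : ℝ, IsRingLipschitz J (fun i : Bond N × Dir => C i.1 i.2) fun _ _ => a :=
    fun a => .const h.clocks.mono fun _ => le_rfl
  have hcan := h.isRingLipschitz_canMoveInd hx hJ
  exact ((hc _).add h.clocks.mono ((hc _).mul h.clocks.mono ((hc _).mul h.clocks.mono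
    (hcan .right)))).add h.clocks.mono ((hc _).mul h.clocks.mono ((hc _).mul h.clocks.mono
    (hcan .left)))

lemma isRingLipschitz_relBracket (h : IsOpenASEP N P F p q α β γ δ C η)
    {J : Finset (Bond N × Dir)} {x : ℕ} (hx : (x : ℕ∞) ≤ N)
    (hJ : ∀ i : Bond N × Dir, i.1.1 ≤ x + 1 → i ∈ J) :
    IsRingLipschitz J (fun i => C i.1 i.2) (relBracket N p q α β γ δ η x) := by
  have hc : ∀ a : ℝ, IsRingLipschitz J (fun i : Bond N × Dir => C i.1 i.2) fun _ _ => a :=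
    fun a => .const h.clocks.mono fun _ => le_rfl
  have hcan := h.isRingLipschitz_canMoveInd hx hJ
  exact ((hc _).mul h.clocks.mono ((hc _).mul h.clocks.mono (hcan .right))).add h.clocks.mono
    ((hc _).mul h.clocks.mono ((hc _).mul h.clocks.mono (hcan .left)))

lemma adapted_relDrift (h : IsOpenASEP N P F p q α β γ δ C η) {x : ℕ} (hx : (x : ℕ∞) ≤ N) :
    Adapted F (relDrift N p q α β γ δ η x) := fun t =>
  (measurable_const.add (((h.adapted_canMoveInd hx .right t).const_mul _).const_mul _)).add
    (((h.adapted_canMoveInd hx .left t).const_mul _).const_mul _)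

lemma adapted_relBracket (h : IsOpenASEP N P F p q α β γ δ C η) {x : ℕ} (hx : (x : ℕ∞) ≤ N) :
    Adapted F (relBracket N p q α β γ δ η x) := fun t =>
  (((h.adapted_canMoveInd hx .right t).const_mul _).const_mul _).add
    (((h.adapted_canMoveInd hx .left t).const_mul _).const_mul _)

lemma adapted_relJump (h : IsOpenASEP N P F p q α β γ δ C η) {x : ℕ} (hx : (x : ℕ∞) ≤ N)
    (κ : Dir → ℝ) (i : Bond N × Dir) : Adapted F (relJump η κ x i) := by
  intro t
  unfold relJump
  split_ifs
  · exact (h.adapted_canMoveInd hx i.2 t).const_mul _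
  · exact measurable_const

lemma isRingLipschitz_drift (h : IsOpenASEP N P F p q α β γ δ C η) (hp : 0 < p) (hq : 0 < q)
    {J : Finset (Bond N × Dir)} {x : ℕ} (hx : (x : ℕ∞) ≤ N)
    (hJ : ∀ i : Bond N × Dir, i.1.1 ≤ x + 1 → i ∈ J) :
    IsRingLipschitz J (fun i => C i.1 i.2) fun s ω =>
      relDrift N p q α β γ δ η x s ω * gartner p q (height N C η) s ω x :=
  (h.isRingLipschitz_relDrift hx hJ).mul h.clocks.mono
    ((h.hasJumpExpansion_gartner hp hq hx hJ).isRingLipschitz h.clocks.mono)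

lemma hasJumpExpansion_noise (h : IsOpenASEP N P F p q α β γ δ C η) (hp : 0 < p) (hq : 0 < q)
    {J : Finset (Bond N × Dir)} {x : ℕ} (hx : (x : ℕ∞) ≤ N)
    (hJ : ∀ i : Bond N × Dir, i.1.1 ≤ x + 1 → i ∈ J) :
    HasJumpExpansion J (fun i => C i.1 i.2) (noise N p q α β γ δ C η x)
      (fun i t ω => relJump η (crossFactor p q) x i t ω * gartner p q (height N C η) t ω x)
      (fun t ω => (p + q - 2 * √(p * q)) * gartner p q (height N C η) t ω x
        - relDrift N p q α β γ δ η x t ω * gartner p q (height N C η) t ω x) := by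
  have hZ := h.hasJumpExpansion_gartner hp hq hx hJ
  obtain ⟨L, -, hL⟩ := hZ 0
  have h0 : ∀ ω, |gartner p q (height N C η) 0 ω x| ≤ L := fun ω => by
    have h1 := (hL ω 0 0 le_rfl le_rfl).1
    have h2 : totalRings J (fun i => C i.1 i.2) 0 ω = 0 :=
      Finset.sum_eq_zero fun i _ => h.clocks.zero i ω
    simpa [h2] using h1
  have := (hZ.sub h.clocks.mono (.const h.clocks.mono h0)).sub h.clocks.mono
    ((h.isRingLipschitz_drift hp hq hx hJ).hasJumpExpansion_timeIntegral h.clocks.mono)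
  simp only [sub_zero] at this
  exact this

lemma adapted_noise (h : IsOpenASEP N P F p q α β γ δ C η) (hp : 0 < p) (hq : 0 < q) {x : ℕ}
    (hx : (x : ℕ∞) ≤ N) : Adapted F (noise N p q α β γ δ C η x) := by
  intro t
  have hZ := h.adapted_gartner hx
  refine ((hZ t).sub ((hZ 0).mono (F.mono zero_le) le_rfl)).sub ?_
  exact (h.isRingLipschitz_drift hp hq hx (J := (finite_clocks_le N (x + 1)).toFinset)
    (by simp)).adapted_timeIntegral h.clocks.mono
    (fun s => (h.adapted_relDrift hx s).mul (hZ s)) t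

lemma martingale_noise [IsProbabilityMeasure P] (h : IsOpenASEP N P F p q α β γ δ C η)
    (hp : 0 < p) (hq : 0 < q) {x : ℕ} (hx : (x : ℕ∞) ≤ N) :
    Martingale (noise N p q α β γ δ C η x) F P := by
  have hJ : ∀ i : Bond N × Dir, i.1.1 ≤ x + 1 → i ∈ (finite_clocks_le N (x + 1)).toFinset := by simp
  exact (h.hasJumpExpansion_noise hp hq hx hJ).martingale h.clocks (h.adapted_noise hp hq hx)
    (fun i _ t => (h.adapted_relJump hx _ i t).mul (h.adapted_gartner hx t))
    (noise_compensation hx hJ)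

lemma relBracket_nonneg (x : ℕ) (t : ℝ≥0) (ω : Ω) : 0 ≤ relBracket N p q α β γ δ η x t ω :=
  add_nonneg (mul_nonneg (NNReal.coe_nonneg _) (mul_nonneg (sq_nonneg _)
    (canMoveInd_nonneg _ _ _ _))) (mul_nonneg (NNReal.coe_nonneg _) (mul_nonneg (sq_nonneg _)
    (canMoveInd_nonneg _ _ _ _)))

lemma hasBracketRate_noise_self [IsProbabilityMeasure P] (h : IsOpenASEP N P F p q α β γ δ C η)
    (hp : 0 < p) (hq : 0 < q) {x : ℕ} (hx : (x : ℕ∞) ≤ N) :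
    HasBracketRate P F (noise N p q α β γ δ C η x) (noise N p q α β γ δ C η x) fun t ω =>
      relBracket N p q α β γ δ η x t ω * gartner p q (height N C η) t ω x ^ 2 := by
  have hJ : ∀ i : Bond N × Dir, i.1.1 ≤ x + 1 → i ∈ (finite_clocks_le N (x + 1)).toFinset := by simp
  have hM := h.hasJumpExpansion_noise hp hq hx hJ
  have hZ := (h.hasJumpExpansion_gartner hp hq hx hJ).isRingLipschitz h.clocks.mono
  have hMA := h.adapted_noise hp hq hx
  have hHA : ∀ i : Bond N × Dir, Adapted F fun t ω =>
      relJump η (crossFactor p q) x i t ω * gartner p q (height N C η) t ω x := fun i t =>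
    (h.adapted_relJump hx _ i t).mul (h.adapted_gartner hx t)
  simp only [sq (gartner _ _ _ _ _ _)]
  refine hM.hasBracketRate h.clocks hM hMA hMA (fun i _ => hHA i) (fun i _ => hHA i)
    (noise_compensation hx hJ) (noise_compensation hx hJ)
    ((h.isRingLipschitz_relBracket hx hJ).mul h.clocks.mono (hZ.mul h.clocks.mono hZ))
    (fun t => (h.adapted_relBracket hx t).mul ((h.adapted_gartner hx t).mul
      (h.adapted_gartner hx t))) (fun t ω => ?_)
    fun t ω => mul_nonneg (relBracket_nonneg _ _ _) (mul_self_nonneg _)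
  rw [sum_clocks_eq hx hJ fun i hi => by simp [relJump, hi]]
  simp only [relJump, relBracket, crossFactor, if_true]
  have e1 := canMoveInd_sq (N := N) (η := η) x .right t ω
  have e2 := canMoveInd_sq (N := N) (η := η) x .left t ω
  set Z := gartner p q (height N C η) t ω x
  linear_combination
    (-((attemptRate N p q α β γ δ x .right).toNNReal * (q / p - 1) ^ 2 * Z ^ 2)) * e1
    - ((attemptRate N p q α β γ δ x .left).toNNReal * (p / q - 1) ^ 2 * Z ^ 2) * e2

/-- No clock moves the Gärtner transform at two positions, so the martingale parts are
orthogonal. -/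
lemma hasBracketRate_noise_of_ne [IsProbabilityMeasure P] (h : IsOpenASEP N P F p q α β γ δ C η)
    (hp : 0 < p) (hq : 0 < q) {x y : ℕ} (hx : (x : ℕ∞) ≤ N) (hy : (y : ℕ∞) ≤ N) (hxy : x ≠ y) :
    HasBracketRate P F (noise N p q α β γ δ C η x) (noise N p q α β γ δ C η y)
      fun _ _ => 0 := by
  set J := (finite_clocks_le N (x + y + 1)).toFinset
  have hJ : ∀ i : Bond N × Dir, i.1.1 ≤ x + y + 1 → i ∈ J := by simp [J]
  have hJx : ∀ i : Bond N × Dir, i.1.1 ≤ x + 1 → i ∈ J := fun i hi => hJ i (by omega)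
  have hJy : ∀ i : Bond N × Dir, i.1.1 ≤ y + 1 → i ∈ J := fun i hi => hJ i (by omega)
  refine (h.hasJumpExpansion_noise hp hq hx hJx).hasBracketRate h.clocks
    (h.hasJumpExpansion_noise hp hq hy hJy) (h.adapted_noise hp hq hx) (h.adapted_noise hp hq hy)
    (fun i _ t => (h.adapted_relJump hx _ i t).mul (h.adapted_gartner hx t))
    (fun i _ t => (h.adapted_relJump hy _ i t).mul (h.adapted_gartner hy t))
    (noise_compensation hx hJx) (noise_compensation hy hJy) (.const h.clocks.mono fun _ => le_rfl)
    (fun t => measurable_const) (fun t ω => (Finset.sum_eq_zero fun i _ => ?_).symm)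
    fun _ _ => le_rfl
  by_cases hi : i.1.1 = x
  · have hi' : i.1.1 ≠ y := fun he => hxy (hi.symm.trans he)
    simp [relJump, hi']
  · simp [relJump, hi]

end IsOpenASEP

end OpenASEP

namespace OpenASEP

/-! ### The weakly asymmetric parameters -/

lemma weak_asymmetry {ε p q : ℝ} (hε : 0 < ε) (hp : p = pW ε) (hq : q = qW ε) :
    0 < p ∧ 0 < q ∧ q < p ∧ √p * √q = 1 / 2 ∧ √(p / q) = 2 * p ∧ √(q / p) = 2 * q ∧
      Real.exp (1 / 2 * Real.log (q / p)) = 2 * q := by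
  have hp0 : 0 < p := by rw [hp, pW]; positivity
  have hq0 : 0 < q := by rw [hq, qW]; positivity
  have hpq : p * q = 1 / 4 := by
    have : Real.exp (√ε) * Real.exp (-√ε) = 1 := by rw [← Real.exp_add]; simp
    rw [hp, hq, pW, qW]
    linear_combination (1 / 4 : ℝ) * this
  have e1 : p / q = (2 * p) ^ 2 := by
    rw [div_eq_iff hq0.ne']
    linear_combination (-4 * p) * hpq
  have e2 : q / p = (2 * q) ^ 2 := by
    rw [div_eq_iff hp0.ne']
    linear_combination (-4 * q) * hpq
  refine ⟨hp0, hq0, ?_, ?_, ?_, ?_, ?_⟩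
  · rw [hp, hq, pW, qW]
    have : -√ε < √ε := by linarith [Real.sqrt_pos.2 hε]
    linarith [Real.exp_lt_exp.2 this]
  · rw [← Real.sqrt_mul hp0.le, hpq, show (1 / 4 : ℝ) = (1 / 2) ^ 2 by norm_num,
      Real.sqrt_sq (by norm_num)]
  · rw [e1, Real.sqrt_sq (by positivity)]
  · rw [e2, Real.sqrt_sq (by positivity)]
  · rw [e2, Real.log_pow, ← mul_assoc]
    norm_num
    rw [Real.exp_log (by positivity)]

/-- The boundary rates are nonnegative, and they are chosen such that the mean effect of the
boundary moves is the one of a Robin boundary condition. -/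
lemma boundary_rates {ε p q μ a b : ℝ} (hε : 0 < ε) (hp : p = pW ε) (hq : q = qW ε)
    (hμ : μ ∈ Icc (√(q / p)) (√(p / q))) (ha : a = rateP p q μ) (hb : b = rateQ p q μ) :
    0 ≤ a ∧ a * (q / p - 1) = μ / 2 - p ∧ 0 ≤ b ∧ b * (p / q - 1) = μ / 2 - q := by
  obtain ⟨hp0, hq0, hlt, hs, h1, h2, -⟩ := weak_asymmetry hε hp hq
  have hpw : ∀ y : ℝ, 0 < y → y ^ (3 / 2 : ℝ) = y * √y := fun y hy => by
    rw [Real.sqrt_eq_rpow, show (3 / 2 : ℝ) = 1 + 1 / 2 by norm_num, Real.rpow_add hy,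
      Real.rpow_one]
  have sp := Real.sq_sqrt hp0.le
  have sq := Real.sq_sqrt hq0.le
  have sp0 := Real.sqrt_pos.2 hp0
  have sq0 := Real.sqrt_pos.2 hq0
  have hne : p - q ≠ 0 := by linarith
  have hne' : q - p ≠ 0 := by linarith
  have g1 : 0 ≤ √p - μ * √q := by
    have : μ * √q ≤ √(p / q) * √q := by gcongr; exact hμ.2
    rw [← Real.sqrt_mul (by positivity), div_mul_cancel₀ _ hq0.ne'] at this
    linarith
  have g2 : √q - μ * √p ≤ 0 := by
    have : √(q / p) * √p ≤ μ * √p := by gcongr; exact hμ.1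
    rw [← Real.sqrt_mul (by positivity), div_mul_cancel₀ _ hp0.ne'] at this
    linarith
  refine ⟨?_, ?_, ?_, ?_⟩
  · rw [ha, rateP, hpw p hp0]
    exact div_nonneg (by positivity) (by linarith)
  · rw [ha, rateP, hpw p hp0]
    field_simp
    linear_combination (p - q) * (2 * μ * hs - 2 * sp)
  · rw [hb, rateQ, hpw q hq0]
    exact div_nonneg_of_nonpos (mul_nonpos_of_nonneg_of_nonpos (by positivity) g2) (by linarith)
  · rw [hb, rateQ, hpw q hq0]
    field_simp
    linear_combination (q - p) * (2 * μ * hs - 2 * sq)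

/-! ### The discrete stochastic heat equation -/

variable {Ω : Type*} {mΩ : MeasurableSpace Ω} {N : ℕ∞} {P : Measure Ω} {F : Filtration ℝ≥0 mΩ}
  {p q α β γ δ : ℝ} {C : ℕ → Dir → ℝ≥0 → Ω → ℕ} {η : ℝ≥0 → Ω → ℕ → ℤ}

/-- The Gärtner transform, extended by the Robin boundary conditions to the left of `0` and, for
finite `N`, to the right of `N`. -/
noncomputable def robinField (N : ℕ∞) (p q μA μB : ℝ) (C : ℕ → Dir → ℝ≥0 → Ω → ℕ)
    (η : ℝ≥0 → Ω → ℕ → ℤ) (t : ℝ≥0) (ω : Ω) (z : ℤ) : ℝ :=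
  if z < 0 then μA * gartner p q (height N C η) t ω 0
  else if (z.toNat : ℕ∞) ≤ N then gartner p q (height N C η) t ω z.toNat
  else μB * gartner p q (height N C η) t ω (z.toNat - 1)

lemma robinField_of_le {μA μB : ℝ} {x : ℕ} (hx : (x : ℕ∞) ≤ N) (t : ℝ≥0) (ω : Ω) :
    robinField N p q μA μB C η t ω x = gartner p q (height N C η) t ω x := by
  simp [robinField, hx]

lemma robinField_neg_one {μA μB : ℝ} (t : ℝ≥0) (ω : Ω) :
    robinField N p q μA μB C η t ω (-1) = μA * gartner p q (height N C η) t ω 0 := by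
  simp [robinField]

lemma robinField_succ {μA μB : ℝ} {n : ℕ} (t : ℝ≥0) (ω : Ω) :
    robinField n p q μA μB C η t ω ((n : ℤ) + 1)
      = μB * gartner p q (height n C η) t ω n := by
  have h1 : ((n : ℤ) + 1).toNat = n + 1 := by omega
  have h2 : ¬ ((n : ℤ) + 1 < 0) := by omega
  have h3 : ¬ (((n + 1 : ℕ) : ℕ∞) ≤ n) := by
    rw [Nat.cast_le]
    omega
  rw [robinField, if_neg h2, h1, if_neg h3, Nat.add_sub_cancel]

lemma canMoveInd_bulk {x : ℕ} {t : ℝ≥0} {ω : Ω} (h0 : 0 < x) (hN : (x : ℕ∞) < N)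
    (h1 : η t ω x = 1 ∨ η t ω x = -1) (h2 : η t ω (x + 1) = 1 ∨ η t ω (x + 1) = -1) :
    canMoveInd N η x .right t ω = (1 + η t ω x) * (1 - η t ω (x + 1)) / 4 ∧
    canMoveInd N η x .left t ω = (1 - η t ω x) * (1 + η t ω (x + 1)) / 4 := by
  rcases h1 with h1 | h1 <;> rcases h2 with h2 | h2 <;>
    norm_num [canMoveInd, CanMove, h0, hN, h1, h2]

lemma canMoveInd_left {t : ℝ≥0} {ω : Ω} (hN : (0 : ℕ∞) < N)
    (h : η t ω 1 = 1 ∨ η t ω 1 = -1) :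
    canMoveInd N η 0 .right t ω = (1 - η t ω 1) / 2 ∧
    canMoveInd N η 0 .left t ω = (1 + η t ω 1) / 2 := by
  rcases h with h | h <;> norm_num [canMoveInd, CanMove, hN, h]

lemma canMoveInd_right {n : ℕ} {t : ℝ≥0} {ω : Ω} (hn : 0 < n)
    (h : η t ω n = 1 ∨ η t ω n = -1) :
    canMoveInd n η n .right t ω = (1 + η t ω n) / 2 ∧
    canMoveInd n η n .left t ω = (1 - η t ω n) / 2 := by
  rcases h with h | h <;> norm_num [canMoveInd, CanMove, hn, h]

/-- Neighboring values of the Gärtner transform differ by the factor `√(p / q) = 2p` or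
`√(q / p) = 2q`, according to the occupation of the site between them. -/
lemma gartner_succ (hp : 0 < p) (hq : 0 < q) (hs : √p * √q = 1 / 2)
    (he : Real.exp (1 / 2 * Real.log (q / p)) = 2 * q) {x : ℕ} {t : ℝ≥0} {ω : Ω}
    (h : η t ω (x + 1) = 1 ∨ η t ω (x + 1) = -1) :
    gartner p q (height N C η) t ω (x + 1)
      = gartner p q (height N C η) t ω x * ((1 + η t ω (x + 1)) * p + (1 - η t ω (x + 1)) * q) ∧
    gartner p q (height N C η) t ω x
      = gartner p q (height N C η) t ω (x + 1)
        * ((1 + η t ω (x + 1)) * q + (1 - η t ω (x + 1)) * p) := by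
  have hpq : p * q = 1 / 4 := by
    have h1 := Real.sq_sqrt hp.le
    have h2 := Real.sq_sqrt hq.le
    calc p * q = (√p * √q) ^ 2 := by rw [mul_pow, h1, h2]
      _ = 1 / 4 := by rw [hs]; norm_num
  have he' : Real.exp (-(1 / 2 * Real.log (q / p))) = 2 * p := by
    rw [Real.exp_neg, he]
    exact inv_eq_of_mul_eq_one_right (by linear_combination 4 * hpq)
  have e : gartner p q (height N C η) t ω (x + 1) = gartner p q (height N C η) t ω x
      * Real.exp (-(1 / 2 * Real.log (q / p)) * η t ω (x + 1)) := by
    simp only [gartner, height]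
    rw [Finset.sum_Icc_succ_top (by omega), ← Real.exp_add]
    congr 1
    push_cast
    ring
  rw [e]
  set Z := gartner p q (height N C η) t ω x
  rcases h with h | h
  · simp only [h, Int.cast_one, mul_one, he']
    constructor
    · ring
    · linear_combination (-4 * Z) * hpq
  · simp only [h, Int.cast_neg, Int.cast_one, mul_neg, mul_one, neg_neg, he]
    constructor
    · ring
    · linear_combination (-4 * Z) * hpq

namespace IsOpenASEP

/-- The drift of the Gärtner transform is half its Laplacian: in the bulk for the given `p` and `q`,
and at the ends by the choice of the boundary rates. -/
lemma half_lap_eq (h : IsOpenASEP N P F p q α β γ δ C η) (hN : 1 ≤ N) (hp : 0 < p) (hq : 0 < q)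
    (hs : √p * √q = 1 / 2) (he : Real.exp (1 / 2 * Real.log (q / p)) = 2 * q) {μA μB : ℝ}
    (hA : 0 ≤ α ∧ α * (q / p - 1) = μA / 2 - p ∧ 0 ≤ γ ∧ γ * (p / q - 1) = μA / 2 - q)
    (hB : ∀ n : ℕ, N = n →
      0 ≤ β ∧ β * (q / p - 1) = μB / 2 - p ∧ 0 ≤ δ ∧ δ * (p / q - 1) = μB / 2 - q)
    {x : ℕ} (hx : (x : ℕ∞) ≤ N) (t : ℝ≥0) (ω : Ω) :
    1 / 2 * lap (robinField N p q μA μB C η t ω) x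
      = relDrift N p q α β γ δ η x t ω * gartner p q (height N C η) t ω x := by
  have hν : √(p * q) = 1 / 2 := by rw [Real.sqrt_mul hp.le, hs]
  -- the value to the left
  have hl : robinField N p q μA μB C η t ω ((x : ℤ) - 1)
      = (if x = 0 then μA else (1 + η t ω x) * q + (1 - η t ω x) * p)
        * gartner p q (height N C η) t ω x := by
    rcases x with _ | y
    · simp [robinField]
    · have hy : (y : ℕ∞) ≤ N := le_trans (by exact_mod_cast Nat.le_succ y) hx
      have := (gartner_succ (N := N) (C := C) hp hq hs he (h.spin t ω (y + 1) (by omega) hx)).2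
      rw [show ((y + 1 : ℕ) : ℤ) - 1 = (y : ℤ) by push_cast; ring, robinField_of_le hy, this,
        if_neg (by omega)]
      ring
  -- the value to the right
  have hr : robinField N p q μA μB C η t ω ((x : ℤ) + 1)
      = (if (x : ℕ∞) = N then μB else (1 + η t ω (x + 1)) * p + (1 - η t ω (x + 1)) * q)
        * gartner p q (height N C η) t ω x := by
    split_ifs with hxN
    · subst hxN
      exact robinField_succ t ω
    · have hy : ((x + 1 : ℕ) : ℕ∞) ≤ N := by
        push_cast
        exact Order.add_one_le_of_lt (lt_of_le_of_ne hx hxN)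
      have := (gartner_succ (N := N) (C := C) hp hq hs he (h.spin t ω (x + 1) (by omega) hy)).1
      rw [show (x : ℤ) + 1 = ((x + 1 : ℕ) : ℤ) by push_cast; ring, robinField_of_le hy, this]
      ring
  rw [lap, hl, hr, robinField_of_le hx, relDrift, hν]
  set Z := gartner p q (height N C η) t ω x
  have hpq1 : p * (q / p - 1) = q - p := by field_simp
  have hpq2 : q * (p / q - 1) = p - q := by field_simp
  rcases Nat.eq_zero_or_pos x with rfl | h0
  · have hN0 : (0 : ℕ∞) < N := lt_of_lt_of_le zero_lt_one hN
    obtain ⟨c1, c2⟩ := canMoveInd_left hN0 (h.spin t ω 1 le_rfl (by simpa using hN))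
    have hne : ((0 : ℕ) : ℕ∞) ≠ N := by simpa using hN0.ne
    simp only [attemptRate, if_true, if_neg hne, c1, c2, Real.coe_toNNReal _ hA.1,
      Real.coe_toNNReal _ hA.2.2.1, zero_add]
    linear_combination (-(1 - (η t ω 1 : ℝ)) / 2 * Z) * hA.2.1
      + (-(1 + (η t ω 1 : ℝ)) / 2 * Z) * hA.2.2.2
  · rcases eq_or_ne (x : ℕ∞) N with hxN | hxN
    · subst hxN
      obtain ⟨b1, b2, b3, b4⟩ := hB x rfl
      obtain ⟨c1, c2⟩ := canMoveInd_right h0 (h.spin t ω x h0 le_rfl)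
      simp only [attemptRate, if_true, if_neg h0.ne', c1, c2, Real.coe_toNNReal _ b1,
        Real.coe_toNNReal _ b3]
      linear_combination (-(1 + (η t ω x : ℝ)) / 2 * Z) * b2
        + (-(1 - (η t ω x : ℝ)) / 2 * Z) * b4
    · have hlt := lt_of_le_of_ne hx hxN
      have hy : ((x + 1 : ℕ) : ℕ∞) ≤ N := by
        push_cast
        exact Order.add_one_le_of_lt hlt
      obtain ⟨c1, c2⟩ := canMoveInd_bulk h0 hlt (h.spin t ω x h0 hx)
        (h.spin t ω (x + 1) (by omega) hy)
      simp only [attemptRate, if_neg hxN, if_neg h0.ne', c1, c2, Real.coe_toNNReal _ hp.le,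
        Real.coe_toNNReal _ hq.le]
      linear_combination
        (-(1 + (η t ω x : ℝ)) * (1 - η t ω (x + 1)) / 4 * Z) * hpq1
        + (-(1 - (η t ω x : ℝ)) * (1 + η t ω (x + 1)) / 4 * Z) * hpq2

lemma solvesDSHE [IsProbabilityMeasure P] (h : IsOpenASEP N P F p q α β γ δ C η)
    (hp : 0 < p) (hq : 0 < q) {x : ℕ} (hx : (x : ℕ∞) ≤ N) {μA μB : ℝ}
    (hlap : ∀ t ω, 1 / 2 * lap (robinField N p q μA μB C η t ω) x
      = relDrift N p q α β γ δ η x t ω * gartner p q (height N C η) t ω x) :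
    SolvesDSHE P F (robinField N p q μA μB C η) x (noise N p q α β γ δ C η x) where
  martingale := h.martingale_noise hp hq hx
  zero ω := by simp [noise, timeIntegral]
  integrable ω t := by
    simp only [hlap]
    exact (h.isRingLipschitz_drift hp hq hx (J := (finite_clocks_le N (x + 1)).toFinset)
      (by simp)).intervalIntegrable h.clocks.mono ω _ _
  equation t ω := by
    simp only [hlap, robinField_of_le hx, noise]
    ring

lemma relBracket_bulk (h : IsOpenASEP N P F p q α β γ δ C η) (hp : 0 < p) (hq : 0 < q) {x : ℕ}
    (h0 : 0 < x) (hx : (x : ℕ∞) < N) (t : ℝ≥0) (ω : Ω) :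
    relBracket N p q α β γ δ η x t ω
      = (q / p - 1) ^ 2 * cR p (η t ω) x + (p / q - 1) ^ 2 * cL q (η t ω) x := by
  have hy : ((x + 1 : ℕ) : ℕ∞) ≤ N := by
    push_cast
    exact Order.add_one_le_of_lt hx
  obtain ⟨c1, c2⟩ := canMoveInd_bulk h0 hx (h.spin t ω x h0 hx.le)
    (h.spin t ω (x + 1) (by omega) hy)
  simp only [relBracket, attemptRate, if_neg hx.ne, if_neg h0.ne', c1, c2,
    Real.coe_toNNReal _ hp.le, Real.coe_toNNReal _ hq.le, cR, cL]
  ring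

lemma relBracket_left (h : IsOpenASEP N P F p q α β γ δ C η) (hN : 1 ≤ N) (hα : 0 ≤ α)
    (hγ : 0 ≤ γ) (t : ℝ≥0) (ω : Ω) :
    relBracket N p q α β γ δ η 0 t ω
      = (q / p - 1) ^ 2 * rPlus α (η t ω 1) + (p / q - 1) ^ 2 * rMinus γ (η t ω 1) := by
  obtain ⟨c1, c2⟩ := canMoveInd_left (lt_of_lt_of_le zero_lt_one hN)
    (h.spin t ω 1 le_rfl (by simpa using hN))
  simp only [relBracket, attemptRate, if_true, c1, c2, Real.coe_toNNReal _ hα,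
    Real.coe_toNNReal _ hγ, rPlus, rMinus]
  ring

lemma relBracket_right {n : ℕ} (h : IsOpenASEP n P F p q α β γ δ C η) (hn : 0 < n) (hβ : 0 ≤ β)
    (hδ : 0 ≤ δ) (t : ℝ≥0) (ω : Ω) :
    relBracket n p q α β γ δ η n t ω
      = (q / p - 1) ^ 2 * rMinus β (η t ω n) + (p / q - 1) ^ 2 * rPlus δ (η t ω n) := by
  obtain ⟨c1, c2⟩ := canMoveInd_right hn (h.spin t ω n hn le_rfl)
  simp only [relBracket, attemptRate, if_true, if_neg hn.ne', c1, c2, Real.coe_toNNReal _ hβ,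
    Real.coe_toNNReal _ hδ, rPlus, rMinus]
  ring

end IsOpenASEP

end OpenASEP

theorem mainTheorem10 {Ω : Type*} {mΩ : MeasurableSpace Ω} (P : Measure Ω)
    [IsProbabilityMeasure P] (F : Filtration ℝ≥0 mΩ)
    (C : ℕ → OpenASEP.Dir → ℝ≥0 → Ω → ℕ) (η : ℝ≥0 → Ω → ℕ → ℤ)
    (ε : ℝ) (hε : 0 < ε) (p q : ℝ) (hp : p = OpenASEP.pW ε) (hq : q = OpenASEP.qW ε)
    (μA : ℝ) (hμA : μA ∈ Set.Icc (√(q / p)) (√(p / q)))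
    (α γ : ℝ) (hα : α = OpenASEP.rateP p q μA) (hγ : γ = OpenASEP.rateQ p q μA) :
    -- the half line
    (OpenASEP.IsASEPH P F p q α γ C η →
      ∃ (Z : ℝ≥0 → Ω → ℤ → ℝ) (M : ℕ → ℝ≥0 → Ω → ℝ),
        (∀ t ω (x : ℕ), Z t ω x = OpenASEP.gartner p q (OpenASEP.height ⊤ C η) t ω x) ∧
        (∀ t ω, Z t ω (-1) = μA * Z t ω 0) ∧
        (∀ x : ℕ, OpenASEP.SolvesDSHE P F Z x (M x)) ∧
        (∀ x y : ℕ, x ≠ y → OpenASEP.HasBracketRate P F (M x) (M y) fun _ _ => 0) ∧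
        (∀ x : ℕ, 0 < x → OpenASEP.HasBracketRate P F (M x) (M x) fun t ω =>
          ((q / p - 1) ^ 2 * OpenASEP.cR p (η t ω) x
            + (p / q - 1) ^ 2 * OpenASEP.cL q (η t ω) x) * Z t ω x ^ 2) ∧
        OpenASEP.HasBracketRate P F (M 0) (M 0) fun t ω =>
          ((q / p - 1) ^ 2 * OpenASEP.rPlus α (η t ω 1)
            + (p / q - 1) ^ 2 * OpenASEP.rMinus γ (η t ω 1)) * Z t ω 0 ^ 2) ∧
    -- the bounded interval
    (∀ (N : ℕ) (_ : 1 ≤ N) (μB : ℝ) (_ : μB ∈ Set.Icc (√(q / p)) (√(p / q)))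
      (β δ : ℝ) (_ : β = OpenASEP.rateP p q μB) (_ : δ = OpenASEP.rateQ p q μB),
      OpenASEP.IsASEPB N P F p q α β γ δ C η →
      ∃ (Z : ℝ≥0 → Ω → ℤ → ℝ) (M : ℕ → ℝ≥0 → Ω → ℝ),
        (∀ t ω (x : ℕ), x ≤ N →
          Z t ω x = OpenASEP.gartner p q (OpenASEP.height N C η) t ω x) ∧
        (∀ t ω, Z t ω (-1) = μA * Z t ω 0) ∧
        (∀ t ω, Z t ω ((N : ℤ) + 1) = μB * Z t ω N) ∧
        (∀ x : ℕ, x ≤ N → OpenASEP.SolvesDSHE P F Z x (M x)) ∧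
        (∀ x y : ℕ, x ≤ N → y ≤ N → x ≠ y →
          OpenASEP.HasBracketRate P F (M x) (M y) fun _ _ => 0) ∧
        (∀ x : ℕ, 0 < x → x < N → OpenASEP.HasBracketRate P F (M x) (M x) fun t ω =>
          ((q / p - 1) ^ 2 * OpenASEP.cR p (η t ω) x
            + (p / q - 1) ^ 2 * OpenASEP.cL q (η t ω) x) * Z t ω x ^ 2) ∧
        (OpenASEP.HasBracketRate P F (M 0) (M 0) fun t ω =>
          ((q / p - 1) ^ 2 * OpenASEP.rPlus α (η t ω 1)
            + (p / q - 1) ^ 2 * OpenASEP.rMinus γ (η t ω 1)) * Z t ω 0 ^ 2) ∧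
        OpenASEP.HasBracketRate P F (M N) (M N) fun t ω =>
          ((q / p - 1) ^ 2 * OpenASEP.rMinus β (η t ω N)
            + (p / q - 1) ^ 2 * OpenASEP.rPlus δ (η t ω N)) * Z t ω N ^ 2) := by
  obtain ⟨hp0, hq0, -, hs, -, -, he⟩ := OpenASEP.weak_asymmetry hε hp hq
  have hA := OpenASEP.boundary_rates hε hp hq hμA hα hγ
  constructor
  · intro h
    have hx : ∀ x : ℕ, (x : ℕ∞) ≤ ⊤ := fun _ => le_top
    have hlap : ∀ (x : ℕ) t ω,
        1 / 2 * OpenASEP.lap (OpenASEP.robinField ⊤ p q μA 0 C η t ω) x = _ :=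
      fun x t ω => h.half_lap_eq le_top hp0 hq0 hs he (μB := 0) hA
        (fun n hn => absurd hn (ENat.top_ne_natCast n)) (hx x) t ω
    have hZ : ∀ t ω (x : ℕ), OpenASEP.robinField ⊤ p q μA 0 C η t ω x
        = OpenASEP.gartner p q (OpenASEP.height ⊤ C η) t ω x :=
      fun t ω x => OpenASEP.robinField_of_le (hx x) t ω
    have hZ0 := fun t ω => hZ t ω 0
    rw [Nat.cast_zero] at hZ0
    refine ⟨OpenASEP.robinField ⊤ p q μA 0 C η, OpenASEP.noise ⊤ p q α 0 γ 0 C η, hZ,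
      fun t ω => by rw [hZ0, OpenASEP.robinField_neg_one],
      fun x => h.solvesDSHE hp0 hq0 (hx x) (hlap x),
      fun x y hxy => h.hasBracketRate_noise_of_ne hp0 hq0 (hx x) (hx y) hxy, fun x h0 => ?_, ?_⟩
    · have := h.hasBracketRate_noise_self hp0 hq0 (hx x)
      simp only [h.relBracket_bulk hp0 hq0 h0 (ENat.natCast_lt_top x)] at this
      simpa only [hZ] using this
    · have := h.hasBracketRate_noise_self hp0 hq0 (hx 0)
      simp only [h.relBracket_left le_top hA.1 hA.2.2.1] at this
      simpa only [hZ0] using this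
  · intro N hN μB hμB β δ hβ hδ h
    have hB := OpenASEP.boundary_rates hε hp hq hμB hβ hδ
    have hx : ∀ x : ℕ, x ≤ N → (x : ℕ∞) ≤ (N : ℕ∞) := fun x h => by exact_mod_cast h
    have hN1 : (1 : ℕ∞) ≤ N := by exact_mod_cast hN
    have hlap : ∀ (x : ℕ) (_ : x ≤ N) t ω,
        1 / 2 * OpenASEP.lap (OpenASEP.robinField N p q μA μB C η t ω) x = _ :=
      fun x hxN t ω => h.half_lap_eq hN1 hp0 hq0 hs he (μB := μB) hA (fun _ _ => hB) (hx x hxN) t ω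
    have hZ : ∀ t ω (x : ℕ), x ≤ N → OpenASEP.robinField N p q μA μB C η t ω x
        = OpenASEP.gartner p q (OpenASEP.height N C η) t ω x :=
      fun t ω x hxN => OpenASEP.robinField_of_le (hx x hxN) t ω
    have hZ0 := fun t ω => hZ t ω 0 (Nat.zero_le N)
    rw [Nat.cast_zero] at hZ0
    refine ⟨OpenASEP.robinField N p q μA μB C η, OpenASEP.noise N p q α β γ δ C η, hZ,
      fun t ω => by rw [hZ0, OpenASEP.robinField_neg_one],
      fun t ω => by rw [hZ t ω N le_rfl, OpenASEP.robinField_succ],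
      fun x hxN => h.solvesDSHE hp0 hq0 (hx x hxN) (hlap x hxN),
      fun x y hxN hyN hxy => h.hasBracketRate_noise_of_ne hp0 hq0 (hx x hxN) (hx y hyN) hxy,
      fun x h0 hxN => ?_, ?_, ?_⟩
    · have := h.hasBracketRate_noise_self hp0 hq0 (hx x hxN.le)
      simp only [h.relBracket_bulk hp0 hq0 h0 (by exact_mod_cast hxN)] at this
      simpa only [hZ _ _ x hxN.le] using this
    · have := h.hasBracketRate_noise_self hp0 hq0 (hx 0 (Nat.zero_le N))
      simp only [h.relBracket_left hN1 hA.1 hA.2.2.1] at this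
      simpa only [hZ0] using this
    · have := h.hasBracketRate_noise_self hp0 hq0 (hx N le_rfl)
      simp only [h.relBracket_right hN hB.1 hB.2.2.1] at this
      simpa only [hZ _ _ N le_rfl] using this
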